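/- **Auxiliary functions.** Let $R,h,\lambda\in C^\infty(\mathbb R)$ satisfy: $R(r)=r$ for $r\le 1$, $R(r)=3$ for $r\ge 5$, $R'>0$ on $(1,5)$, $-\tfrac12\le R''\le 0$; $h(r)=1+e^r$ for $r\le -1$, $h(r)=2e^r$ for $r\ge 1$, $h\ge 1$ and $h',h''>0$; $\lambda\ge 0$, $\operatorname{supp}\lambda\subset[-1,1]$, $\int\lambda=1$. (Such functions exist.) Put $\bar f(s)=1$ for $s\le 0$, $\bar f(s)=e^s$ for $s>0$, $f=\lambda*\bar f$, and $c=(\lambda*e^t)(0)$. Let $a>5$, $\delta=(a-5)/2$ and $b=c^{-1}e^{-(a-\delta)}\sinh(a-\delta-5)$. Write $S^1(c_i)=\mathbb R/c_i\mathbb Z$. **Proposition.** There are $C^\infty$ functions $\tilde F$ on $\mathbb R^2$ and $T$ on $\mathbb R$ and a constant $C<0$ such that * $\tilde F(r,t)=b\,e^{R(r)}f(t-R(r))$ for $t\le 5$, $\tilde F(r,t)=\sinh(t-5)$ for $t\ge a$, $\tilde F_t,\tilde F_{tt}\ge 0$, and $\tilde F(r,t)$ is independent of $r$ in the region $t\ge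 4$ and also in the region $r\ge 5$; * $T(t)=1$ for $t\le 4$, $T(t)=\cosh(t-5)$ for $t\ge a$, $T\ge 1$, $T',T''\ge 0$; and such that the following holds for every $n\ge 2$, every closed hyperbolic manifold $N$ of dimension $n-2$, with hyperbolic metric $g_N$ (locally $g_N=dw^2+\sum_{j=1}^{n-3}e^{2w}dw_j^2$), and all $c_1,c_2>0$. There is a smooth Riemannian metric $g$ on $\mathbb R\times\mathbb R\times S^1(c_1)\times S^1(c_2)\times N$, with points $(r,t,\rho,\tau,x)$, that is invariant under rotations of each circle and satisfies: 1. All sectional curvatures satisfy $C\le K<0$. (In particular $C$ does not depend on $c_1,c_2$.) 2. The subset $\{r\le -1,\ r-1\le t\le 2\}$ has finite volume. 3. For $r\le 0$ and $t\le r-1$: $g=dr^2+h(r)^2\bigl(dt^2+b^2e^{2r}d\rho^2+b^2e^{2r}d\tau^2+g_N\bigr)$. 4. For $r\ge 0$ and $t\le -1$: $g=dr^2+h(r)^2\bigl(dt^2+b^2e^{2R(r)}d\rho^2+b^2e^{2R(r)}d\tau^2+g_N\bigr)$. 5. For all $r$ and $t\ge a$: $g=dr^2+h(r)^2\bigl(dt^2+b^2e^{2R(r)}d\rho^2+\sinh^2(t-5)\,d\tau^2+\cosh^2(t-5)\,g_N\bigr)$.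 6. For $r\ge 5$: $g=dr^2+4e^{2r}\hat g$, where $\hat g=dt^2+b^2e^6d\rho^2+\tilde F(r,t)^2d\tau^2+T(t)^2g_N$ is a Riemannian metric on $\mathbb R\times S^1(c_1)\times S^1(c_2)\times N$ which is independent of $r$ for $r\ge 5$. 7. All sectional curvatures of $\hat g$ are $\le 0$. -/

import Mathlib

open Set MeasureTheory Bundle
open scoped Manifold ContDiff ENNReal

/-! ### Riemannian metrics on manifolds without boundary: curvature and volume -/

section Riemannian

variable {E : Type*} [NormedAddCommGroup E] [NormedSpace ℝ E]

/-- Christoffel symbols `Γ(u, v)` at `y` of a metric `G` given on an open subset of a finite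
dimensional vector space: the vector with
`2 G(Γ(u, v), w) = ∂_u G(v, w) + ∂_v G(u, w) - ∂_w G(u, v)` for all `w`. -/
noncomputable def christoffel (G : E → E →L[ℝ] E →L[ℝ] ℝ) (y u v : E) : E :=
  (G y).inverse
    ((1 / 2 : ℝ) •
      (fderiv ℝ G y u v + fderiv ℝ G y v u - fderiv ℝ (fun z => G z u v) y))

/-- The Riemann curvature tensor `R(u, v) w`, i.e.
`R_{ijk}^l = ∂_i Γ^l_{jk} - ∂_j Γ^l_{ik} + Γ^l_{im} Γ^m_{jk} - Γ^l_{jm} Γ^m_{ik}`. -/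
noncomputable def riemannTensor (G : E → E →L[ℝ] E →L[ℝ] ℝ) (y u v w : E) : E :=
  fderiv ℝ (fun z => christoffel G z v w) y u - fderiv ℝ (fun z => christoffel G z u w) y v
    + christoffel G y u (christoffel G y v w) - christoffel G y v (christoffel G y u w)

/-- Sectional curvature at `y` of the plane spanned by linearly independent `u`, `v`. -/
noncomputable def localSectionalCurvature (G : E → E →L[ℝ] E →L[ℝ] ℝ) (y u v : E) : ℝ :=
  G y (riemannTensor G y u v v) u / (G y u u * G y v v - (G y u v) ^ 2)

variable {H : Type*} [TopologicalSpace H] (I : ModelWithCorners ℝ E H)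
  (M : Type*) [TopologicalSpace M] [ChartedSpace H M] [IsManifold I ∞ M]

/-- Smooth Riemannian metrics on the manifold `M`. -/
abbrev RMetric : Type _ := ContMDiffRiemannianMetric I ∞ E (fun x : M => TangentSpace I x)

variable {I M}

/-- The coordinate expression of `g` in the preferred chart at `p`. -/
noncomputable def localMetric (g : RMetric I M) (p : M) (y : E) : E →L[ℝ] E →L[ℝ] ℝ :=
  let q : M := (extChartAt I p).symm y
  let D : E →L[ℝ] E := mfderiv 𝓘(ℝ, E) I (extChartAt I p).symm y
  let G : E →L[ℝ] E →L[ℝ] ℝ := g.inner q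
  G.bilinearComp D D

/-- Sectional curvature of `g` at `p` on the plane spanned by tangent vectors `u`, `v`. (The tangent
space at `p` is identified with the model vector space by the preferred chart at `p`.) -/
noncomputable def sectionalCurvature (g : RMetric I M) (p : M) (u v : TangentSpace I p) : ℝ :=
  localSectionalCurvature (localMetric g p) (extChartAt I p p) u v

/-- The set of values of the sectional curvature of `g`, over all points and all `2`-planes. -/
def sectionalCurvatures (g : RMetric I M) : Set ℝ :=
  {K | ∃ (p : M) (u v : TangentSpace I p),
    LinearIndependent ℝ ![u, v] ∧ K = sectionalCurvature g p u v}

/-- `φ` preserves the Riemannian metric `g`. -/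
def PreservesMetric (g : RMetric I M) (φ : M → M) : Prop :=
  ContMDiff I I ∞ φ ∧ ∀ (p : M) (u v : TangentSpace I p),
    g.inner (φ p) (mfderiv I I φ p u) (mfderiv I I φ p v) = g.inner p u v

variable [FiniteDimensional ℝ E] [MeasurableSpace E] [BorelSpace E]

/-- The Riemannian volume measure on the domain of the preferred chart at `p`: in coordinates it is
`√(det g_ij)` times Lebesgue measure, both with respect to the same basis of the vector space. -/
noncomputable def chartVolume (g : RMetric I M) (p : M) : @Measure M (borel M) :=
  letI : MeasurableSpace M := borel M
  let b := Module.finBasis ℝ E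
  ((b.addHaar.restrict (extChartAt I p).target).withDensity
      (fun y => ENNReal.ofReal
        (Real.sqrt (Matrix.det (Matrix.of fun i j => localMetric g p y (b i) (b j)))))).map
    (extChartAt I p).symm

/-- The Riemannian volume measure on Borel sets. The measures on the chart domains agree on overlaps,
so that their supremum in the lattice of measures is the measure they glue to. -/
noncomputable def riemannianVolume (g : RMetric I M) : @Measure M (borel M) :=
  ⨆ p : M, chartVolume g p

end Riemannian

/-! ### The circle `ℝ / cℤ` as a smooth manifold -/

section Circle

/-- The inverse of the covering `ℝ → ℝ / cℤ` restricted to the interval `(a, a + c)`. -/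
noncomputable def circleChart (c : ℝ) [Fact (0 < c)] (a : ℝ) :
    OpenPartialHomeomorph (AddCircle c) ℝ :=
  (AddCircle.openPartialHomeomorphCoe c a).symm

theorem mem_circleChart_source (c : ℝ) [hc : Fact (0 < c)] (x : AddCircle c) :
    x ∈ (circleChart c ((AddCircle.equivIco c 0 x : ℝ) - c / 2)).source := by
  have h := hc.out
  have h1 := (AddCircle.openPartialHomeomorphCoe c
    ((AddCircle.equivIco c 0 x : ℝ) - c / 2)).map_source
    (x := (AddCircle.equivIco c 0 x : ℝ)) (by
      simp only [AddCircle.openPartialHomeomorphCoe_source, mem_Ioo]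
      constructor <;> linarith)
  simpa [circleChart, AddCircle.coe_equivIco] using h1

noncomputable instance circleChartedSpace (c : ℝ) [Fact (0 < c)] :
    ChartedSpace ℝ (AddCircle c) where
  atlas := range (circleChart c)
  chartAt x := circleChart c ((AddCircle.equivIco c 0 x : ℝ) - c / 2)
  mem_chart_source x := mem_circleChart_source c x
  chart_mem_atlas _ := mem_range_self _

instance circleIsManifold (c : ℝ) [Fact (0 < c)] : IsManifold 𝓘(ℝ, ℝ) ∞ (AddCircle c) := by
  apply isManifold_of_contDiffOn
  rintro e e' ⟨a, rfl⟩ ⟨a', rfl⟩ x hx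
  apply ContDiffAt.contDiffWithinAt
  simp only [circleChart, OpenPartialHomeomorph.symm_symm, modelWithCornersSelf_coe,
    modelWithCornersSelf_coe_symm, range_id, inter_univ, preimage_id_eq, id_eq,
    OpenPartialHomeomorph.trans_source, mem_inter_iff, mem_preimage] at hx ⊢
  obtain ⟨_, hx2⟩ := hx
  have hy := (AddCircle.openPartialHomeomorphCoe c a').symm.map_source hx2
  have hxy := (AddCircle.openPartialHomeomorphCoe c a').symm.left_inv hx2
  set y : ℝ := (AddCircle.openPartialHomeomorphCoe c a').symm
    ((AddCircle.openPartialHomeomorphCoe c a) x) with hyd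
  have hy' : y ∈ Ioo a' (a' + c) := by simpa using hy
  have hc0 : ((y - x : ℝ) : AddCircle c) = 0 := by
    have : ((y : ℝ) : AddCircle c) = (x : AddCircle c) := by simpa using hxy
    rw [AddCircle.coe_sub, this, sub_self]
  have hcont : ContDiffAt ℝ ∞ (fun z : ℝ => z + (y - x)) x := by fun_prop
  refine hcont.congr_of_eventuallyEq ?_
  have hnear : ∀ᶠ z in nhds x, z + (y - x) ∈ Ioo a' (a' + c) := by
    have : ContinuousAt (fun z : ℝ => z + (y - x)) x := by fun_prop
    apply this.eventually_mem
    have e : x + (y - x) = y := by ring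
    rw [e]
    exact isOpen_Ioo.mem_nhds hy'
  filter_upwards [hnear] with z hz
  have h2 : ((z : ℝ) : AddCircle c) = ((z + (y - x) : ℝ) : AddCircle c) := by
    rw [AddCircle.coe_add, hc0, add_zero]
  simp only [Function.comp_apply, OpenPartialHomeomorph.coe_trans, id_eq,
    AddCircle.openPartialHomeomorphCoe_apply, AddCircle.openPartialHomeomorphCoe_symm_apply]
  rw [h2, AddCircle.equivIco_coe_eq (Ioo_subset_Ico_self hz)]

end Circle

/-! ### Hyperbolic manifolds -/

section Hyperbolic

/-- `ℝ^m`, the model of an `m`-dimensional manifold. -/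
abbrev Euc (m : ℕ) : Type := EuclideanSpace ℝ (Fin m)

/-- The hyperbolic metric `dw² + ∑_{j=1}^{m-1} e^{2w} dw_j²` on `ℝ^m` at the point
`x = (w, w_1, …, w_{m-1})`. With it `ℝ^m` is isometric to hyperbolic `m`-space. -/
noncomputable def hypMetric {m : ℕ} (x u v : Euc m) : ℝ :=
  ∑ i : Fin m, (if i.val = 0 then 1 else Real.exp (2 * x ⟨0, i.pos⟩)) * (u i * v i)

/-- `N` is a hyperbolic `m`-manifold: it has an atlas of charts in hyperbolic `m`-space whose
transition maps are smooth local isometries of hyperbolic space. -/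
class HyperbolicManifold (m : ℕ) (N : Type*) [TopologicalSpace N] [ChartedSpace (Euc m) N] :
    Prop where
  contDiffOn_transition : ∀ e ∈ atlas (Euc m) N, ∀ e' ∈ atlas (Euc m) N,
    ContDiffOn ℝ ∞ (e.symm ≫ₕ e') (e.symm ≫ₕ e').source
  isometry_transition : ∀ e ∈ atlas (Euc m) N, ∀ e' ∈ atlas (Euc m) N,
    ∀ x ∈ (e.symm ≫ₕ e').source, ∀ u v : Euc m,
      hypMetric ((e.symm ≫ₕ e') x) (fderiv ℝ (e.symm ≫ₕ e') x u) (fderiv ℝ (e.symm ≫ₕ e') x v)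
        = hypMetric x u v

instance HyperbolicManifold.isManifold (m : ℕ) (N : Type*) [TopologicalSpace N]
    [ChartedSpace (Euc m) N] [HyperbolicManifold m N] : IsManifold (𝓡 m) ∞ N := by
  apply isManifold_of_contDiffOn
  intro e e' he he'
  simpa using HyperbolicManifold.contDiffOn_transition e he e' he'

/-- The hyperbolic metric `g_N` of `N` on the tangent space at `x`, which is identified with `ℝ^m`
by the preferred chart at `x`. -/
noncomputable def hypForm {m : ℕ} {N : Type*} [TopologicalSpace N] [ChartedSpace (Euc m) N]
    (x : N) (u v : Euc m) : ℝ :=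
  hypMetric (chartAt (Euc m) x x) u v

end Hyperbolic

/-! ### The auxiliary functions -/

section Profiles

/-- The conditions under which the functions `R`, `h` and the mollifier `lam` are picked. -/
structure IsProfile (R h lam : ℝ → ℝ) : Prop where
  R_smooth : ContDiff ℝ ∞ R
  R_left : ∀ r ≤ 1, R r = r
  R_right : ∀ r, 5 ≤ r → R r = 3
  R_deriv : ∀ r ∈ Ioo (1 : ℝ) 5, 0 < deriv R r
  R_deriv2 : ∀ r, -(1 / 2) ≤ deriv (deriv R) r ∧ deriv (deriv R) r ≤ 0
  h_smooth : ContDiff ℝ ∞ h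
  h_left : ∀ r ≤ -1, h r = 1 + Real.exp r
  h_right : ∀ r, 1 ≤ r → h r = 2 * Real.exp r
  h_ge : ∀ r, 1 ≤ h r
  h_deriv : ∀ r, 0 < deriv h r
  h_deriv2 : ∀ r, 0 < deriv (deriv h) r
  lam_smooth : ContDiff ℝ ∞ lam
  lam_nonneg : ∀ x, 0 ≤ lam x
  lam_support : tsupport lam ⊆ Icc (-1) 1
  lam_integral : ∫ x, lam x = 1

/-- The convolution `(lam * φ)(x) = ∫ φ(t) lam(x - t) dt`. -/
noncomputable def mollify (lam φ : ℝ → ℝ) (x : ℝ) : ℝ := ∫ t, φ t * lam (x - t)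

/-- The function `1` for `s ≤ 0` and `e^s` for `s > 0`. -/
noncomputable def fbar (s : ℝ) : ℝ := if s ≤ 0 then 1 else Real.exp s

/-- `b = c⁻¹ e^{-(a-δ)} sinh(a-δ-5)`, where `c = (lam * e^t)(0)` and `δ = (a-5)/2`. -/
noncomputable def bConst (lam : ℝ → ℝ) (a : ℝ) : ℝ :=
  (mollify lam Real.exp 0)⁻¹ * Real.exp (-(a - (a - 5) / 2)) * Real.sinh (a - (a - 5) / 2 - 5)

/-- The conditions on the function `F̃(r, t)`. -/
structure IsFtilde (R lam : ℝ → ℝ) (a : ℝ) (F : ℝ → ℝ → ℝ) : Prop where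
  smooth : ContDiff ℝ ∞ (fun q : ℝ × ℝ => F q.1 q.2)
  left : ∀ r, ∀ t ≤ 5, F r t = bConst lam a * Real.exp (R r) * mollify lam fbar (t - R r)
  right : ∀ r t, a ≤ t → F r t = Real.sinh (t - 5)
  deriv_nonneg : ∀ r t, 0 ≤ deriv (F r) t
  deriv2_nonneg : ∀ r t, 0 ≤ deriv (deriv (F r)) t
  indep_t : ∀ r r' t, 4 ≤ t → F r t = F r' t
  indep_r : ∀ r r' t, 5 ≤ r → 5 ≤ r' → F r t = F r' t

/-- The conditions on the function `T(t)`. -/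
structure IsT (a : ℝ) (T : ℝ → ℝ) : Prop where
  smooth : ContDiff ℝ ∞ T
  left : ∀ t ≤ 4, T t = 1
  right : ∀ t, a ≤ t → T t = Real.cosh (t - 5)
  ge_one : ∀ t, 1 ≤ T t
  deriv_nonneg : ∀ t, 0 ≤ deriv T t
  deriv2_nonneg : ∀ t, 0 ≤ deriv (deriv T) t

end Profiles

/-! ### The product manifolds -/

section Product

/-- `ℝ × S¹(c₁) × S¹(c₂) × N`, with points `(t, ρ, τ, x)`; here `S¹(c) = ℝ / cℤ`. -/
abbrev ProdFiber (c₁ c₂ : ℝ) (N : Type*) : Type _ := ℝ × AddCircle c₁ × AddCircle c₂ × N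

/-- `ℝ × ℝ × S¹(c₁) × S¹(c₂) × N`, with points `(r, t, ρ, τ, x)`. -/
abbrev ProdTotal (c₁ c₂ : ℝ) (N : Type*) : Type _ := ℝ × ProdFiber c₁ c₂ N

noncomputable abbrev fiberModel (m : ℕ) :=
  𝓘(ℝ, ℝ).prod (𝓘(ℝ, ℝ).prod (𝓘(ℝ, ℝ).prod (𝓡 m)))

noncomputable abbrev totalModel (m : ℕ) := 𝓘(ℝ, ℝ).prod (fiberModel m)

/-- The bilinear form `dt² + A² dρ² + B² dτ² + T² g_N` on the tangent space of
`ℝ × S¹(c₁) × S¹(c₂) × N` at a point `(t, ρ, τ, x)`. The entries of a tangent vector are its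
components along `ℝ`, the two circles (with respect to `∂/∂ρ`, `∂/∂τ`) and `N`. -/
noncomputable def fiberForm {m : ℕ} {N : Type*} [TopologicalSpace N] [ChartedSpace (Euc m) N]
    (A B T : ℝ) (x : N) (u v : ℝ × ℝ × ℝ × Euc m) : ℝ :=
  u.1 * v.1 + A ^ 2 * (u.2.1 * v.2.1) + B ^ 2 * (u.2.2.1 * v.2.2.1)
    + T ^ 2 * hypForm x u.2.2.2 v.2.2.2

/-- Rotation of the two circles. -/
def rotate {c₁ c₂ : ℝ} {N : Type*} (α : AddCircle c₁) (β : AddCircle c₂) (p : ProdTotal c₁ c₂ N) :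
    ProdTotal c₁ c₂ N :=
  (p.1, p.2.1, p.2.2.1 + α, p.2.2.2.1 + β, p.2.2.2.2)

end Product

/-! ### Smoothed ramps and the existence of profiles -/

section Ramp

theorem contDiff_infty_of_hasDerivAt {f f' : ℝ → ℝ} (h : ∀ x, HasDerivAt f (f' x) x)
    (hf' : ContDiff ℝ ∞ f') : ContDiff ℝ ∞ f := by
  rw [contDiff_infty_iff_deriv]
  refine ⟨fun x => (h x).differentiableAt, ?_⟩
  rwa [show deriv f = f' from funext fun x => (h x).deriv]

/-- `θ` is a smoothing of `max 0 t` on `[-ε, ε]` with first derivative `σ` and second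
derivative `μ`. -/
structure IsSmoothRamp (ε : ℝ) (θ σ μ : ℝ → ℝ) : Prop where
  smooth : ContDiff ℝ ∞ θ
  hasDerivAt : ∀ t, HasDerivAt θ (σ t) t
  hasDerivAt' : ∀ t, HasDerivAt σ (μ t) t
  left : ∀ t ≤ -ε, θ t = 0
  deriv_left : ∀ t ≤ -ε, σ t = 0
  right : ∀ t, ε ≤ t → θ t = t
  deriv_nonneg : ∀ t, 0 ≤ σ t
  deriv_le_one : ∀ t, σ t ≤ 1
  deriv_lt_one : ∀ t < ε, σ t < 1
  nonneg : ∀ t, 0 ≤ θ t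
  deriv2_nonneg : ∀ t, 0 ≤ μ t
  deriv2_le : ∀ t, μ t ≤ 1 / ε

theorem exists_isSmoothRamp {ε : ℝ} (hε : 0 < ε) : ∃ θ σ μ, IsSmoothRamp ε θ σ μ := by
  let B : ContDiffBump (0 : ℝ) := ⟨ε / 2, ε, by positivity, by linarith⟩
  set μ : ℝ → ℝ := B.normed volume with hμ
  have hμs : ContDiff ℝ ∞ μ := B.contDiff_normed
  have hμc : Continuous μ := hμs.continuous
  have hμ0 : ∀ t, 0 ≤ μ t := B.nonneg_normed
  have hμsupp : Function.support μ = Ioo (-ε) ε := by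
    rw [hμ, B.support_normed_eq, Real.ball_eq_Ioo]; simp [B]
  have hμz : ∀ t, t ∉ Ioo (-ε) ε → μ t = 0 := fun t ht => by
    rwa [← hμsupp, Function.notMem_support] at ht
  have hμpos : ∀ t ∈ Ioo (-ε) ε, 0 < μ t := fun t ht => by
    rw [← hμsupp] at ht
    exact lt_of_le_of_ne (hμ0 t) (Ne.symm ht)
  have hμneg : ∀ t, μ (-t) = μ t := fun t => B.normed_neg t
  set σ : ℝ → ℝ := fun t => ∫ s in (-ε)..t, μ s with hσ
  have hσd : ∀ t, HasDerivAt σ (μ t) t := fun t => hμc.integral_hasStrictDerivAt (-ε) t |>.hasDerivAt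
  have hσs : ContDiff ℝ ∞ σ := contDiff_infty_of_hasDerivAt hσd hμs
  have hσc := hσs.continuous
  set θ : ℝ → ℝ := fun t => ∫ s in (-ε)..t, σ s with hθ
  have hθd : ∀ t, HasDerivAt θ (σ t) t := fun t => hσc.integral_hasStrictDerivAt (-ε) t |>.hasDerivAt
  have hσl : ∀ t ≤ -ε, σ t = 0 := fun t ht => by
    rw [hσ]
    simp only
    rw [intervalIntegral.integral_congr (g := fun _ => (0 : ℝ))]
    · simp
    · intro s hs
      rw [uIcc_of_ge ht] at hs
      exact hμz s fun h => absurd h.1 (not_lt.2 hs.2)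
  have hσr : ∀ t, ε ≤ t → σ t = 1 := fun t ht => by
    have : σ t = ∫ s, μ s := by
      apply intervalIntegral.integral_eq_integral_of_support_subset
      rw [hμsupp]
      exact fun s hs => ⟨hs.1, hs.2.le.trans ht⟩
    rw [this]
    exact B.integral_normed
  have hmono : Monotone σ := monotone_of_deriv_nonneg (fun t => (hσd t).differentiableAt)
    fun t => by rw [(hσd t).deriv]; exact hμ0 t
  have hσ0 : ∀ t, 0 ≤ σ t := fun t => by
    rw [← hσl (min t (-ε)) (min_le_right _ _)]; exact hmono (min_le_left _ _)
  have hσ1 : ∀ t, σ t ≤ 1 := fun t => by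
    rw [← hσr (max t ε) (le_max_right _ _)]; exact hmono (le_max_left _ _)
  have hθl : ∀ t ≤ -ε, θ t = 0 := fun t ht => by
    rw [hθ]
    simp only
    rw [intervalIntegral.integral_congr (g := fun _ => (0 : ℝ))]
    · simp
    · intro s hs
      rw [uIcc_of_ge ht] at hs
      exact hσl s hs.2
  have hθmono : Monotone θ := monotone_of_deriv_nonneg (fun t => (hθd t).differentiableAt)
    fun t => by rw [(hθd t).deriv]; exact hσ0 t
  have hsym : ∀ t, σ t + σ (-t) = 1 := by
    have hd : ∀ t, HasDerivAt (fun t => σ t + σ (-t)) 0 t := fun t => by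
      have := (hσd t).add ((hσd (-t)).scomp t (hasDerivAt_neg t))
      rw [hμneg] at this
      refine this.congr_deriv ?_
      simp
    intro t
    have := is_const_of_deriv_eq_zero (fun t => (hd t).differentiableAt) (fun t => (hd t).deriv) t ε
    rw [this, hσr ε le_rfl, hσl (-ε) le_rfl, add_zero]
  have hθsym : ∀ t, θ t - θ (-t) - t = 0 := by
    have hd : ∀ t, HasDerivAt (fun t => θ t - θ (-t) - t) 0 t := fun t => by
      have := ((hθd t).sub ((hθd (-t)).scomp t (hasDerivAt_neg t))).sub (hasDerivAt_id t)
      refine this.congr_deriv ?_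
      have := hsym t
      simp; linarith
    intro t
    have := is_const_of_deriv_eq_zero (fun t => (hd t).differentiableAt) (fun t => (hd t).deriv) t 0
    rw [this]; simp
  refine ⟨θ, σ, μ, contDiff_infty_of_hasDerivAt hθd hσs, hθd, hσd, hθl, hσl, fun t ht => ?_,
    hσ0, hσ1, fun t ht => ?_, fun t => ?_, hμ0, fun t => ?_⟩
  · have := hθsym t
    rw [hθl (-t) (by linarith)] at this
    linarith
  · by_cases h : t ≤ -ε
    · rw [hσl t h]; norm_num
    · push Not at h
      have hlt : StrictMonoOn σ (Icc (-ε) ε) :=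
        strictMonoOn_of_deriv_pos (convex_Icc _ _) hσc.continuousOn fun s hs => by
          rw [interior_Icc] at hs
          rw [(hσd s).deriv]; exact hμpos s hs
      rw [← hσr ε le_rfl]
      exact hlt ⟨h.le, ht.le⟩ ⟨by linarith, le_rfl⟩ ht
  · rw [← hθl (min t (-ε)) (min_le_right _ _)]; exact hθmono (min_le_left _ _)
  · refine (B.normed_le_div_measure_closedBall_rIn volume t).trans ?_
    rw [Measure.real, Real.volume_closedBall]
    simp only [B]
    rw [ENNReal.toReal_ofReal (by positivity)]
    apply le_of_eq; congr 1; ring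

end Ramp

section Mollifier

/-- `lam` is a mollifier supported in `[-1, 1]`. -/
structure IsMollifier (lam : ℝ → ℝ) : Prop where
  smooth : ContDiff ℝ ∞ lam
  nonneg : ∀ x, 0 ≤ lam x
  support : tsupport lam ⊆ Icc (-1) 1
  integral : ∫ x, lam x = 1

variable {lam : ℝ → ℝ}

theorem IsProfile.isMollifier {R h : ℝ → ℝ} (H : IsProfile R h lam) : IsMollifier lam :=
  ⟨H.lam_smooth, H.lam_nonneg, H.lam_support, H.lam_integral⟩

/-- `∫_{-∞}^x lam`. -/
noncomputable def mollCdf (lam : ℝ → ℝ) (x : ℝ) : ℝ := ∫ u in (-2)..x, lam u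

/-- `∫_{-∞}^x e^{-u} lam(u) du`. -/
noncomputable def mollExp (lam : ℝ → ℝ) (x : ℝ) : ℝ := ∫ u in (-2)..x, Real.exp (-u) * lam u

namespace IsMollifier

theorem eq_zero_of_le (H : IsMollifier lam) {x : ℝ} (hx : x ≤ -1) : lam x = 0 := by
  have hcl : IsClosed {y | lam y = 0} := isClosed_eq H.smooth.continuous continuous_const
  have hsub : Iio (-1 : ℝ) ⊆ {y | lam y = 0} := fun y hy =>
    image_eq_zero_of_notMem_tsupport fun h => absurd (H.support h).1 (not_le.2 hy)
  have := closure_minimal hsub hcl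
  rw [closure_Iio] at this
  exact this hx

theorem eq_zero_of_ge (H : IsMollifier lam) {x : ℝ} (hx : 1 ≤ x) : lam x = 0 := by
  have hcl : IsClosed {y | lam y = 0} := isClosed_eq H.smooth.continuous continuous_const
  have hsub : Ioi (1 : ℝ) ⊆ {y | lam y = 0} := fun y hy =>
    image_eq_zero_of_notMem_tsupport fun h => absurd (H.support h).2 (not_le.2 hy)
  have := closure_minimal hsub hcl
  rw [closure_Ioi] at this
  exact this hx

theorem hasCompactSupport (H : IsMollifier lam) : HasCompactSupport lam :=
  isCompact_Icc.of_isClosed_subset (isClosed_tsupport _) H.support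

theorem integrable_mul (H : IsMollifier lam) {g : ℝ → ℝ} (hg : Continuous g) :
    Integrable fun u => g u * lam u :=
  (hg.mul H.smooth.continuous).integrable_of_hasCompactSupport H.hasCompactSupport.mul_left

theorem setIntegral_Iic (H : IsMollifier lam) {g : ℝ → ℝ} (hg : Continuous g) (x : ℝ) :
    ∫ u in Iic x, g u * lam u = ∫ u in (-2)..x, g u * lam u := by
  have hi := H.integrable_mul hg
  have := intervalIntegral.integral_Iic_sub_Iic (μ := volume) (a := -2) (b := x)
    hi.integrableOn hi.integrableOn
  rw [← this, setIntegral_eq_zero_of_forall_eq_zero (t := Iic (-2 : ℝ)), sub_zero]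
  intro u hu
  rw [H.eq_zero_of_le (by simp only [mem_Iic] at hu; linarith), mul_zero]

theorem mollify_eq (φ : ℝ → ℝ) (x : ℝ) : mollify lam φ x = ∫ u, φ (x - u) * lam u := by
  unfold mollify
  rw [← integral_sub_left_eq_self _ volume x]
  simp

theorem mollify_fbar (H : IsMollifier lam) (x : ℝ) :
    mollify lam fbar x = 1 - mollCdf lam x + Real.exp x * mollExp lam x := by
  rw [mollify_eq]
  have h1 := H.integrable_mul (g := fun _ => 1) continuous_const
  have h2 := H.integrable_mul (g := fun u => Real.exp (-u)) (by fun_prop)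
  have e : (fun u => fbar (x - u) * lam u) = fun u => (1 * lam u -
      (Iic x).indicator (fun u => 1 * lam u) u) +
      Real.exp x * (Iic x).indicator (fun u => Real.exp (-u) * lam u) u := by
    ext u
    by_cases hu : u ≤ x
    · rw [indicator_of_mem (mem_Iic.2 hu), indicator_of_mem (mem_Iic.2 hu)]
      rcases hu.lt_or_eq with h | h
      · rw [fbar, if_neg (by linarith), sub_eq_add_neg, Real.exp_add]; ring
      · rw [fbar, if_pos (by linarith), ← mul_assoc, ← Real.exp_add, h]; simp
    · rw [indicator_of_notMem (by simpa using hu), indicator_of_notMem (by simpa using hu), fbar,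
        if_pos (by push Not at hu; linarith)]
      ring
  have h3 : Integrable fun u => 1 * lam u - (Iic x).indicator (fun u => 1 * lam u) u :=
    h1.sub (h1.indicator measurableSet_Iic)
  rw [e, integral_add h3 ((h2.indicator measurableSet_Iic).const_mul _),
    integral_sub h1 (h1.indicator measurableSet_Iic), integral_const_mul (Real.exp x),
    integral_indicator measurableSet_Iic, integral_indicator measurableSet_Iic,
    H.setIntegral_Iic continuous_const, H.setIntegral_Iic (by fun_prop)]
  simp only [one_mul, H.integral, mollCdf, mollExp]

theorem hasDerivAt_mollCdf (H : IsMollifier lam) (x : ℝ) :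
    HasDerivAt (mollCdf lam) (lam x) x :=
  (H.smooth.continuous.integral_hasStrictDerivAt (-2) x).hasDerivAt

theorem hasDerivAt_mollExp (H : IsMollifier lam) (x : ℝ) :
    HasDerivAt (mollExp lam) (Real.exp (-x) * lam x) x :=
  ((show Continuous fun u => Real.exp (-u) * lam u by
    have := H.smooth.continuous; fun_prop).integral_hasStrictDerivAt (-2) x).hasDerivAt

theorem contDiff_mollCdf (H : IsMollifier lam) : ContDiff ℝ ∞ (mollCdf lam) :=
  contDiff_infty_of_hasDerivAt H.hasDerivAt_mollCdf H.smooth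

theorem contDiff_mollExp (H : IsMollifier lam) : ContDiff ℝ ∞ (mollExp lam) :=
  contDiff_infty_of_hasDerivAt H.hasDerivAt_mollExp (by have := H.smooth; fun_prop)

theorem monotone_mollCdf (H : IsMollifier lam) : Monotone (mollCdf lam) :=
  monotone_of_deriv_nonneg (fun t => (H.hasDerivAt_mollCdf t).differentiableAt)
    fun t => by rw [(H.hasDerivAt_mollCdf t).deriv]; exact H.nonneg t

theorem monotone_mollExp (H : IsMollifier lam) : Monotone (mollExp lam) :=
  monotone_of_deriv_nonneg (fun t => (H.hasDerivAt_mollExp t).differentiableAt)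
    fun t => by
      rw [(H.hasDerivAt_mollExp t).deriv]; exact mul_nonneg (Real.exp_pos _).le (H.nonneg t)

theorem mollCdf_of_le (H : IsMollifier lam) {x : ℝ} (hx : x ≤ -1) : mollCdf lam x = 0 := by
  rw [mollCdf, intervalIntegral.integral_congr (g := fun _ => (0 : ℝ))]
  · simp
  · intro u hu
    exact H.eq_zero_of_le (hu.2.trans (max_le (by norm_num) hx))

theorem mollExp_of_le (H : IsMollifier lam) {x : ℝ} (hx : x ≤ -1) : mollExp lam x = 0 := by
  rw [mollExp, intervalIntegral.integral_congr (g := fun _ => (0 : ℝ))]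
  · simp
  · intro u hu
    simp [H.eq_zero_of_le (hu.2.trans (max_le (by norm_num) hx))]

theorem intervalIntegral_of_ge (H : IsMollifier lam) (g : ℝ → ℝ) {x : ℝ} (hx : 1 ≤ x) :
    ∫ u in (-2)..x, g u * lam u = ∫ u, g u * lam u := by
  apply intervalIntegral.integral_eq_integral_of_support_subset
  intro u hu
  have hu' : lam u ≠ 0 := right_ne_zero_of_mul hu
  refine ⟨?_, ?_⟩
  · by_contra h
    exact hu' (H.eq_zero_of_le (by linarith))
  · by_contra h
    exact hu' (H.eq_zero_of_ge (by linarith))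

theorem mollCdf_of_ge (H : IsMollifier lam) {x : ℝ} (hx : 1 ≤ x) : mollCdf lam x = 1 := by
  have := H.intervalIntegral_of_ge (fun _ => 1) hx
  simpa only [one_mul, H.integral, mollCdf] using this

theorem mollExp_of_ge (H : IsMollifier lam) {x : ℝ} (hx : 1 ≤ x) :
    mollExp lam x = mollify lam Real.exp 0 := by
  rw [mollify_eq, mollExp, H.intervalIntegral_of_ge _ hx]
  simp

theorem mollCdf_nonneg (H : IsMollifier lam) (x : ℝ) : 0 ≤ mollCdf lam x := by
  rw [← H.mollCdf_of_le (min_le_right x (-1))]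
  exact H.monotone_mollCdf (min_le_left _ _)

theorem mollCdf_le_one (H : IsMollifier lam) (x : ℝ) : mollCdf lam x ≤ 1 := by
  rw [← H.mollCdf_of_ge (le_max_right x 1)]
  exact H.monotone_mollCdf (le_max_left _ _)

theorem mollExp_nonneg (H : IsMollifier lam) (x : ℝ) : 0 ≤ mollExp lam x := by
  rw [← H.mollExp_of_le (min_le_right x (-1))]
  exact H.monotone_mollExp (min_le_left _ _)

theorem mollExp_le (H : IsMollifier lam) (x : ℝ) : mollExp lam x ≤ mollify lam Real.exp 0 := by
  rw [← H.mollExp_of_ge (le_max_right x 1)]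
  exact H.monotone_mollExp (le_max_left _ _)

theorem mollify_exp_pos (H : IsMollifier lam) : 0 < mollify lam Real.exp 0 := by
  refine lt_of_le_of_ne ((H.mollExp_nonneg 1).trans (H.mollExp_le 1)) fun h0 => ?_
  have hz : ∀ x, mollExp lam x = 0 := fun x =>
    le_antisymm ((H.mollExp_le x).trans h0.ge) (H.mollExp_nonneg x)
  have hl : ∀ x, lam x = 0 := fun x => by
    have h1 := (H.hasDerivAt_mollExp x).deriv
    rw [show mollExp lam = fun _ => 0 from funext hz, deriv_const] at h1
    exact (mul_eq_zero.1 h1.symm).resolve_left (Real.exp_pos _).ne'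
  have := H.integral
  simp [hl] at this

theorem exists_le (H : IsMollifier lam) : ∃ C, ∀ x, lam x ≤ C := by
  obtain ⟨C, hC⟩ := H.hasCompactSupport.exists_bound_of_continuous H.smooth.continuous
  exact ⟨C, fun x => (le_abs_self _).trans (hC x)⟩

theorem contDiff_mollify_fbar (H : IsMollifier lam) : ContDiff ℝ ∞ (mollify lam fbar) := by
  rw [show mollify lam fbar = _ from funext H.mollify_fbar]
  have := H.contDiff_mollCdf
  have := H.contDiff_mollExp
  fun_prop

theorem hasDerivAt_mollify_fbar (H : IsMollifier lam) (x : ℝ) :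
    HasDerivAt (mollify lam fbar) (Real.exp x * mollExp lam x) x := by
  rw [show mollify lam fbar = _ from funext H.mollify_fbar]
  have := ((H.hasDerivAt_mollCdf x).const_sub 1).add
    ((Real.hasDerivAt_exp x).mul (H.hasDerivAt_mollExp x))
  refine this.congr_deriv ?_
  rw [← mul_assoc, ← Real.exp_add]
  simp

theorem hasDerivAt_mollify_fbar' (H : IsMollifier lam) (x : ℝ) :
    HasDerivAt (fun x => Real.exp x * mollExp lam x) (Real.exp x * mollExp lam x + lam x) x := by
  have := (Real.hasDerivAt_exp x).mul (H.hasDerivAt_mollExp x)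
  refine this.congr_deriv ?_
  rw [← mul_assoc, ← Real.exp_add]
  simp

theorem mollify_fbar_of_le (H : IsMollifier lam) {x : ℝ} (hx : x ≤ -1) :
    mollify lam fbar x = 1 := by
  rw [H.mollify_fbar, H.mollCdf_of_le hx, H.mollExp_of_le hx]; simp

theorem mollify_fbar_of_ge (H : IsMollifier lam) {x : ℝ} (hx : 1 ≤ x) :
    mollify lam fbar x = Real.exp x * mollify lam Real.exp 0 := by
  rw [H.mollify_fbar, H.mollCdf_of_ge hx, H.mollExp_of_ge hx]; simp

theorem one_le_mollify_fbar (H : IsMollifier lam) (x : ℝ) : 1 ≤ mollify lam fbar x := by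
  rw [← H.mollify_fbar_of_le (min_le_right x (-1))]
  refine monotone_of_deriv_nonneg (fun t => (H.hasDerivAt_mollify_fbar t).differentiableAt)
    (fun t => ?_) (min_le_left _ _)
  rw [(H.hasDerivAt_mollify_fbar t).deriv]
  exact mul_nonneg (Real.exp_pos _).le (H.mollExp_nonneg t)

end IsMollifier

end Mollifier

theorem exists_isProfile : ∃ R h lam : ℝ → ℝ, IsProfile R h lam := by
  obtain ⟨θ₁, σ₁, μ₁, H₁⟩ := exists_isSmoothRamp (ε := 1) one_pos
  obtain ⟨θ₂, σ₂, μ₂, H₂⟩ := exists_isSmoothRamp (ε := 2) two_pos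
  let B : ContDiffBump (0 : ℝ) := ⟨1 / 2, 1, by norm_num, by norm_num⟩
  have hR : ∀ r, HasDerivAt (fun r => r - θ₂ (r - 3)) (1 - σ₂ (r - 3)) r := fun r => by
    have := (hasDerivAt_id r).sub ((H₂.hasDerivAt (r - 3)).comp_sub_const r 3)
    exact this
  have hR' : ∀ r, HasDerivAt (fun r => 1 - σ₂ (r - 3)) (-μ₂ (r - 3)) r := fun r =>
    ((H₂.hasDerivAt' (r - 3)).comp_sub_const r 3).const_sub 1
  have hh : ∀ r, HasDerivAt (fun r => Real.exp r + Real.exp (θ₁ r))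
      (Real.exp r + Real.exp (θ₁ r) * σ₁ r) r := fun r =>
    (Real.hasDerivAt_exp r).add (H₁.hasDerivAt r).exp
  have hh' : ∀ r, HasDerivAt (fun r => Real.exp r + Real.exp (θ₁ r) * σ₁ r)
      (Real.exp r + (Real.exp (θ₁ r) * σ₁ r * σ₁ r + Real.exp (θ₁ r) * μ₁ r)) r := fun r =>
    (Real.hasDerivAt_exp r).add ((H₁.hasDerivAt r).exp.mul (H₁.hasDerivAt' r))
  have dR := funext fun r => (hR r).deriv
  have dh := funext fun r => (hh r).deriv
  have s₁ := H₁.smooth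
  have s₂ := H₂.smooth
  refine ⟨fun r => r - θ₂ (r - 3), fun r => Real.exp r + Real.exp (θ₁ r), B.normed volume,
    by fun_prop, fun r hr => ?_, fun r hr => ?_, fun r hr => ?_, fun r => ?_, by fun_prop,
    fun r hr => ?_, fun r hr => ?_, fun r => ?_, fun r => ?_, fun r => ?_,
    B.contDiff_normed, B.nonneg_normed, ?_, B.integral_normed⟩
  · simp [H₂.left (r - 3) (by linarith)]
  · simp [H₂.right (r - 3) (by linarith)]
  · rw [dR]
    linarith [H₂.deriv_lt_one (r - 3) (by linarith [hr.2])]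
  · rw [dR, (hR' r).deriv]
    constructor <;> linarith [H₂.deriv2_le (r - 3), H₂.deriv2_nonneg (r - 3)]
  · simp only [H₁.left r hr, Real.exp_zero]; ring
  · simp only [H₁.right r hr]; ring
  · have := Real.exp_pos r
    have := Real.one_le_exp (H₁.nonneg r)
    linarith
  · rw [dh]
    have := mul_nonneg (Real.exp_pos (θ₁ r)).le (H₁.deriv_nonneg r)
    linarith [Real.exp_pos r]
  · rw [dh, (hh' r).deriv]
    have h1 := mul_nonneg (mul_nonneg (Real.exp_pos (θ₁ r)).le (H₁.deriv_nonneg r))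
      (H₁.deriv_nonneg r)
    have h2 := mul_nonneg (Real.exp_pos (θ₁ r)).le (H₁.deriv2_nonneg r)
    linarith [Real.exp_pos r]
  · rw [B.tsupport_normed_eq, Real.closedBall_eq_Icc]
    simp [B]

/-! ### Consequences of the conditions on profiles -/

section ProfileFacts

variable {R h lam : ℝ → ℝ}

namespace IsProfile

theorem hasDerivAt_R (H : IsProfile R h lam) (r : ℝ) : HasDerivAt R (deriv R r) r :=
  (H.R_smooth.differentiable (by simp) r).hasDerivAt

theorem contDiff_deriv_R (H : IsProfile R h lam) : ContDiff ℝ ∞ (deriv R) :=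
  (contDiff_infty_iff_deriv.1 H.R_smooth).2

theorem hasDerivAt_deriv_R (H : IsProfile R h lam) (r : ℝ) :
    HasDerivAt (deriv R) (deriv (deriv R) r) r :=
  (H.contDiff_deriv_R.differentiable (by simp) r).hasDerivAt

theorem hasDerivAt_h (H : IsProfile R h lam) (r : ℝ) : HasDerivAt h (deriv h r) r :=
  (H.h_smooth.differentiable (by simp) r).hasDerivAt

theorem contDiff_deriv_h (H : IsProfile R h lam) : ContDiff ℝ ∞ (deriv h) :=
  (contDiff_infty_iff_deriv.1 H.h_smooth).2

theorem hasDerivAt_deriv_h (H : IsProfile R h lam) (r : ℝ) :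
    HasDerivAt (deriv h) (deriv (deriv h) r) r :=
  (H.contDiff_deriv_h.differentiable (by simp) r).hasDerivAt

theorem h_pos (H : IsProfile R h lam) (r : ℝ) : 0 < h r := one_pos.trans_le (H.h_ge r)

theorem antitone_deriv_R (H : IsProfile R h lam) : Antitone (deriv R) :=
  antitone_of_deriv_nonpos (H.contDiff_deriv_R.differentiable (by simp))
    fun r => (H.R_deriv2 r).2

theorem deriv_R_of_lt (H : IsProfile R h lam) {r : ℝ} (hr : r < 1) : deriv R r = 1 := by
  have : R =ᶠ[nhds r] id := by
    filter_upwards [Iio_mem_nhds hr] with s hs using H.R_left s (le_of_lt hs)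
  rw [this.deriv_eq, deriv_id]

theorem deriv_R_of_gt (H : IsProfile R h lam) {r : ℝ} (hr : 5 < r) : deriv R r = 0 := by
  have : R =ᶠ[nhds r] fun _ => 3 := by
    filter_upwards [Ioi_mem_nhds hr] with s hs using H.R_right s (le_of_lt hs)
  rw [this.deriv_eq, deriv_const]

theorem deriv_R_nonneg (H : IsProfile R h lam) (r : ℝ) : 0 ≤ deriv R r := by
  rw [← H.deriv_R_of_gt (lt_max_of_lt_right (by norm_num) : 5 < max r 6)]
  exact H.antitone_deriv_R (le_max_left _ _)

theorem deriv_R_le_one (H : IsProfile R h lam) (r : ℝ) : deriv R r ≤ 1 := by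
  rw [← H.deriv_R_of_lt (min_lt_of_right_lt (by norm_num) : min r 0 < 1)]
  exact H.antitone_deriv_R (min_le_left _ _)

theorem monotone_R (H : IsProfile R h lam) : Monotone R :=
  monotone_of_deriv_nonneg (H.R_smooth.differentiable (by simp)) H.deriv_R_nonneg

theorem R_le (H : IsProfile R h lam) (r : ℝ) : R r ≤ 3 := by
  rw [← H.R_right _ (le_max_right r 5)]
  exact H.monotone_R (le_max_left _ _)

theorem R_nonneg (H : IsProfile R h lam) {r : ℝ} (hr : 0 ≤ r) : 0 ≤ R r := by
  have := H.monotone_R hr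
  rwa [H.R_left 0 (by norm_num)] at this

theorem deriv2_h_add_nonneg (H : IsProfile R h lam) (r : ℝ) :
    0 ≤ deriv (deriv h) r + 2 * h r * deriv (deriv R) r := by
  have hc : Continuous fun r => deriv (deriv h) r + 2 * h r * deriv (deriv R) r := by
    have h1 := (contDiff_infty_iff_deriv.1 H.contDiff_deriv_h).2.continuous
    have h2 := (contDiff_infty_iff_deriv.1 H.contDiff_deriv_R).2.continuous
    have h3 := H.h_smooth.continuous
    fun_prop
  have hcl : IsClosed {r | 0 ≤ deriv (deriv h) r + 2 * h r * deriv (deriv R) r} :=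
    isClosed_le continuous_const hc
  have hsub : ({1}ᶜ : Set ℝ) ⊆ {r | 0 ≤ deriv (deriv h) r + 2 * h r * deriv (deriv R) r} := by
    intro s hs
    rcases lt_or_gt_of_ne (show s ≠ 1 from hs) with h1 | h1
    · have : deriv R =ᶠ[nhds s] fun _ => 1 := by
        filter_upwards [Iio_mem_nhds h1] with x hx using H.deriv_R_of_lt hx
      simp only [mem_ofPred_eq, this.deriv_eq, deriv_const, mul_zero, add_zero]
      exact (H.h_deriv2 s).le
    · have e : h =ᶠ[nhds s] fun x => 2 * Real.exp x := by
        filter_upwards [Ioi_mem_nhds h1] with x hx using H.h_right x (le_of_lt hx)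
      have e2 : deriv (deriv h) s = h s := by
        rw [e.deriv.deriv_eq, e.eq_of_nhds]
        simp
      simp only [mem_ofPred_eq, e2]
      nlinarith [H.h_pos s, (H.R_deriv2 s).1]
  have := closure_minimal hsub hcl
  rw [(dense_compl_singleton (1 : ℝ)).closure_eq] at this
  exact this (mem_univ r)

theorem exists_h_bound (H : IsProfile R h lam) :
    ∃ C, ∀ r, deriv h r ≤ C * h r ∧ deriv (deriv h) r ≤ C * h r := by
  have h1 := (contDiff_infty_iff_deriv.1 H.contDiff_deriv_h).2.continuous
  have h2 := H.contDiff_deriv_h.continuous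
  obtain ⟨C, hC⟩ := (isCompact_Icc (a := (-1 : ℝ)) (b := 1)).exists_bound_of_continuousOn
    h1.continuousOn
  obtain ⟨D, hD⟩ := (isCompact_Icc (a := (-1 : ℝ)) (b := 1)).exists_bound_of_continuousOn
    h2.continuousOn
  refine ⟨max 1 (max C D), fun r => ?_⟩
  have hm := H.h_ge r
  have key : ∀ {x : ℝ}, (x ≤ h r ∨ x ≤ max C D) → x ≤ max 1 (max C D) * h r := by
    rintro x (hx | hx)
    · exact hx.trans (le_mul_of_one_le_left (by linarith) (le_max_left _ _))
    · exact (hx.trans (le_max_right 1 _)).trans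
        (le_mul_of_one_le_right (zero_le_one.trans (le_max_left _ _)) hm)
  rcases lt_or_ge r (-1) with hr | hr
  · have e : h =ᶠ[nhds r] fun x => 1 + Real.exp x := by
      filter_upwards [Iio_mem_nhds hr] with x hx using H.h_left x (le_of_lt hx)
    have e1 : deriv h r = Real.exp r := by rw [e.deriv_eq]; simp
    have e2 : deriv (deriv h) r = Real.exp r := by rw [e.deriv.deriv_eq]; simp
    rw [e1, e2]
    have : Real.exp r ≤ h r := by rw [e.eq_of_nhds]; linarith
    exact ⟨key (Or.inl this), key (Or.inl this)⟩
  rcases lt_or_ge 1 r with hr' | hr'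
  · have e : h =ᶠ[nhds r] fun x => 2 * Real.exp x := by
      filter_upwards [Ioi_mem_nhds hr'] with x hx using H.h_right x (le_of_lt hx)
    have e1 : deriv h r = h r := by rw [e.deriv_eq, e.eq_of_nhds]; simp
    have e2 : deriv (deriv h) r = h r := by rw [e.deriv.deriv_eq, e.eq_of_nhds]; simp
    rw [e1, e2]
    exact ⟨key (Or.inl le_rfl), key (Or.inl le_rfl)⟩
  · exact ⟨key (Or.inr (((le_abs_self _).trans (hD r ⟨hr, hr'⟩)).trans (le_max_right _ _))),
      key (Or.inr (((le_abs_self _).trans (hC r ⟨hr, hr'⟩)).trans (le_max_left _ _)))⟩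

end IsProfile

theorem bConst_pos (H : IsMollifier lam) {a : ℝ} (ha : 5 < a) : 0 < bConst lam a := by
  have h1 := H.mollify_exp_pos
  have h2 : 0 < Real.sinh (a - (a - 5) / 2 - 5) := Real.sinh_pos_iff.2 (by linarith)
  unfold bConst
  positivity

/-- The product `b c`. -/
noncomputable def bcConst (lam : ℝ → ℝ) (a : ℝ) : ℝ := bConst lam a * mollify lam Real.exp 0

theorem bcConst_pos (H : IsMollifier lam) {a : ℝ} (ha : 5 < a) : 0 < bcConst lam a :=
  mul_pos (bConst_pos H ha) H.mollify_exp_pos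

/-- `S` is the part of `F̃(r, t)` that is added for `t ≥ 5`, with derivatives `S₁`, `S₂`. -/
structure IsTail (lam : ℝ → ℝ) (a C : ℝ) (S S₁ S₂ : ℝ → ℝ) : Prop where
  smooth : ContDiff ℝ ∞ S
  hasDerivAt : ∀ t, HasDerivAt S (S₁ t) t
  hasDerivAt' : ∀ t, HasDerivAt S₁ (S₂ t) t
  nonneg : ∀ t, 0 ≤ S t
  deriv_nonneg : ∀ t, 0 ≤ S₁ t
  deriv2_nonneg : ∀ t, 0 ≤ S₂ t
  left : ∀ t ≤ 5, S t = 0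
  deriv_left : ∀ t ≤ 5, S₁ t = 0
  deriv2_left : ∀ t ≤ 5, S₂ t = 0
  right : ∀ t, a ≤ t → bcConst lam a * Real.exp t + S t = Real.sinh (t - 5)
  deriv_le : ∀ t, 5 ≤ t → S₁ t ≤ C * (bcConst lam a * Real.exp t + S t)
  deriv2_le : ∀ t, 5 ≤ t → S₂ t ≤ C * (bcConst lam a * Real.exp t + S t)

theorem exists_isTail (H : IsMollifier lam) {a : ℝ} (ha : 5 < a) :
    ∃ C S S₁ S₂, 0 ≤ C ∧ IsTail lam a C S S₁ S₂ := by
  set u : ℝ := (a - 5) / 2 with hu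
  have hu0 : 0 < u := by rw [hu]; linarith
  obtain ⟨θ, σ, μ, Hθ⟩ := exists_isSmoothRamp hu0
  have hk := bcConst_pos H ha
  have hkeq : bcConst lam a = Real.exp (-(5 + u)) * Real.sinh u := by
    have := H.mollify_exp_pos
    rw [bcConst, bConst, show a - (a - 5) / 2 - 5 = u by rw [hu]; ring,
      show a - (a - 5) / 2 = 5 + u by rw [hu]; ring]
    field_simp
  set k := bcConst lam a with hkd
  set J := Real.exp (-u) with hJ
  have hJ0 : 0 < J := Real.exp_pos _
  have hθd : ∀ t, HasDerivAt (fun t => θ (t - (5 + u))) (σ (t - (5 + u))) t := fun t =>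
    (Hθ.hasDerivAt _).comp_sub_const t _
  have hσd : ∀ t, HasDerivAt (fun t => σ (t - (5 + u))) (μ (t - (5 + u))) t := fun t =>
    (Hθ.hasDerivAt' _).comp_sub_const t _
  have hsinh : ∀ t, 0 ≤ Real.sinh (θ t) := fun t => Real.sinh_nonneg_iff.2 (Hθ.nonneg t)
  have hcosh : ∀ t, Real.cosh (θ t) ≤ 1 + Real.sinh (θ t) := fun t => by
    rw [Real.cosh_eq, Real.sinh_eq]
    have : Real.exp (-θ t) ≤ 1 := Real.exp_le_one_iff.2 (by linarith [Hθ.nonneg t])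
    linarith
  have hμl : ∀ t ≤ -u, μ t = 0 := fun t ht => by
    have hz : ∀ s, s < -u → μ s = 0 := fun s hs => by
      have e : σ =ᶠ[nhds s] fun _ => 0 := by
        filter_upwards [Iio_mem_nhds hs] with x hx using Hθ.deriv_left x (le_of_lt hx)
      rw [← (Hθ.hasDerivAt' s).deriv, e.deriv_eq, deriv_const]
    have hc : Continuous μ := by
      have h1 := (contDiff_infty_iff_deriv.1 Hθ.smooth).2
      rw [show deriv θ = σ from funext fun x => (Hθ.hasDerivAt x).deriv] at h1
      have h2 := (contDiff_infty_iff_deriv.1 h1).2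
      rw [show deriv σ = μ from funext fun x => (Hθ.hasDerivAt' x).deriv] at h2
      exact h2.continuous
    have := closure_minimal (show Iio (-u) ⊆ {s | μ s = 0} from hz)
      (isClosed_eq hc continuous_const)
    rw [closure_Iio] at this
    exact this ht
  have hbd : ∀ t, 5 ≤ t → J ≤ J / k * (k * Real.exp t) := fun t ht => by
    have : J / k * (k * Real.exp t) = J * Real.exp t := by field_simp
    rw [this]
    exact le_mul_of_one_le_right hJ0.le (Real.one_le_exp (by linarith))
  refine ⟨(1 + 1 / u) * (J / k + 1), fun t => J * Real.sinh (θ (t - (5 + u))),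
    fun t => J * (Real.cosh (θ (t - (5 + u))) * σ (t - (5 + u))),
    fun t => J * ((Real.sinh (θ (t - (5 + u))) * σ (t - (5 + u))) * σ (t - (5 + u)) +
      Real.cosh (θ (t - (5 + u))) * μ (t - (5 + u))), by positivity,
    ?_, fun t => ?_, fun t => ?_, fun t => ?_, fun t => ?_, fun t => ?_, fun t ht => ?_,
    fun t ht => ?_, fun t ht => ?_, fun t ht => ?_, fun t ht => ?_, fun t ht => ?_⟩
  · have := Hθ.smooth
    fun_prop
  · exact (hθd t).sinh.const_mul J
  · exact ((hθd t).cosh.mul (hσd t)).const_mul J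
  · exact mul_nonneg hJ0.le (hsinh _)
  · exact mul_nonneg hJ0.le (mul_nonneg (Real.cosh_pos _).le (Hθ.deriv_nonneg _))
  · exact mul_nonneg hJ0.le (add_nonneg
      (mul_nonneg (mul_nonneg (hsinh _) (Hθ.deriv_nonneg _)) (Hθ.deriv_nonneg _))
      (mul_nonneg (Real.cosh_pos _).le (Hθ.deriv2_nonneg _)))
  · simp [Hθ.left (t - (5 + u)) (by linarith)]
  · simp [Hθ.deriv_left (t - (5 + u)) (by linarith)]
  · simp [Hθ.deriv_left (t - (5 + u)) (by linarith), hμl (t - (5 + u)) (by linarith)]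
  · have ht' : u ≤ t - (5 + u) := by linarith
    simp only [Hθ.right _ ht', hJ, Real.sinh_eq]
    rw [← hkd, hkeq, Real.sinh_eq]
    have e1 : Real.exp (-(5 + u)) * ((Real.exp u - Real.exp (-u)) / 2) * Real.exp t =
        (Real.exp (t - 5) - Real.exp (t - 5 - 2 * u)) / 2 := by
      rw [show t - 5 = -(5 + u) + u + t by ring, show -(5 + u) + u + t - 2 * u =
        -(5 + u) + -u + t by ring, Real.exp_add, Real.exp_add, Real.exp_add (-(5 + u) + -u),
        Real.exp_add (-(5 + u)) (-u)]
      ring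
    have e2 : Real.exp (-u) * ((Real.exp (t - (5 + u)) - Real.exp (-(t - (5 + u)))) / 2) =
        (Real.exp (t - 5 - 2 * u) - Real.exp (-(t - 5))) / 2 := by
      rw [show t - 5 - 2 * u = -u + (t - (5 + u)) by ring,
        show -(t - 5) = -u + -(t - (5 + u)) by ring, Real.exp_add, Real.exp_add (-u)]
      ring
    rw [e1, e2]; ring
  · have h1 := hcosh (t - (5 + u))
    have h2 := Hθ.deriv_le_one (t - (5 + u))
    have h3 := hbd t ht
    have h4 := hsinh (t - (5 + u))
    have hS : 0 ≤ J * Real.sinh (θ (t - (5 + u))) := by positivity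
    have hE : 0 ≤ k * Real.exp t := by positivity
    calc J * (Real.cosh (θ (t - (5 + u))) * σ (t - (5 + u)))
        ≤ J * (Real.cosh (θ (t - (5 + u))) * 1) := by gcongr
      _ ≤ J * (1 + Real.sinh (θ (t - (5 + u)))) := by rw [mul_one]; gcongr
      _ ≤ (J / k + 1) * (k * Real.exp t + J * Real.sinh (θ (t - (5 + u)))) := by
          have : 0 ≤ J / k * (J * Real.sinh (θ (t - (5 + u)))) := by positivity
          nlinarith
      _ ≤ _ := by
          rw [mul_assoc]
          exact le_mul_of_one_le_left (by positivity) (by simp [hu0.le])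
  · have h1 := hcosh (t - (5 + u))
    have h2 := Hθ.deriv_le_one (t - (5 + u))
    have h2' := Hθ.deriv_nonneg (t - (5 + u))
    have h3 := hbd t ht
    have h4 := hsinh (t - (5 + u))
    have h5 := Hθ.deriv2_le (t - (5 + u))
    have hS : 0 ≤ J * Real.sinh (θ (t - (5 + u))) := by positivity
    have hE : 0 ≤ k * Real.exp t := by positivity
    calc J * ((Real.sinh (θ (t - (5 + u))) * σ (t - (5 + u))) * σ (t - (5 + u)) +
          Real.cosh (θ (t - (5 + u))) * μ (t - (5 + u)))
        ≤ J * ((Real.sinh (θ (t - (5 + u))) * 1) * 1 +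
          (1 + Real.sinh (θ (t - (5 + u)))) * (1 / u)) := by
          have := Hθ.deriv2_nonneg (t - (5 + u))
          gcongr
      _ ≤ (1 + 1 / u) * (J * (1 + Real.sinh (θ (t - (5 + u))))) := by nlinarith
      _ ≤ (1 + 1 / u) * ((J / k + 1) * (k * Real.exp t + J * Real.sinh (θ (t - (5 + u))))) := by
          refine mul_le_mul_of_nonneg_left ?_ (by positivity)
          have : 0 ≤ J / k * (J * Real.sinh (θ (t - (5 + u)))) := by positivity
          nlinarith
      _ = _ := by ring

/-- `T` together with its derivatives. -/
structure IsTWith (a C : ℝ) (T T₁ T₂ : ℝ → ℝ) : Prop where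
  smooth : ContDiff ℝ ∞ T
  hasDerivAt : ∀ t, HasDerivAt T (T₁ t) t
  hasDerivAt' : ∀ t, HasDerivAt T₁ (T₂ t) t
  left : ∀ t ≤ 4, T t = 1
  right : ∀ t, a ≤ t → T t = Real.cosh (t - 5)
  one_le : ∀ t, 1 ≤ T t
  deriv_nonneg : ∀ t, 0 ≤ T₁ t
  deriv2_nonneg : ∀ t, 0 ≤ T₂ t
  deriv_le : ∀ t, T₁ t ≤ C * T t
  deriv2_le : ∀ t, T₂ t ≤ C * T t

theorem IsTWith.isT {a C : ℝ} {T T₁ T₂ : ℝ → ℝ} (H : IsTWith a C T T₁ T₂) : IsT a T := by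
  have d1 : deriv T = T₁ := funext fun t => (H.hasDerivAt t).deriv
  refine ⟨H.smooth, H.left, H.right, H.one_le, fun t => ?_, fun t => ?_⟩
  · rw [d1]; exact H.deriv_nonneg t
  · rw [d1, (H.hasDerivAt' t).deriv]; exact H.deriv2_nonneg t

theorem exists_isTWith {a : ℝ} (ha : 5 < a) : ∃ C T T₁ T₂, 0 ≤ C ∧ IsTWith a C T T₁ T₂ := by
  have hε : 0 < min 1 (a - 5) := lt_min one_pos (by linarith)
  have hε1 := min_le_left 1 (a - 5)
  have hε2 := min_le_right 1 (a - 5)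
  set ε := min 1 (a - 5)
  obtain ⟨θ, σ, μ, Hθ⟩ := exists_isSmoothRamp hε
  have hθd : ∀ t, HasDerivAt (fun t => θ (t - 5)) (σ (t - 5)) t := fun t =>
    (Hθ.hasDerivAt _).comp_sub_const t _
  have hσd : ∀ t, HasDerivAt (fun t => σ (t - 5)) (μ (t - 5)) t := fun t =>
    (Hθ.hasDerivAt' _).comp_sub_const t _
  have hsinh : ∀ t, 0 ≤ Real.sinh (θ t) := fun t => Real.sinh_nonneg_iff.2 (Hθ.nonneg t)
  have hcosh : ∀ t, Real.sinh (θ t) ≤ Real.cosh (θ t) := fun t => (Real.sinh_lt_cosh _).le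
  refine ⟨1 + 1 / ε, fun t => Real.cosh (θ (t - 5)), fun t => Real.sinh (θ (t - 5)) * σ (t - 5),
    fun t => Real.cosh (θ (t - 5)) * σ (t - 5) * σ (t - 5) + Real.sinh (θ (t - 5)) * μ (t - 5),
    by positivity, ?_, fun t => (hθd t).cosh, fun t => (hθd t).sinh.mul (hσd t), fun t ht => ?_,
    fun t ht => ?_, fun t => Real.one_le_cosh _, fun t => ?_, fun t => ?_, fun t => ?_,
    fun t => ?_⟩
  · have := Hθ.smooth
    fun_prop
  · simp [Hθ.left (t - 5) (by linarith)]
  · simp [Hθ.right (t - 5) (by linarith)]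
  · exact mul_nonneg (hsinh _) (Hθ.deriv_nonneg _)
  · exact add_nonneg (mul_nonneg (mul_nonneg (Real.cosh_pos _).le (Hθ.deriv_nonneg _))
      (Hθ.deriv_nonneg _)) (mul_nonneg (hsinh _) (Hθ.deriv2_nonneg _))
  · have := Hθ.deriv_le_one (t - 5)
    have := Real.cosh_pos (θ (t - 5))
    calc Real.sinh (θ (t - 5)) * σ (t - 5) ≤ Real.cosh (θ (t - 5)) * 1 := by
          gcongr
          · exact Hθ.deriv_nonneg _
          · exact hcosh _
      _ ≤ _ := by
          rw [mul_comm]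
          gcongr
          simp [hε.le]
  · have h1 := Hθ.deriv_le_one (t - 5)
    have h2 := Hθ.deriv_nonneg (t - 5)
    have h3 := Real.cosh_pos (θ (t - 5))
    have h4 := Hθ.deriv2_nonneg (t - 5)
    have h5 := Hθ.deriv2_le (t - 5)
    calc Real.cosh (θ (t - 5)) * σ (t - 5) * σ (t - 5) + Real.sinh (θ (t - 5)) * μ (t - 5)
        ≤ Real.cosh (θ (t - 5)) * 1 * 1 + Real.cosh (θ (t - 5)) * (1 / ε) := by
          gcongr
          exact hcosh _
      _ = _ := by ring

end ProfileFacts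

/-! ### Curvature of metrics on vector spaces -/

section CoordinateMetric

variable {E : Type*} [NormedAddCommGroup E] [NormedSpace ℝ E]
  {E' : Type*} [NormedAddCommGroup E'] [NormedSpace ℝ E']

/-- The second derivative `∂_u ∂_v f` at `y`. -/
noncomputable def secondDeriv (f : E → ℝ) (y u v : E) : ℝ :=
  fderiv ℝ (fun z => fderiv ℝ f z v) y u

theorem ContDiff.fderiv_apply_const {f : E → ℝ} (hf : ContDiff ℝ ∞ f) (v : E) :
    ContDiff ℝ ∞ fun z => fderiv ℝ f z v :=
  (hf.fderiv_right (m := ∞) (by simp)).clm_apply contDiff_const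

theorem ContDiff.differentiableAt_infty {F : Type*} [NormedAddCommGroup F] [NormedSpace ℝ F]
    {f : E → F} (hf : ContDiff ℝ ∞ f) (y : E) : DifferentiableAt ℝ f y :=
  hf.differentiable (by simp) y

theorem secondDeriv_symm {f : E → ℝ} (hf : ContDiff ℝ ∞ f) (y u v : E) :
    secondDeriv f y u v = secondDeriv f y v u := by
  have h2 := (hf.fderiv_right (m := ∞) (by simp)).differentiableAt_infty y
  have hs : IsSymmSndFDerivAt ℝ f y := hf.contDiffAt.isSymmSndFDerivAt 
    (by simpa using (WithTop.coe_le_coe.2 (le_top (a := (2 : ℕ∞)))))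
  have e : ∀ u v, secondDeriv f y u v = fderiv ℝ (fderiv ℝ f) y u v := fun u v => by
    unfold secondDeriv
    rw [fderiv_clm_apply h2 (differentiableAt_const v)]
    simp
  rw [e, e]
  exact hs u v

theorem secondDeriv_add {f g : E → ℝ} (hf : ContDiff ℝ ∞ f) (hg : ContDiff ℝ ∞ g) (y u v : E) :
    secondDeriv (fun z => f z + g z) y u v = secondDeriv f y u v + secondDeriv g y u v := by
  unfold secondDeriv
  have : (fun z => fderiv ℝ (fun z => f z + g z) z v) =
      fun z => fderiv ℝ f z v + fderiv ℝ g z v := by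
    ext z
    rw [fderiv_fun_add (hf.differentiableAt_infty z) (hg.differentiableAt_infty z)]
    rfl
  rw [this, fderiv_fun_add ((hf.fderiv_apply_const v).differentiableAt_infty y)
    ((hg.fderiv_apply_const v).differentiableAt_infty y)]
  rfl

theorem fderiv_mul_apply {f g : E → ℝ} (hf : ContDiff ℝ ∞ f) (hg : ContDiff ℝ ∞ g) (y v : E) :
    fderiv ℝ (fun z => f z * g z) y v = f y * fderiv ℝ g y v + g y * fderiv ℝ f y v := by
  rw [fderiv_fun_mul (hf.differentiableAt_infty y) (hg.differentiableAt_infty y)]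
  rfl

theorem secondDeriv_mul {f g : E → ℝ} (hf : ContDiff ℝ ∞ f) (hg : ContDiff ℝ ∞ g) (y u v : E) :
    secondDeriv (fun z => f z * g z) y u v =
      f y * secondDeriv g y u v + fderiv ℝ f y u * fderiv ℝ g y v +
      (g y * secondDeriv f y u v + fderiv ℝ g y u * fderiv ℝ f y v) := by
  unfold secondDeriv
  have : (fun z => fderiv ℝ (fun z => f z * g z) z v) =
      fun z => f z * fderiv ℝ g z v + g z * fderiv ℝ f z v := by
    ext z
    exact fderiv_mul_apply hf hg z v
  have hf' := hf.fderiv_apply_const v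
  have hg' := hg.fderiv_apply_const v
  rw [this, fderiv_fun_add ((hf.mul hg').differentiableAt_infty y)
    ((hg.mul hf').differentiableAt_infty y)]
  simp only [add_apply]
  rw [fderiv_mul_apply hf hg', fderiv_mul_apply hg hf']
  ring

theorem fderiv_comp_clm {f : E' → ℝ} (hf : ContDiff ℝ ∞ f) (L : E →L[ℝ] E') (y u : E) :
    fderiv ℝ (fun z => f (L z)) y u = fderiv ℝ f (L y) (L u) := by
  have := ((hf.differentiableAt_infty (L y)).hasFDerivAt.comp y L.hasFDerivAt).fderiv
  rw [show (fun z => f (L z)) = f ∘ L from rfl, this]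
  rfl

theorem secondDeriv_comp_clm {f : E' → ℝ} (hf : ContDiff ℝ ∞ f) (L : E →L[ℝ] E') (y u v : E) :
    secondDeriv (fun z => f (L z)) y u v = secondDeriv f (L y) (L u) (L v) := by
  unfold secondDeriv
  simp only [fderiv_comp_clm hf L]
  exact fderiv_comp_clm (hf.fderiv_apply_const (L v)) L y u

theorem fderiv_comp_fst {f : E → ℝ} (hf : ContDiff ℝ ∞ f) (z u : E × E') :
    fderiv ℝ (fun z : E × E' => f z.1) z u = fderiv ℝ f z.1 u.1 :=
  fderiv_comp_clm hf (ContinuousLinearMap.fst ℝ E E') z u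

/-- A smooth Riemannian metric on a vector space. -/
structure IsRiemannianForm (G : E → E →L[ℝ] E →L[ℝ] ℝ) : Prop where
  smooth : ContDiff ℝ ∞ G
  symm : ∀ y u v, G y u v = G y v u
  pos : ∀ y u, u ≠ 0 → 0 < G y u u

/-- The curvature `(0, 4)`-tensor evaluated on the plane spanned by `u`, `v`. -/
noncomputable def curvForm (G : E → E →L[ℝ] E →L[ℝ] ℝ) (y u v : E) : ℝ :=
  G y (riemannTensor G y u v v) u

/-- The squared area of the parallelogram spanned by `u`, `v`. -/
noncomputable def areaForm (G : E → E →L[ℝ] E →L[ℝ] ℝ) (y u v : E) : ℝ :=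
  G y u u * G y v v - (G y u v) ^ 2

/-- The gradient of `f` with respect to `G`. -/
noncomputable def metricGrad (G : E → E →L[ℝ] E →L[ℝ] ℝ) (f : E → ℝ) (y : E) : E :=
  (G y).inverse (fderiv ℝ f y)

/-- The inner product of the gradients of `f₁` and `f₂` with respect to `G`. -/
noncomputable def gradInner (G : E → E →L[ℝ] E →L[ℝ] ℝ) (f₁ f₂ : E → ℝ) (y : E) : ℝ :=
  fderiv ℝ f₁ y (metricGrad G f₂ y)

/-- The Hessian of `f` with respect to `G`. -/
noncomputable def metricHess (G : E → E →L[ℝ] E →L[ℝ] ℝ) (f : E → ℝ) (y u v : E) : ℝ :=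
  secondDeriv f y u v - fderiv ℝ f y (christoffel G y u v)

namespace IsRiemannianForm

variable {G : E → E →L[ℝ] E →L[ℝ] ℝ}

theorem contDiff_apply (H : IsRiemannianForm G) (u v : E) : ContDiff ℝ ∞ fun z => G z u v :=
  (H.smooth.clm_apply contDiff_const).clm_apply contDiff_const

theorem fderiv_apply₂ (H : IsRiemannianForm G) (y u v w : E) :
    fderiv ℝ (fun z => G z u v) y w = fderiv ℝ G y w u v := by
  have h1 := (H.smooth.differentiableAt_infty y).hasFDerivAt
  have h2 := ((h1.clm_apply (hasFDerivAt_const u y)).clm_apply (hasFDerivAt_const v y)).fderiv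
  rw [h2]
  simp

theorem eq_of_forall (H : IsRiemannianForm G) {y X X' : E} (h : ∀ w, G y X w = G y X' w) :
    X = X' := by
  by_contra hne
  have h1 := H.pos y (X - X') (sub_ne_zero.2 hne)
  rw [map_sub (G y), sub_apply, h, sub_self] at h1
  exact lt_irrefl _ h1

theorem fderiv_symm (H : IsRiemannianForm G) (y u v w : E) :
    fderiv ℝ (fun z => G z u v) y w = fderiv ℝ (fun z => G z v u) y w := by
  simp only [H.symm _ u v]

theorem areaForm_nonneg (H : IsRiemannianForm G) (y u v : E) : 0 ≤ areaForm G y u v := by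
  unfold areaForm
  by_cases hv : v = 0
  · simp [hv]
  · have hp := H.pos y v hv
    have h0 : 0 ≤ G y (G y v v • u - G y u v • v) (G y v v • u - G y u v • v) := by
      by_cases h : G y v v • u - G y u v • v = 0
      · simp [h]
      · exact (H.pos y _ h).le
    simp only [map_sub, map_smul, sub_apply, smul_apply,
      smul_eq_mul, H.symm y v u] at h0
    nlinarith

theorem areaForm_pos (H : IsRiemannianForm G) (y : E) {u v : E}
    (h : LinearIndependent ℝ ![u, v]) : 0 < areaForm G y u v := by
  have hv : v ≠ 0 := by simpa using h.ne_zero 1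
  have hp := H.pos y v hv
  have h0 : 0 < G y (G y v v • u - G y u v • v) (G y v v • u - G y u v • v) := by
    refine H.pos y _ fun h0 => hp.ne' ?_
    have := (LinearIndependent.pair_iff.1 h) (G y v v) (-G y u v) (by rw [neg_smul, ← sub_eq_add_neg, h0])
    exact this.1
  simp only [map_sub, map_smul, sub_apply, smul_apply,
    smul_eq_mul, H.symm y v u] at h0
  unfold areaForm
  have : 0 < G y v v * (G y u u * G y v v - (G y u v) ^ 2) := by nlinarith
  exact (mul_pos_iff_of_pos_left hp).1 this

variable [FiniteDimensional ℝ E]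

theorem isInvertible (H : IsRiemannianForm G) (y : E) : (G y).IsInvertible := by
  have hinj : Function.Injective (G y) := fun X X' h => H.eq_of_forall fun w => by rw [h]
  let e₀ : E →ₗ[ℝ] (E →L[ℝ] ℝ) := (G y).toLinearMap
  have hrank : Module.finrank ℝ E = Module.finrank ℝ (E →L[ℝ] ℝ) := by
    rw [← (LinearMap.toContinuousLinearMap (𝕜 := ℝ) (E := E) (F' := ℝ)).finrank_eq]
    exact (Subspace.dual_finrank_eq (K := ℝ) (V := E)).symm
  let e := e₀.linearEquivOfInjective hinj hrank
  refine ⟨e.toContinuousLinearEquiv, ?_⟩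
  ext u v
  rfl

theorem inverse_spec (H : IsRiemannianForm G) (y : E) (ℓ : E →L[ℝ] ℝ) :
    G y ((G y).inverse ℓ) = ℓ := by
  obtain ⟨e, he⟩ := H.isInvertible y
  rw [← he, ContinuousLinearMap.inverse_equiv]
  simp

theorem inner_metricGrad (H : IsRiemannianForm G) (f : E → ℝ) (y w : E) :
    G y (metricGrad G f y) w = fderiv ℝ f y w := by
  rw [metricGrad, H.inverse_spec]

theorem inner_christoffel (H : IsRiemannianForm G) (y u v w : E) :
    G y (christoffel G y u v) w = 1 / 2 * (fderiv ℝ (fun z => G z v w) y u +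
      fderiv ℝ (fun z => G z u w) y v - fderiv ℝ (fun z => G z u v) y w) := by
  rw [christoffel, H.inverse_spec, H.fderiv_apply₂, H.fderiv_apply₂]
  simp

theorem christoffel_eq (H : IsRiemannianForm G) {y u v X : E}
    (h : ∀ w, G y X w = 1 / 2 * (fderiv ℝ (fun z => G z v w) y u +
      fderiv ℝ (fun z => G z u w) y v - fderiv ℝ (fun z => G z u v) y w)) :
    christoffel G y u v = X :=
  H.eq_of_forall fun w => by rw [h, H.inner_christoffel]

theorem metricGrad_eq (H : IsRiemannianForm G) {y X : E} {f : E → ℝ}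
    (h : ∀ w, G y X w = fderiv ℝ f y w) : metricGrad G f y = X :=
  H.eq_of_forall fun w => by rw [h, H.inner_metricGrad]

theorem christoffel_symm (H : IsRiemannianForm G) (y u v : E) :
    christoffel G y u v = christoffel G y v u := by
  refine H.christoffel_eq fun w => ?_
  rw [H.inner_christoffel, H.fderiv_symm y v u w]
  ring

/-- Metric compatibility of the Levi-Civita connection. -/
theorem fderiv_inner (H : IsRiemannianForm G) (y u v w : E) :
    fderiv ℝ (fun z => G z v w) y u =
      G y (christoffel G y u v) w + G y v (christoffel G y u w) := by
  rw [H.symm y v, H.inner_christoffel, H.inner_christoffel, H.fderiv_symm y w v u]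
  ring

theorem contDiff_christoffel (H : IsRiemannianForm G) (u v : E) :
    ContDiff ℝ ∞ fun z => christoffel G z u v := by
  have := FiniteDimensional.complete ℝ E
  rw [contDiff_iff_contDiffAt]
  intro y
  have h1 : ContDiffAt ℝ ∞ (fun z => (G z).inverse) y :=
    ((H.isInvertible y).contDiffAt_map_inverse).comp y H.smooth.contDiffAt
  have h2 : ContDiff ℝ ∞ (fun z => fderiv ℝ (fun z => G z u v) z) :=
    (H.contDiff_apply u v).fderiv_right (by simp)
  have h3 : ContDiff ℝ ∞ fun z => (1 / 2 : ℝ) •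
      (fderiv ℝ G z u v + fderiv ℝ G z v u - fderiv ℝ (fun z => G z u v) z) := by
    have h4 : ∀ a b : E, ContDiff ℝ ∞ fun z => fderiv ℝ G z a b := fun a b => by
      have e : (fun z => fderiv ℝ G z a b) = fun z => fderiv ℝ (fun x => G x b) z a := by
        ext1 z
        have := ((H.smooth.differentiableAt_infty z).hasFDerivAt.clm_apply
          (hasFDerivAt_const b z)).fderiv
        rw [this]
        simp
      rw [e]
      exact ((H.smooth.clm_apply contDiff_const).fderiv_right (m := ∞) (by simp)).clm_apply
        contDiff_const
    exact (((h4 u v).add (h4 v u)).sub h2).const_smul _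
  exact h1.clm_apply h3.contDiffAt

theorem inner_fderiv_christoffel (H : IsRiemannianForm G) (y a v w z : E) :
    G y (fderiv ℝ (fun x => christoffel G x v w) y a) z =
      1 / 2 * (secondDeriv (fun x => G x w z) y a v + secondDeriv (fun x => G x v z) y a w -
        secondDeriv (fun x => G x v w) y a z) -
      fderiv ℝ (fun x => G x (christoffel G y v w) z) y a := by
  have hΓ := (H.contDiff_christoffel v w).differentiableAt_infty y
  have h1 := (((H.smooth.differentiableAt_infty y).hasFDerivAt.clm_apply
    hΓ.hasFDerivAt).clm_apply (hasFDerivAt_const z y)).fderiv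
  have h2 : (fun x => G x (christoffel G x v w) z) = fun x =>
      1 / 2 * (fderiv ℝ (fun x => G x w z) x v +
      fderiv ℝ (fun x => G x v z) x w - fderiv ℝ (fun x => G x v w) x z) :=
    funext fun x => H.inner_christoffel x v w z
  have d := fun a b c => ((H.contDiff_apply a b).fderiv_apply_const c).differentiableAt_infty y
  have h3 : fderiv ℝ (fun x => G x (christoffel G x v w) z) y a =
      1 / 2 * (secondDeriv (fun x => G x w z) y a v + secondDeriv (fun x => G x v z) y a w -
        secondDeriv (fun x => G x v w) y a z) := by
    rw [h2, fderiv_const_mul (((d _ _ _).fun_add (d _ _ _)).fun_sub (d _ _ _)),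
      fderiv_fun_sub ((d _ _ _).fun_add (d _ _ _)) (d _ _ _), fderiv_fun_add (d _ _ _) (d _ _ _)]
    rfl
  rw [← h3, h1, H.fderiv_apply₂]
  simp

/-- The curvature form in terms of second derivatives of the metric and Christoffel symbols. -/
theorem curvForm_eq (H : IsRiemannianForm G) (y u v : E) :
    curvForm G y u v = secondDeriv (fun x => G x u v) y u v
      - 1 / 2 * secondDeriv (fun x => G x v v) y u u
      - 1 / 2 * secondDeriv (fun x => G x u u) y v v
      + G y (christoffel G y u v) (christoffel G y u v)
      - G y (christoffel G y u u) (christoffel G y v v) := by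
  unfold curvForm riemannTensor
  simp only [map_add, map_sub, add_apply, sub_apply]
  rw [H.inner_fderiv_christoffel, H.inner_fderiv_christoffel, H.fderiv_inner, H.fderiv_inner,
    H.christoffel_symm y v u, H.symm y (christoffel G y v v) (christoffel G y u u)]
  have e1 : (fun x => G x v u) = fun x => G x u v := funext fun x => H.symm x v u
  rw [e1, secondDeriv_symm (H.contDiff_apply u v) y v u]
  ring

end IsRiemannianForm

end CoordinateMetric

section CoordinateMetricConstructions

variable {E : Type*} [NormedAddCommGroup E] [NormedSpace ℝ E]
  {E' : Type*} [NormedAddCommGroup E'] [NormedSpace ℝ E']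

theorem localSectionalCurvature_congr {G G' : E → E →L[ℝ] E →L[ℝ] ℝ} {y : E}
    (h : G =ᶠ[nhds y] G') (u v : E) :
    localSectionalCurvature G y u v = localSectionalCurvature G' y u v := by
  have hΓ : ∀ a b, (fun z => christoffel G z a b) =ᶠ[nhds y] fun z => christoffel G' z a b := by
    intro a b
    filter_upwards [h, h.fderiv (𝕜 := ℝ), (h.fun_comp fun A => A a b).fderiv (𝕜 := ℝ)] with z h1 h2 h3
    have h3' : fderiv ℝ (fun x => G x a b) z = fderiv ℝ (fun x => G' x a b) z := h3
    unfold christoffel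
    rw [h1, h2, h3']
  have hΓ' : ∀ a b, christoffel G y a b = christoffel G' y a b := fun a b => (hΓ a b).eq_of_nhds
  unfold localSectionalCurvature riemannTensor
  rw [(hΓ v v).fderiv_eq, (hΓ u v).fderiv_eq, hΓ', hΓ', hΓ', hΓ', h.eq_of_nhds]

theorem contDiff_form [FiniteDimensional ℝ E] {F : Type*} [NormedAddCommGroup F] [NormedSpace ℝ F]
    {G : F → E →L[ℝ] E →L[ℝ] ℝ} (h : ∀ u v, ContDiff ℝ ∞ fun z => G z u v) : ContDiff ℝ ∞ G := by
  rw [contDiff_clm_apply_iff]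
  intro u
  rw [contDiff_clm_apply_iff]
  exact h u

/-- The pullback of a metric by a linear isomorphism. -/
noncomputable def pullForm (L : E ≃L[ℝ] E') (G : E' → E' →L[ℝ] E' →L[ℝ] ℝ) (y : E) :
    E →L[ℝ] E →L[ℝ] ℝ :=
  (G (L y)).bilinearComp (L : E →L[ℝ] E') (L : E →L[ℝ] E')

@[simp] theorem pullForm_apply (L : E ≃L[ℝ] E') (G : E' → E' →L[ℝ] E' →L[ℝ] ℝ) (y u v : E) :
    pullForm L G y u v = G (L y) (L u) (L v) := rfl

theorem IsRiemannianForm.pullForm [FiniteDimensional ℝ E] {G : E' → E' →L[ℝ] E' →L[ℝ] ℝ}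
    (H : IsRiemannianForm G) (L : E ≃L[ℝ] E') : IsRiemannianForm (pullForm L G) where
  smooth := contDiff_form fun u v => (H.contDiff_apply (L u) (L v)).comp L.contDiff
  symm y u v := H.symm _ _ _
  pos y u hu := H.pos _ _ (by simpa using hu)

theorem christoffel_pullForm [FiniteDimensional ℝ E] [FiniteDimensional ℝ E']
    {G : E' → E' →L[ℝ] E' →L[ℝ] ℝ} (H : IsRiemannianForm G) (L : E ≃L[ℝ] E') (y u v : E) :
    christoffel (pullForm L G) y u v = L.symm (christoffel G (L y) (L u) (L v)) := by
  refine (H.pullForm L).christoffel_eq fun w => ?_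
  have e : ∀ a b c, fderiv ℝ (fun z => pullForm L G z a b) y c =
      fderiv ℝ (fun z => G z (L a) (L b)) (L y) (L c) := fun a b c =>
    fderiv_comp_clm (H.contDiff_apply (L a) (L b)) (L : E →L[ℝ] E') y c
  rw [e, e, e, pullForm_apply, L.apply_symm_apply, H.inner_christoffel]

theorem curvForm_pullForm [FiniteDimensional ℝ E] [FiniteDimensional ℝ E']
    {G : E' → E' →L[ℝ] E' →L[ℝ] ℝ} (H : IsRiemannianForm G) (L : E ≃L[ℝ] E') (y u v : E) :
    curvForm (pullForm L G) y u v = curvForm G (L y) (L u) (L v) := by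
  have e : ∀ a b c d, secondDeriv (fun z => pullForm L G z a b) y c d =
      secondDeriv (fun z => G z (L a) (L b)) (L y) (L c) (L d) := fun a b c d =>
    secondDeriv_comp_clm (H.contDiff_apply (L a) (L b)) (L : E →L[ℝ] E') y c d
  rw [(H.pullForm L).curvForm_eq, H.curvForm_eq, e, e, e]
  simp only [christoffel_pullForm H, pullForm_apply, L.apply_symm_apply]

variable {B : Type*} [NormedAddCommGroup B] [NormedSpace ℝ B]
  {V : Type*} [NormedAddCommGroup V] [NormedSpace ℝ V]

/-- The warped product metric `G_B + φ² G_V`. -/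
noncomputable def warpedForm (GB : B → B →L[ℝ] B →L[ℝ] ℝ) (φ : B → ℝ)
    (GV : V → V →L[ℝ] V →L[ℝ] ℝ) (z : B × V) : B × V →L[ℝ] B × V →L[ℝ] ℝ :=
  (GB z.1).bilinearComp (ContinuousLinearMap.fst ℝ B V) (ContinuousLinearMap.fst ℝ B V) +
    (φ z.1) ^ 2 •
      (GV z.2).bilinearComp (ContinuousLinearMap.snd ℝ B V) (ContinuousLinearMap.snd ℝ B V)

section Warped

variable {GB : B → B →L[ℝ] B →L[ℝ] ℝ} {φ : B → ℝ} {GV : V → V →L[ℝ] V →L[ℝ] ℝ}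

@[simp] theorem warpedForm_apply (z u v : B × V) :
    warpedForm GB φ GV z u v = GB z.1 u.1 v.1 + (φ z.1) ^ 2 * GV z.2 u.2 v.2 := rfl

theorem fderiv_warpedForm (HB : IsRiemannianForm GB) (HV : IsRiemannianForm GV)
    (hφ : ContDiff ℝ ∞ φ) (z a b c : B × V) :
    fderiv ℝ (fun x => warpedForm GB φ GV x a b) z c =
      fderiv ℝ (fun x => GB x a.1 b.1) z.1 c.1 +
      (φ z.1 * φ z.1 * fderiv ℝ (fun x => GV x a.2 b.2) z.2 c.2 +
        GV z.2 a.2 b.2 * (2 * φ z.1 * fderiv ℝ φ z.1 c.1)) := by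
  have h1 := HB.contDiff_apply a.1 b.1
  have h2 := HV.contDiff_apply a.2 b.2
  have e1 := fderiv_comp_clm h1 (ContinuousLinearMap.fst ℝ B V) z c
  have e2 := fderiv_comp_clm h2 (ContinuousLinearMap.snd ℝ B V) z c
  have e3 := fderiv_comp_clm (hφ.mul hφ) (ContinuousLinearMap.fst ℝ B V) z c
  have c1 := h1.comp (ContinuousLinearMap.fst ℝ B V).contDiff
  have c2 := h2.comp (ContinuousLinearMap.snd ℝ B V).contDiff
  have c3 := (hφ.mul hφ).comp (ContinuousLinearMap.fst ℝ B V).contDiff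
  simp only [warpedForm_apply, pow_two]
  have s := fderiv_mul_apply c3 c2 z c
  have t := fderiv_fun_add (c1.differentiableAt_infty z) ((c3.mul c2).differentiableAt_infty z)
  simp only [Function.comp_def, ContinuousLinearMap.coe_fst', ContinuousLinearMap.coe_snd'] at *
  rw [t, add_apply, s, e1, e2, e3, fderiv_mul_apply hφ hφ]
  ring

theorem secondDeriv_warpedForm (HB : IsRiemannianForm GB) (HV : IsRiemannianForm GV)
    (hφ : ContDiff ℝ ∞ φ) (z a b c d : B × V) :
    secondDeriv (fun x => warpedForm GB φ GV x a b) z c d =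
      secondDeriv (fun x => GB x a.1 b.1) z.1 c.1 d.1 +
      (φ z.1 * φ z.1 * secondDeriv (fun x => GV x a.2 b.2) z.2 c.2 d.2 +
        (2 * φ z.1 * fderiv ℝ φ z.1 c.1) * fderiv ℝ (fun x => GV x a.2 b.2) z.2 d.2 +
        (GV z.2 a.2 b.2 * (2 * φ z.1 * secondDeriv φ z.1 c.1 d.1 +
          2 * fderiv ℝ φ z.1 c.1 * fderiv ℝ φ z.1 d.1) +
        fderiv ℝ (fun x => GV x a.2 b.2) z.2 c.2 * (2 * φ z.1 * fderiv ℝ φ z.1 d.1))) := by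
  have h1 := HB.contDiff_apply a.1 b.1
  have h2 := HV.contDiff_apply a.2 b.2
  have e1 := secondDeriv_comp_clm h1 (ContinuousLinearMap.fst ℝ B V) z c d
  have e2 := secondDeriv_comp_clm h2 (ContinuousLinearMap.snd ℝ B V) z c d
  have e3 := secondDeriv_comp_clm (hφ.mul hφ) (ContinuousLinearMap.fst ℝ B V) z c d
  have f2 := fun c => fderiv_comp_clm h2 (ContinuousLinearMap.snd ℝ B V) z c
  have f3 := fun c => fderiv_comp_clm (hφ.mul hφ) (ContinuousLinearMap.fst ℝ B V) z c
  have c1 := h1.comp (ContinuousLinearMap.fst ℝ B V).contDiff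
  have c2 := h2.comp (ContinuousLinearMap.snd ℝ B V).contDiff
  have c3 := (hφ.mul hφ).comp (ContinuousLinearMap.fst ℝ B V).contDiff
  simp only [warpedForm_apply, pow_two]
  have s := secondDeriv_mul c3 c2 z c d
  have t := secondDeriv_add c1 (c3.mul c2) z c d
  simp only [Function.comp_def, ContinuousLinearMap.coe_fst', ContinuousLinearMap.coe_snd'] at *
  rw [t, s, e1, e2, e3, f2, f2, f3, f3, fderiv_mul_apply hφ hφ, fderiv_mul_apply hφ hφ,
    secondDeriv_mul hφ hφ]
  ring

variable [FiniteDimensional ℝ B] [FiniteDimensional ℝ V]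

theorem IsRiemannianForm.warpedForm (HB : IsRiemannianForm GB) (HV : IsRiemannianForm GV)
    (hφ : ContDiff ℝ ∞ φ) (hφ0 : ∀ b, 0 < φ b) : IsRiemannianForm (warpedForm GB φ GV) where
  smooth := contDiff_form fun u v =>
    ((HB.contDiff_apply u.1 v.1).comp contDiff_fst).add
      (((hφ.comp contDiff_fst).pow 2).mul ((HV.contDiff_apply u.2 v.2).comp contDiff_snd))
  symm y u v := by simp only [warpedForm_apply, HB.symm y.1 u.1, HV.symm y.2 u.2]
  pos y u hu := by
    rw [warpedForm_apply]
    have hp := pow_pos (hφ0 y.1) 2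
    by_cases h1 : u.1 = 0
    · have h2 : u.2 ≠ 0 := fun h2 => hu (Prod.ext h1 h2)
      simpa [h1] using mul_pos hp (HV.pos y.2 _ h2)
    · have h3 : 0 ≤ GV y.2 u.2 u.2 := by
        by_cases h2 : u.2 = 0
        · simp [h2]
        · exact (HV.pos y.2 _ h2).le
      have := HB.pos y.1 _ h1
      positivity

theorem christoffel_warpedForm (HB : IsRiemannianForm GB) (HV : IsRiemannianForm GV)
    (hφ : ContDiff ℝ ∞ φ) (hφ0 : ∀ b, 0 < φ b) (z u v : B × V) :
    christoffel (warpedForm GB φ GV) z u v =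
      (christoffel GB z.1 u.1 v.1 - (φ z.1 * GV z.2 u.2 v.2) • metricGrad GB φ z.1,
        christoffel GV z.2 u.2 v.2 + ((φ z.1)⁻¹ * fderiv ℝ φ z.1 u.1) • v.2 +
          ((φ z.1)⁻¹ * fderiv ℝ φ z.1 v.1) • u.2) := by
  refine (HB.warpedForm HV hφ hφ0).christoffel_eq fun w => ?_
  rw [fderiv_warpedForm HB HV hφ, fderiv_warpedForm HB HV hφ, fderiv_warpedForm HB HV hφ,
    warpedForm_apply]
  simp only [map_sub, map_add, map_smul, sub_apply, add_apply, smul_apply, smul_eq_mul,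
    HB.inner_christoffel, HV.inner_christoffel, HB.inner_metricGrad]
  have := (hφ0 z.1).ne'
  field_simp
  ring

/-- The curvature of a warped product. -/
theorem curvForm_warpedForm (HB : IsRiemannianForm GB) (HV : IsRiemannianForm GV)
    (hφ : ContDiff ℝ ∞ φ) (hφ0 : ∀ b, 0 < φ b) (z u v : B × V) :
    curvForm (warpedForm GB φ GV) z u v =
      curvForm GB z.1 u.1 v.1 + (φ z.1) ^ 2 * curvForm GV z.2 u.2 v.2
      - (φ z.1) ^ 2 * gradInner GB φ φ z.1 * areaForm GV z.2 u.2 v.2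
      - φ z.1 * (metricHess GB φ z.1 u.1 u.1 * GV z.2 v.2 v.2
        - 2 * metricHess GB φ z.1 u.1 v.1 * GV z.2 u.2 v.2
        + metricHess GB φ z.1 v.1 v.1 * GV z.2 u.2 u.2) := by
  rw [(HB.warpedForm HV hφ hφ0).curvForm_eq, HB.curvForm_eq, HV.curvForm_eq,
    secondDeriv_warpedForm HB HV hφ, secondDeriv_warpedForm HB HV hφ,
    secondDeriv_warpedForm HB HV hφ, christoffel_warpedForm HB HV hφ hφ0,
    christoffel_warpedForm HB HV hφ hφ0, christoffel_warpedForm HB HV hφ hφ0, warpedForm_apply,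
    warpedForm_apply]
  have g : ∀ X, GB z.1 X (metricGrad GB φ z.1) = fderiv ℝ φ z.1 X := fun X => by
    rw [HB.symm, HB.inner_metricGrad]
  simp only [map_sub, map_add, map_smul, sub_apply, add_apply, smul_apply, smul_eq_mul,
    HB.inner_metricGrad, g, HV.fderiv_inner, metricHess, gradInner, areaForm]
  have cu : ∀ a b, GV z.2 u.2 (christoffel GV z.2 a b) = GV z.2 (christoffel GV z.2 a b) u.2 :=
    fun a b => HV.symm _ _ _
  have cv : ∀ a b, GV z.2 v.2 (christoffel GV z.2 a b) = GV z.2 (christoffel GV z.2 a b) v.2 :=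
    fun a b => HV.symm _ _ _
  simp only [HV.christoffel_symm z.2 v.2 u.2, cu, cv, HV.symm z.2 v.2 u.2]
  have := (hφ0 z.1).ne'
  field_simp
  ring

end Warped

end CoordinateMetricConstructions

section CurvatureComparison

variable {E : Type*} [NormedAddCommGroup E] [NormedSpace ℝ E] [FiniteDimensional ℝ E]

namespace IsRiemannianForm

variable {G : E → E →L[ℝ] E →L[ℝ] ℝ}

set_option synthInstance.maxHeartbeats 100000 in
theorem christoffel_add_smul (H : IsRiemannianForm G) (y u v : E) (s : ℝ) :
    christoffel G y (u + s • v) (u + s • v) =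
      christoffel G y u u + (2 * s) • christoffel G y u v + (s * s) • christoffel G y v v := by
  refine H.christoffel_eq fun w => ?_
  rw [H.fderiv_apply₂ y (u + s • v) w, H.fderiv_apply₂ y (u + s • v) (u + s • v)]
  simp only [map_add, map_smul, add_apply, smul_apply, smul_eq_mul, H.inner_christoffel,
    H.fderiv_apply₂]
  have hs := H.fderiv_symm y v u w
  rw [H.fderiv_apply₂, H.fderiv_apply₂] at hs
  rw [hs]
  ring

theorem metricHess_add_smul (H : IsRiemannianForm G) {f : E → ℝ} (hf : ContDiff ℝ ∞ f)
    (y u v : E) (s : ℝ) :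
    metricHess G f y (u + s • v) (u + s • v) =
      metricHess G f y u u + 2 * s * metricHess G f y u v + s * s * metricHess G f y v v := by
  have e : ∀ a, secondDeriv f y a (u + s • v) = secondDeriv f y a u + s * secondDeriv f y a v := by
    intro a
    rw [secondDeriv_symm hf, secondDeriv_symm hf y a u, secondDeriv_symm hf y a v]
    simp [secondDeriv]
  have e' : ∀ a, secondDeriv f y (u + s • v) a = secondDeriv f y u a + s * secondDeriv f y v a :=
    fun a => by simp [secondDeriv]
  unfold metricHess
  rw [H.christoffel_add_smul, e, e', e', secondDeriv_symm hf y v u]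
  simp only [map_add, map_smul, smul_eq_mul]
  ring

end IsRiemannianForm

theorem sq_le_mul_of_forall_nonneg {a b k : ℝ} (h : ∀ s : ℝ, 0 ≤ a + 2 * s * k + s * s * b) :
    k ^ 2 ≤ a * b := by
  have := discrim_le_zero (a := b) (b := 2 * k) (c := a) fun s => by linarith [h s]
  rw [discrim] at this
  linarith

theorem two_mul_mul_le_of_sq_le {a b p q k g : ℝ} (ha : 0 ≤ a) (hb : 0 ≤ b) (hp : 0 ≤ p)
    (hq : 0 ≤ q) (hk : k ^ 2 ≤ a * b) (hg : g ^ 2 ≤ p * q) : 2 * k * g ≤ a * q + b * p := by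
  refine abs_le_of_sq_le_sq' ?_ (by positivity) |>.2
  have : k ^ 2 * g ^ 2 ≤ (a * b) * (p * q) := mul_le_mul hk hg (sq_nonneg _) (by positivity)
  nlinarith [sq_nonneg (a * q - b * p)]

/-- The inequality `-curvature ≥ k` (for `s > 0`) or `-curvature ≤ k` (for `s < 0`) at `y`. -/
def CurvatureSide (s k : ℝ) (G : E → E →L[ℝ] E →L[ℝ] ℝ) (y : E) : Prop :=
  ∀ u v, 0 ≤ s * (-curvForm G y u v - k * areaForm G y u v)

theorem curvForm_const {A : E →L[ℝ] E →L[ℝ] ℝ} (H : IsRiemannianForm fun _ : E => A) (y u v : E) :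
    curvForm (fun _ => A) y u v = 0 := by
  have h : ∀ a b, christoffel (fun _ : E => A) y a b = 0 := fun a b =>
    H.christoffel_eq fun w => by simp
  rw [H.curvForm_eq]
  simp [h, secondDeriv]

theorem metricHess_const {A : E →L[ℝ] E →L[ℝ] ℝ} (H : IsRiemannianForm fun _ : E => A)
    (f : E → ℝ) (y u v : E) : metricHess (fun _ => A) f y u v = secondDeriv f y u v := by
  have h : ∀ a b, christoffel (fun _ : E => A) y a b = 0 := fun a b =>
    H.christoffel_eq fun w => by simp
  simp [metricHess, h]

variable {B : Type*} [NormedAddCommGroup B] [NormedSpace ℝ B] [FiniteDimensional ℝ B]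
  {V : Type*} [NormedAddCommGroup V] [NormedSpace ℝ V] [FiniteDimensional ℝ V]
  {GB : B → B →L[ℝ] B →L[ℝ] ℝ} {φ : B → ℝ} {GV : V → V →L[ℝ] V →L[ℝ] ℝ}

theorem CurvatureSide.warpedForm {s k : ℝ} (HB : IsRiemannianForm GB) (HV : IsRiemannianForm GV)
    (hφ : ContDiff ℝ ∞ φ) (hφ0 : ∀ b, 0 < φ b) (z : B × V) (h : CurvatureSide s k GB z.1)
    (hh : ∀ X, 0 ≤ s * (metricHess GB φ z.1 X X - k * φ z.1 * GB z.1 X X))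
    (hf : ∀ U W, 0 ≤ s * (-curvForm GV z.2 U W + (gradInner GB φ φ z.1 - k * (φ z.1) ^ 2) *
      areaForm GV z.2 U W)) :
    CurvatureSide s k (warpedForm GB φ GV) z := by
  intro u v
  rw [curvForm_warpedForm HB HV hφ hφ0]
  have h1 := h u.1 v.1
  have h2 := hf u.2 v.2
  have hp := hφ0 z.1
  have hV : ∀ U, 0 ≤ GV z.2 U U := fun U => by
    by_cases hU : U = 0
    · simp [hU]
    · exact (HV.pos z.2 U hU).le
  set K : B → B → ℝ := fun X Y => s * (metricHess GB φ z.1 X Y - k * φ z.1 * GB z.1 X Y) with hK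
  have hexp : ∀ σ : ℝ, K (u.1 + σ • v.1) (u.1 + σ • v.1) =
      K u.1 u.1 + 2 * σ * K u.1 v.1 + σ * σ * K v.1 v.1 := fun σ => by
    simp only [hK]
    rw [HB.metricHess_add_smul hφ]
    simp only [map_add, map_smul, add_apply, smul_apply, smul_eq_mul, HB.symm z.1 v.1 u.1]
    ring
  have hCS : K u.1 v.1 ^ 2 ≤ K u.1 u.1 * K v.1 v.1 :=
    sq_le_mul_of_forall_nonneg fun σ => by rw [← hexp]; exact hh _
  have hCS' : (GV z.2 u.2 v.2) ^ 2 ≤ GV z.2 u.2 u.2 * GV z.2 v.2 v.2 := by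
    have := HV.areaForm_nonneg z.2 u.2 v.2
    unfold areaForm at this
    linarith
  have h3 := two_mul_mul_le_of_sq_le (hh u.1) (hh v.1) (hV u.2) (hV v.2) hCS hCS'
  have h4 : 0 ≤ φ z.1 * (K u.1 u.1 * GV z.2 v.2 v.2 + K v.1 v.1 * GV z.2 u.2 u.2 -
      2 * K u.1 v.1 * GV z.2 u.2 v.2) := mul_nonneg hp.le (by linarith)
  have h5 := mul_nonneg (sq_nonneg (φ z.1)) h2
  have : areaForm (_root_.warpedForm GB φ GV) z u v = areaForm GB z.1 u.1 v.1 + (φ z.1) ^ 2 *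
      (GB z.1 u.1 u.1 * GV z.2 v.2 v.2 + GB z.1 v.1 v.1 * GV z.2 u.2 u.2 -
        2 * GB z.1 u.1 v.1 * GV z.2 u.2 v.2) + (φ z.1) ^ 4 * areaForm GV z.2 u.2 v.2 := by
    simp only [areaForm, warpedForm_apply]
    ring
  rw [this]
  simp only [hK] at h4
  linarith

theorem metricHess_warpedForm_fst (HB : IsRiemannianForm GB) (HV : IsRiemannianForm GV)
    (hφ : ContDiff ℝ ∞ φ) (hφ0 : ∀ b, 0 < φ b) {ψ : B → ℝ} (hψ : ContDiff ℝ ∞ ψ) (z u v : B × V) :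
    metricHess (warpedForm GB φ GV) (fun z => ψ z.1) z u v =
      metricHess GB ψ z.1 u.1 v.1 + φ z.1 * gradInner GB ψ φ z.1 * GV z.2 u.2 v.2 := by
  unfold metricHess
  rw [fderiv_comp_fst hψ, christoffel_warpedForm HB HV hφ hφ0,
    show secondDeriv (fun z : B × V => ψ z.1) z u v = secondDeriv ψ z.1 u.1 v.1 from
      secondDeriv_comp_clm hψ (ContinuousLinearMap.fst ℝ B V) z u v]
  simp only [map_sub, map_smul, smul_eq_mul, gradInner]
  ring

theorem gradInner_warpedForm_fst (HB : IsRiemannianForm GB) (HV : IsRiemannianForm GV)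
    (hφ : ContDiff ℝ ∞ φ) (hφ0 : ∀ b, 0 < φ b) {ψ χ : B → ℝ} (hψ : ContDiff ℝ ∞ ψ)
    (hχ : ContDiff ℝ ∞ χ) (z : B × V) :
    gradInner (warpedForm GB φ GV) (fun z => ψ z.1) (fun z => χ z.1) z =
      gradInner GB ψ χ z.1 := by
  unfold gradInner
  rw [fderiv_comp_fst hψ, (HB.warpedForm HV hφ hφ0).metricGrad_eq
    (X := (metricGrad GB χ z.1, 0)) fun w => ?_]
  rw [fderiv_comp_fst hχ]
  simp [HB.inner_metricGrad]

/-- The standard metric on the real line. -/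
noncomputable def lineForm (_ : ℝ) : ℝ →L[ℝ] ℝ →L[ℝ] ℝ := ContinuousLinearMap.mul ℝ ℝ

@[simp] theorem lineForm_apply (y u v : ℝ) : lineForm y u v = u * v := rfl

theorem isRiemannianForm_lineForm : IsRiemannianForm lineForm where
  smooth := contDiff_const
  symm _ u v := mul_comm u v
  pos _ _ hu := mul_self_pos.2 hu

theorem curvForm_lineForm (y u v : ℝ) : curvForm lineForm y u v = 0 :=
  curvForm_const isRiemannianForm_lineForm y u v

theorem areaForm_lineForm (y u v : ℝ) : areaForm lineForm y u v = 0 := by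
  simp only [areaForm, lineForm_apply]
  ring

theorem curvatureSide_lineForm (s k y : ℝ) : CurvatureSide s k lineForm y := fun u v => by
  simp [curvForm_lineForm, areaForm_lineForm]

theorem CurvatureSide.warpedForm_line {s k : ℝ} (HB : IsRiemannianForm GB)
    (hφ : ContDiff ℝ ∞ φ) (hφ0 : ∀ b, 0 < φ b) (z : B × ℝ) (h : CurvatureSide s k GB z.1)
    (hh : ∀ X, 0 ≤ s * (metricHess GB φ z.1 X X - k * φ z.1 * GB z.1 X X)) :
    CurvatureSide s k (_root_.warpedForm GB φ lineForm) z :=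
  h.warpedForm HB isRiemannianForm_lineForm hφ hφ0 z hh fun U W => by
    simp [curvForm_lineForm, areaForm_lineForm]

/-- The metric `G_B + P² dρ² + Q² dτ² + S² G_V`. -/
noncomputable def tripleForm (GB : B → B →L[ℝ] B →L[ℝ] ℝ) (P Q S : B → ℝ)
    (GV : V → V →L[ℝ] V →L[ℝ] ℝ) :
    ((B × ℝ) × ℝ) × V → ((B × ℝ) × ℝ) × V →L[ℝ] ((B × ℝ) × ℝ) × V →L[ℝ] ℝ :=
  warpedForm (warpedForm (warpedForm GB P lineForm) (fun z => Q z.1) lineForm)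
    (fun z => S z.1.1) GV

/-- The inequalities on the warping functions that imply a one-sided curvature bound for the
metric `G_B + P² dρ² + Q² dτ² + S² G_V` with `G_V` hyperbolic. -/
structure WarpingSide (s k : ℝ) (GB : B → B →L[ℝ] B →L[ℝ] ℝ) (P Q S : B → ℝ) (b : B) : Prop where
  base : CurvatureSide s k GB b
  hessP : ∀ X, 0 ≤ s * (metricHess GB P b X X - k * P b * GB b X X)
  hessQ : ∀ X, 0 ≤ s * (metricHess GB Q b X X - k * Q b * GB b X X)
  hessS : ∀ X, 0 ≤ s * (metricHess GB S b X X - k * S b * GB b X X)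
  gradQP : 0 ≤ s * (gradInner GB Q P b - k * Q b * P b)
  gradSP : 0 ≤ s * (gradInner GB S P b - k * S b * P b)
  gradSQ : 0 ≤ s * (gradInner GB S Q b - k * S b * Q b)
  gradSS : 0 ≤ s * (1 + gradInner GB S S b - k * (S b) ^ 2)

section Triple

variable {P Q S : B → ℝ}

theorem IsRiemannianForm.tripleForm (HB : IsRiemannianForm GB) (HV : IsRiemannianForm GV)
    (hP : ContDiff ℝ ∞ P) (hP0 : ∀ b, 0 < P b) (hQ : ContDiff ℝ ∞ Q) (hQ0 : ∀ b, 0 < Q b)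
    (hS : ContDiff ℝ ∞ S) (hS0 : ∀ b, 0 < S b) : IsRiemannianForm (tripleForm GB P Q S GV) :=
  ((HB.warpedForm isRiemannianForm_lineForm hP hP0).warpedForm isRiemannianForm_lineForm
    (hQ.comp contDiff_fst) fun _ => hQ0 _).warpedForm HV
    (hS.comp (contDiff_fst.comp contDiff_fst)) fun _ => hS0 _

theorem WarpingSide.curvatureSide {s k : ℝ} (HB : IsRiemannianForm GB) (HV : IsRiemannianForm GV)
    (hyp : ∀ x U W, curvForm GV x U W = -areaForm GV x U W)
    (hP : ContDiff ℝ ∞ P) (hP0 : ∀ b, 0 < P b) (hQ : ContDiff ℝ ∞ Q) (hQ0 : ∀ b, 0 < Q b)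
    (hS : ContDiff ℝ ∞ S) (hS0 : ∀ b, 0 < S b) (z : ((B × ℝ) × ℝ) × V)
    (h : WarpingSide s k GB P Q S z.1.1.1) :
    CurvatureSide s k (_root_.tripleForm GB P Q S GV) z := by
  have H1 := HB.warpedForm isRiemannianForm_lineForm hP hP0
  have hQ' : ContDiff ℝ ∞ fun z : B × ℝ => Q z.1 := hQ.comp contDiff_fst
  have hS' : ContDiff ℝ ∞ fun z : B × ℝ => S z.1 := hS.comp contDiff_fst
  have H2 := H1.warpedForm isRiemannianForm_lineForm hQ' fun _ => hQ0 _
  have hP1 := hP0 z.1.1.1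
  have hQ1 := hQ0 z.1.1.1
  have step : ∀ (f : B → ℝ) (hf : ContDiff ℝ ∞ f)
      (_ : ∀ X, 0 ≤ s * (metricHess GB f z.1.1.1 X X - k * f z.1.1.1 * GB z.1.1.1 X X))
      (_ : 0 ≤ s * (gradInner GB f P z.1.1.1 - k * f z.1.1.1 * P z.1.1.1)) (X : B × ℝ),
      0 ≤ s * (metricHess (warpedForm GB P lineForm) (fun z => f z.1) z.1.1 X X -
        k * f z.1.1.1 * warpedForm GB P lineForm z.1.1 X X) := by
    intro f hf h1 h2 X
    rw [metricHess_warpedForm_fst HB isRiemannianForm_lineForm hP hP0 hf, warpedForm_apply]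
    simp only [lineForm_apply]
    have a1 := h1 X.1
    have a2 := mul_nonneg (mul_nonneg hP1.le (mul_self_nonneg X.2)) h2
    linarith
  have C1 := h.base.warpedForm_line HB hP hP0 z.1.1 h.hessP
  have C2 := C1.warpedForm_line H1 hQ' (fun _ => hQ0 _) z.1 (step Q hQ h.hessQ h.gradQP)
  refine C2.warpedForm H2 HV (hS'.comp contDiff_fst) (fun _ => hS0 _) z (fun X => ?_) fun U W => ?_
  · have e := metricHess_warpedForm_fst H1 isRiemannianForm_lineForm hQ' (fun _ => hQ0 _) hS' z.1 X X
    simp only [Function.comp_def] at e ⊢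
    rw [e, warpedForm_apply, gradInner_warpedForm_fst HB isRiemannianForm_lineForm hP hP0 hS hQ]
    have a1 := step S hS h.hessS h.gradSP X.1
    have a2 := mul_nonneg (mul_nonneg hQ1.le (mul_self_nonneg X.2)) h.gradSQ
    simp only [lineForm_apply] at a1 ⊢
    linarith
  · have e := gradInner_warpedForm_fst H1 isRiemannianForm_lineForm hQ' (fun _ => hQ0 _) hS' hS' z.1
    simp only [Function.comp_def] at e ⊢
    rw [e, gradInner_warpedForm_fst HB isRiemannianForm_lineForm hP hP0 hS hS, hyp]
    have := mul_nonneg (HV.areaForm_nonneg z.2 U W) h.gradSS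
    linarith

end Triple

end CurvatureComparison

section HyperbolicForm

/-- The hyperbolic metric on `ℝ^m` as a bilinear form depending on the point. -/
noncomputable def hyperbolicForm (m : ℕ) (x : Euc m) : Euc m →L[ℝ] Euc m →L[ℝ] ℝ :=
  ∑ i : Fin m, (if i.val = 0 then 1 else Real.exp (2 * x ⟨0, i.pos⟩)) •
    (ContinuousLinearMap.mul ℝ ℝ).bilinearComp (EuclideanSpace.proj i) (EuclideanSpace.proj i)

theorem hyperbolicForm_apply {m : ℕ} (x u v : Euc m) :
    hyperbolicForm m x u v = hypMetric x u v := by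
  simp only [hyperbolicForm, hypMetric, sum_apply, smul_apply,
    ContinuousLinearMap.bilinearComp_apply, ContinuousLinearMap.mul_apply', smul_eq_mul]
  rfl

/-- Splitting off the first coordinate. -/
noncomputable def eucSucc (k : ℕ) : Euc (k + 1) ≃L[ℝ] ℝ × Euc k :=
  (EuclideanSpace.equiv (Fin (k + 1)) ℝ).trans ((Fin.consEquivL ℝ (fun _ => ℝ)).symm.trans
    ((ContinuousLinearEquiv.refl ℝ ℝ).prodCongr (EuclideanSpace.equiv (Fin k) ℝ).symm))

theorem eucSucc_fst {k : ℕ} (x : Euc (k + 1)) : (eucSucc k x).1 = x 0 := rfl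

theorem eucSucc_snd {k : ℕ} (x : Euc (k + 1)) (i : Fin k) : (eucSucc k x).2 i = x i.succ := rfl

/-- The Euclidean metric on `ℝ^k`. -/
noncomputable def flatForm (k : ℕ) (_ : Euc k) : Euc k →L[ℝ] Euc k →L[ℝ] ℝ := innerSL ℝ

@[simp] theorem flatForm_apply {k : ℕ} (x u v : Euc k) : flatForm k x u v = inner ℝ u v := rfl

theorem isRiemannianForm_flatForm (k : ℕ) : IsRiemannianForm (flatForm k) where
  smooth := contDiff_const
  symm _ u v := (real_inner_comm u v).symm
  pos _ _ hu := real_inner_self_pos.2 hu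

theorem hyperbolicForm_succ (k : ℕ) : hyperbolicForm (k + 1) =
    pullForm (eucSucc k) (warpedForm lineForm Real.exp (flatForm k)) := by
  ext x u v
  rw [hyperbolicForm_apply, pullForm_apply, warpedForm_apply, hypMetric, Fin.sum_univ_succ]
  simp only [lineForm_apply, flatForm_apply, eucSucc_fst, PiLp.inner_apply, eucSucc_snd,
    Finset.mul_sum]
  congr 1
  · simp
  · refine Finset.sum_congr rfl fun i _ => ?_
    rw [if_neg (by simp), two_mul, Real.exp_add, pow_two]
    simp only [RCLike.inner_apply, conj_trivial]
    rw [show (⟨0, i.succ.pos⟩ : Fin (k + 1)) = 0 from rfl]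
    ring

theorem isRiemannianForm_hyperbolicForm (m : ℕ) : IsRiemannianForm (hyperbolicForm m) := by
  cases m with
  | zero =>
    refine ⟨?_, fun y u v => ?_, fun y u hu => absurd (Subsingleton.elim u 0) hu⟩
    · rw [show hyperbolicForm 0 = fun _ => 0 from by ext x u v; simp [hyperbolicForm]]
      exact contDiff_const
    · simp [hyperbolicForm]
  | succ k =>
    rw [hyperbolicForm_succ]
    exact (isRiemannianForm_lineForm.warpedForm (isRiemannianForm_flatForm k) Real.contDiff_exp
      Real.exp_pos).pullForm _

theorem metricHess_lineForm {f f' f'' : ℝ → ℝ} (hf : ∀ x, HasDerivAt f (f' x) x)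
    (hf' : ∀ x, HasDerivAt f' (f'' x) x) (y u v : ℝ) :
    metricHess lineForm f y u v = f'' y * (u * v) := by
  have := metricHess_const (A := ContinuousLinearMap.mul ℝ ℝ) isRiemannianForm_lineForm f y u v
  rw [show lineForm = fun _ => ContinuousLinearMap.mul ℝ ℝ from rfl, this, secondDeriv]
  have e : (fun z => fderiv ℝ f z v) = fun z => f' z * v := by
    ext z
    rw [(hf z).hasFDerivAt.fderiv]
    simp [mul_comm]
  rw [e, ((hf' y).mul_const v).hasFDerivAt.fderiv]
  simp
  ring

theorem gradInner_lineForm {f f' g g' : ℝ → ℝ} (hf : ∀ x, HasDerivAt f (f' x) x)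
    (hg : ∀ x, HasDerivAt g (g' x) x) (y : ℝ) :
    gradInner lineForm f g y = f' y * g' y := by
  unfold gradInner
  rw [isRiemannianForm_lineForm.metricGrad_eq (X := g' y) fun w => ?_, (hf y).hasFDerivAt.fderiv]
  · simp [mul_comm]
  · rw [(hg y).hasFDerivAt.fderiv]
    simp [mul_comm]

theorem curvForm_hyperbolicForm (m : ℕ) (x u v : Euc m) :
    curvForm (hyperbolicForm m) x u v = -areaForm (hyperbolicForm m) x u v := by
  cases m with
  | zero => simp [curvForm, areaForm, Subsingleton.elim u 0]
  | succ k =>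
    have HW := isRiemannianForm_lineForm.warpedForm (isRiemannianForm_flatForm k)
      Real.contDiff_exp Real.exp_pos
    have hc : ∀ y a b, curvForm (flatForm k) y a b = 0 := fun y a b =>
      curvForm_const (isRiemannianForm_flatForm k) y a b
    rw [hyperbolicForm_succ, curvForm_pullForm HW, curvForm_warpedForm isRiemannianForm_lineForm
      (isRiemannianForm_flatForm k) Real.contDiff_exp Real.exp_pos, curvForm_lineForm, hc,
      gradInner_lineForm Real.hasDerivAt_exp Real.hasDerivAt_exp,
      metricHess_lineForm Real.hasDerivAt_exp Real.hasDerivAt_exp,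
      metricHess_lineForm Real.hasDerivAt_exp Real.hasDerivAt_exp,
      metricHess_lineForm Real.hasDerivAt_exp Real.hasDerivAt_exp]
    simp only [areaForm, pullForm_apply, warpedForm_apply, lineForm_apply]
    ring

end HyperbolicForm

section Partials

/-- `ψ` is a smooth function of two variables with the given first and second partial
derivatives. -/
structure HasPartials (ψ ψr ψt ψrr ψrt ψtt : ℝ → ℝ → ℝ) : Prop where
  smooth : ContDiff ℝ ∞ fun q : ℝ × ℝ => ψ q.1 q.2
  dr : ∀ r t, HasDerivAt (fun r => ψ r t) (ψr r t) r
  dt : ∀ r t, HasDerivAt (fun t => ψ r t) (ψt r t) t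
  drr : ∀ r t, HasDerivAt (fun r => ψr r t) (ψrr r t) r
  drt : ∀ r t, HasDerivAt (fun t => ψr r t) (ψrt r t) t
  dtt : ∀ r t, HasDerivAt (fun t => ψt r t) (ψtt r t) t

theorem hasDerivAt_fst_slice {g : ℝ × ℝ → ℝ} {z : ℝ × ℝ} (hg : DifferentiableAt ℝ g z) :
    HasDerivAt (fun r => g (r, z.2)) (fderiv ℝ g z (1, 0)) z.1 :=
  HasFDerivAt.comp_hasDerivAt (l := g) z.1 hg.hasFDerivAt
    ((hasDerivAt_id z.1).prodMk (hasDerivAt_const z.1 z.2))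

theorem hasDerivAt_snd_slice {g : ℝ × ℝ → ℝ} {z : ℝ × ℝ} (hg : DifferentiableAt ℝ g z) :
    HasDerivAt (fun t => g (z.1, t)) (fderiv ℝ g z (0, 1)) z.2 :=
  HasFDerivAt.comp_hasDerivAt (l := g) z.2 hg.hasFDerivAt
    ((hasDerivAt_const z.2 z.1).prodMk (hasDerivAt_id z.2))

theorem fderiv_apply_eq_partials {ψ : ℝ → ℝ → ℝ} {p q : ℝ} {z : ℝ × ℝ}
    (hψ : DifferentiableAt ℝ (fun q : ℝ × ℝ => ψ q.1 q.2) z)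
    (hr : HasDerivAt (fun r => ψ r z.2) p z.1) (ht : HasDerivAt (fun t => ψ z.1 t) q z.2)
    (v : ℝ × ℝ) : fderiv ℝ (fun q : ℝ × ℝ => ψ q.1 q.2) z v = p * v.1 + q * v.2 := by
  have e1 : fderiv ℝ (fun q : ℝ × ℝ => ψ q.1 q.2) z (1, 0) = p :=
    (hasDerivAt_fst_slice hψ).unique hr
  have e2 : fderiv ℝ (fun q : ℝ × ℝ => ψ q.1 q.2) z (0, 1) = q :=
    (hasDerivAt_snd_slice hψ).unique ht
  have : v = v.1 • ((1 : ℝ), (0 : ℝ)) + v.2 • ((0 : ℝ), (1 : ℝ)) := by ext <;> simp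
  rw [this, map_add, map_smul, map_smul, e1, e2]
  simp [mul_comm]

variable {ψ ψr ψt ψrr ψrt ψtt : ℝ → ℝ → ℝ} {χ χr χt χrr χrt χtt : ℝ → ℝ → ℝ}

theorem HasPartials.fderiv_eq (H : HasPartials ψ ψr ψt ψrr ψrt ψtt) (z v : ℝ × ℝ) :
    fderiv ℝ (fun q : ℝ × ℝ => ψ q.1 q.2) z v = ψr z.1 z.2 * v.1 + ψt z.1 z.2 * v.2 :=
  fderiv_apply_eq_partials (H.smooth.differentiableAt_infty z) (H.dr _ _) (H.dt _ _) v

theorem HasPartials.secondDeriv_eq (H : HasPartials ψ ψr ψt ψrr ψrt ψtt) (z u : ℝ × ℝ) :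
    secondDeriv (fun q : ℝ × ℝ => ψ q.1 q.2) z u u =
      ψrr z.1 z.2 * u.1 ^ 2 + 2 * ψrt z.1 z.2 * (u.1 * u.2) + ψtt z.1 z.2 * u.2 ^ 2 := by
  set f : ℝ × ℝ → ℝ := fun q => ψ q.1 q.2 with hf
  have hu : u = u.1 • ((1 : ℝ), (0 : ℝ)) + u.2 • ((0 : ℝ), (1 : ℝ)) := by ext <;> simp
  have f1 : (fun z => fderiv ℝ f z (1, 0)) = fun z => ψr z.1 z.2 := by
    ext z; rw [H.fderiv_eq]; simp
  have f2 : (fun z => fderiv ℝ f z (0, 1)) = fun z => ψt z.1 z.2 := by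
    ext z; rw [H.fderiv_eq]; simp
  have d1 := H.smooth.fderiv_apply_const (1, 0)
  have d2 := H.smooth.fderiv_apply_const (0, 1)
  rw [← hf, f1] at d1
  rw [← hf, f2] at d2
  have a11 : secondDeriv f z (1, 0) (1, 0) = ψrr z.1 z.2 := by
    unfold secondDeriv
    rw [f1]
    exact (hasDerivAt_fst_slice (d1.differentiableAt_infty z)).unique (H.drr _ _)
  have a21 : secondDeriv f z (0, 1) (1, 0) = ψrt z.1 z.2 := by
    unfold secondDeriv
    rw [f1]
    exact (hasDerivAt_snd_slice (d1.differentiableAt_infty z)).unique (H.drt _ _)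
  have a22 : secondDeriv f z (0, 1) (0, 1) = ψtt z.1 z.2 := by
    unfold secondDeriv
    rw [f2]
    exact (hasDerivAt_snd_slice (d2.differentiableAt_infty z)).unique (H.dtt _ _)
  have left : ∀ a, secondDeriv f z u a =
      u.1 * secondDeriv f z (1, 0) a + u.2 * secondDeriv f z (0, 1) a := fun a => by
    conv_lhs => rw [hu]
    simp only [secondDeriv, map_add, map_smul, smul_eq_mul]
  rw [left, secondDeriv_symm H.smooth z (1, 0), secondDeriv_symm H.smooth z (0, 1), left, left,
    secondDeriv_symm H.smooth z (1, 0) (0, 1), a11, a21, a22]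
  ring

theorem HasPartials.h_mul {h h' h'' : ℝ → ℝ} (H : HasPartials ψ ψr ψt ψrr ψrt ψtt)
    (hs : ContDiff ℝ ∞ h) (hd : ∀ r, HasDerivAt h (h' r) r)
    (hd' : ∀ r, HasDerivAt h' (h'' r) r) :
    HasPartials (fun r t => h r * ψ r t) (fun r t => h' r * ψ r t + h r * ψr r t)
      (fun r t => h r * ψt r t) (fun r t => h'' r * ψ r t + 2 * h' r * ψr r t + h r * ψrr r t)
      (fun r t => h' r * ψt r t + h r * ψrt r t) (fun r t => h r * ψtt r t) where
  smooth := (hs.comp contDiff_fst).mul H.smooth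
  dr r t := (hd r).mul (H.dr r t)
  dt r t := (H.dt r t).const_mul _
  drr r t := (((hd' r).mul (H.dr r t)).add ((hd r).mul (H.drr r t))).congr_deriv (by ring)
  drt r t := ((H.dt r t).const_mul _).add ((H.drt r t).const_mul _)
  dtt r t := (H.dtt r t).const_mul _

variable {h h' h'' : ℝ → ℝ}

/-- The metric `dr² + h(r)² dt²`. -/
noncomputable abbrev surfaceForm (h : ℝ → ℝ) : ℝ × ℝ → ℝ × ℝ →L[ℝ] ℝ × ℝ →L[ℝ] ℝ :=
  warpedForm lineForm h lineForm

theorem christoffel_surfaceForm (hs : ContDiff ℝ ∞ h) (h0 : ∀ r, 0 < h r)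
    (hd : ∀ r, HasDerivAt h (h' r) r) (z u : ℝ × ℝ) :
    christoffel (surfaceForm h) z u u =
      (-(h z.1 * h' z.1 * u.2 ^ 2), 2 * ((h z.1)⁻¹ * h' z.1 * u.1 * u.2)) := by
  have hΓ : ∀ y a b, christoffel lineForm y a b = 0 := fun y a b =>
    isRiemannianForm_lineForm.christoffel_eq fun w => by simp
  have hg : metricGrad lineForm h z.1 = h' z.1 :=
    isRiemannianForm_lineForm.metricGrad_eq fun w => by
      rw [(hd z.1).hasFDerivAt.fderiv]; simp [mul_comm]
  rw [christoffel_warpedForm isRiemannianForm_lineForm isRiemannianForm_lineForm hs h0, hΓ, hΓ, hg,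
    (hd z.1).hasFDerivAt.fderiv]
  ext
  · simp; ring
  · simp; ring

theorem HasPartials.metricHess_surfaceForm (H : HasPartials ψ ψr ψt ψrr ψrt ψtt)
    (hs : ContDiff ℝ ∞ h) (h0 : ∀ r, 0 < h r) (hd : ∀ r, HasDerivAt h (h' r) r)
    (hd' : ∀ r, HasDerivAt h' (h'' r) r) (r t : ℝ) (u : ℝ × ℝ) :
    metricHess (surfaceForm h) (fun q => h q.1 * ψ q.1 q.2) (r, t) u u =
      (h'' r * ψ r t + 2 * h' r * ψr r t + h r * ψrr r t) * u.1 ^ 2 +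
      2 * (h r * ψrt r t) * (u.1 * u.2) +
      (h r * ψtt r t + h r * h' r * (h' r * ψ r t + h r * ψr r t)) * u.2 ^ 2 := by
  have K := H.h_mul hs hd hd'
  unfold metricHess
  rw [K.secondDeriv_eq, K.fderiv_eq, christoffel_surfaceForm hs h0 hd]
  have := (h0 r).ne'
  field_simp
  ring

theorem HasPartials.gradInner_surfaceForm (H : HasPartials ψ ψr ψt ψrr ψrt ψtt)
    (K : HasPartials χ χr χt χrr χrt χtt)
    (hs : ContDiff ℝ ∞ h) (h0 : ∀ r, 0 < h r) (hd : ∀ r, HasDerivAt h (h' r) r)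
    (hd' : ∀ r, HasDerivAt h' (h'' r) r) (r t : ℝ) :
    gradInner (surfaceForm h) (fun q => h q.1 * ψ q.1 q.2) (fun q => h q.1 * χ q.1 q.2) (r, t) =
      (h' r * ψ r t + h r * ψr r t) * (h' r * χ r t + h r * χr r t) + ψt r t * χt r t := by
  have H' := H.h_mul hs hd hd'
  have K' := K.h_mul hs hd hd'
  have hW := isRiemannianForm_lineForm.warpedForm isRiemannianForm_lineForm hs h0
  have hne := (h0 r).ne'
  unfold gradInner
  rw [hW.metricGrad_eq (y := (r, t))
    (X := (h' r * χ r t + h r * χr r t, (h r)⁻¹ * χt r t)) fun w => ?_, H'.fderiv_eq]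
  · field_simp
  · rw [K'.fderiv_eq]
    simp
    field_simp

theorem curvForm_surfaceForm (hs : ContDiff ℝ ∞ h) (h0 : ∀ r, 0 < h r)
    (hd : ∀ r, HasDerivAt h (h' r) r) (hd' : ∀ r, HasDerivAt h' (h'' r) r) (z u v : ℝ × ℝ) :
    curvForm (surfaceForm h) z u v = -(h z.1 * h'' z.1 * (u.1 * v.2 - v.1 * u.2) ^ 2) := by
  rw [curvForm_warpedForm isRiemannianForm_lineForm isRiemannianForm_lineForm hs h0,
    curvForm_lineForm, curvForm_lineForm, areaForm_lineForm, metricHess_lineForm hd hd',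
    metricHess_lineForm hd hd', metricHess_lineForm hd hd']
  simp only [lineForm_apply]
  ring

end Partials

section Inequalities

open Filter Topology

theorem exists_pos_mul_le_quadratic {α β γ w₁ w₂ : ℝ} (hα : 0 < α) (hd : β ^ 2 < α * γ)
    (hw₁ : 0 < w₁) (hw₂ : 0 < w₂) :
    ∀ᶠ c : ℝ in 𝓝[>] 0, ∀ x y : ℝ,
      c * (w₁ * x ^ 2 + w₂ * y ^ 2) ≤ α * x ^ 2 + 2 * β * (x * y) + γ * y ^ 2 := by
  have hγ : 0 < γ := by
    by_contra hγ
    nlinarith [sq_nonneg β, mul_nonneg hα.le (not_lt.1 hγ |> neg_nonneg.2)]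
  set c₀ := (α * γ - β ^ 2) / (α + γ) with hc₀
  have hc₀pos : 0 < c₀ := div_pos (by linarith) (by linarith)
  have hc₀eq : c₀ * (α + γ) = α * γ - β ^ 2 := div_mul_cancel₀ _ (by linarith)
  have hαc : 0 < α - c₀ := by
    have : (α - c₀) * (α + γ) = α ^ 2 + β ^ 2 := by linear_combination -hc₀eq
    have h2 : 0 < (α - c₀) * (α + γ) := by rw [this]; positivity
    exact (mul_pos_iff_of_pos_right (by linarith)).1 h2
  have key : ∀ x y : ℝ, c₀ * (x ^ 2 + y ^ 2) ≤ α * x ^ 2 + 2 * β * (x * y) + γ * y ^ 2 := by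
    intro x y
    have h1 : (α - c₀) * (γ - c₀) - β ^ 2 = c₀ ^ 2 := by linear_combination -hc₀eq
    have h2 : 0 ≤ (α - c₀) * ((α - c₀) * x ^ 2 + 2 * β * (x * y) + (γ - c₀) * y ^ 2) := by
      have : (α - c₀) * ((α - c₀) * x ^ 2 + 2 * β * (x * y) + (γ - c₀) * y ^ 2) =
        ((α - c₀) * x + β * y) ^ 2 + c₀ ^ 2 * y ^ 2 := by linear_combination y ^ 2 * h1
      rw [this]; positivity
    have := (mul_nonneg_iff_of_pos_left hαc).1 h2
    linarith
  have hpos : 0 < c₀ / (w₁ + w₂) := by positivity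
  filter_upwards [Ioo_mem_nhdsGT hpos] with c hc x y
  refine le_trans ?_ (key x y)
  have h1 : c * (w₁ + w₂) ≤ c₀ := by
    have := (lt_div_iff₀ (by positivity)).1 hc.2
    exact this.le
  have hc0 := hc.1
  nlinarith [mul_nonneg (mul_pos hc0 hw₂).le (sq_nonneg x), mul_nonneg (mul_pos hc0 hw₁).le (sq_nonneg y),
    sq_nonneg x, sq_nonneg y, mul_nonneg (sub_nonneg.2 h1) (sq_nonneg x),
    mul_nonneg (sub_nonneg.2 h1) (sq_nonneg y)]

theorem eventually_mul_le_of_pos {a b : ℝ} (ha : 0 < a) (hb : 0 < b) :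
    ∀ᶠ c : ℝ in 𝓝[>] 0, c * b ≤ a := by
  filter_upwards [Ioo_mem_nhdsGT (div_pos ha hb)] with c hc
  exact ((lt_div_iff₀ hb).1 hc.2).le

/-- The growth conditions on a function `G(r, t)` and its derivatives that bound the Hessian and
the gradient of `h(r) G(r, t)`. -/
structure GrowthBound (M G Gr Gt Grr Grt Gtt : ℝ) : Prop where
  pos : 0 < G
  r_nonneg : 0 ≤ Gr
  t_nonneg : 0 ≤ Gt
  r_le : Gr ≤ M * G
  t_le : Gt ≤ M * G
  rr_le : Grr ≤ M * G
  rt_le : |Grt| ≤ M * G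
  tt_le : Gtt ≤ M * G

theorem GrowthBound.hess_le {M G Gr Gt Grr Grt Gtt h h₁ h₂ : ℝ}
    (H : GrowthBound M G Gr Gt Grr Grt Gtt) (hM : 0 ≤ M) (hh : 1 ≤ h) (h₁0 : 0 ≤ h₁)
    (h₁M : h₁ ≤ M * h) (h₂M : h₂ ≤ M * h) (x y : ℝ) :
    (h₂ * G + 2 * h₁ * Gr + h * Grr) * x ^ 2 + 2 * (h * Grt) * (x * y) +
      (h * Gtt + h * h₁ * (h₁ * G + h * Gr)) * y ^ 2 ≤
      (1 + 4 * M + 5 * M ^ 2) * (h * G) * (x ^ 2 + h ^ 2 * y ^ 2) := by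
  have hG := H.pos
  have hG' := H.r_nonneg
  have h0 : 0 < h := by linarith
  have a1 : h₂ * G + 2 * h₁ * Gr + h * Grr ≤ (2 * M + 2 * M ^ 2) * (h * G) := by
    calc h₂ * G + 2 * h₁ * Gr + h * Grr
        ≤ (M * h) * G + 2 * (M * h) * (M * G) + h * (M * G) := by
          gcongr
          · exact H.r_le
          · exact H.rr_le
      _ = _ := by ring
  have hh2 : 1 ≤ h ^ 2 := one_le_pow₀ hh
  have a2 : h * Gtt + h * h₁ * (h₁ * G + h * Gr) ≤ (M + 2 * M ^ 2) * (h * G) * h ^ 2 := by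
    calc h * Gtt + h * h₁ * (h₁ * G + h * Gr)
        ≤ h * (M * G) + h * (M * h) * ((M * h) * G + h * (M * G)) := by
          gcongr
          · exact H.tt_le
          · exact H.r_le
      _ = M * (h * G) * 1 + 2 * M ^ 2 * (h * G) * h ^ 2 := by ring
      _ ≤ M * (h * G) * h ^ 2 + 2 * M ^ 2 * (h * G) * h ^ 2 := by gcongr
      _ = _ := by ring
  have a3 : 2 * (h * Grt) * (x * y) ≤ M * (h * G) * (x ^ 2 + h ^ 2 * y ^ 2) := by
    have b1 : 2 * (x * y * Grt) ≤ 2 * (|x * y| * (M * G)) := by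
      have : x * y * Grt ≤ |x * y| * (M * G) :=
        (le_abs_self _).trans (by rw [abs_mul]; gcongr; exact H.rt_le)
      linarith
    have b2 : 2 * |x * y| ≤ x ^ 2 + y ^ 2 := by
      rw [abs_mul]; nlinarith [sq_nonneg (|x| - |y|), sq_abs x, sq_abs y]
    have b3 : y ^ 2 ≤ h ^ 2 * y ^ 2 := le_mul_of_one_le_left (sq_nonneg y) hh2
    have b4 : 2 * |x * y| * (M * G) ≤ (x ^ 2 + h ^ 2 * y ^ 2) * (M * G) :=
      mul_le_mul_of_nonneg_right (by linarith) (by positivity)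
    nlinarith
  have hx := sq_nonneg x
  have hy := sq_nonneg y
  have c1 := mul_le_mul_of_nonneg_right a1 hx
  have c2 := mul_le_mul_of_nonneg_right a2 hy
  have d1 : 0 ≤ (1 + M + 3 * M ^ 2) * (h * G) * x ^ 2 := by positivity
  have d2 : 0 ≤ (1 + 2 * M + 3 * M ^ 2) * (h * G) * (h ^ 2 * y ^ 2) := by positivity
  linarith

theorem GrowthBound.grad_le {M G Gr Gt Grr Grt Gtt K Kr Kt Krr Krt Ktt h h₁ : ℝ}
    (H : GrowthBound M G Gr Gt Grr Grt Gtt) (H' : GrowthBound M K Kr Kt Krr Krt Ktt)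
    (hM : 0 ≤ M) (hh : 1 ≤ h) (h₁0 : 0 ≤ h₁) (h₁M : h₁ ≤ M * h) :
    (h₁ * G + h * Gr) * (h₁ * K + h * Kr) + Gt * Kt ≤ 5 * M ^ 2 * (h * G) * (h * K) := by
  have hG := H.pos
  have hK := H'.pos
  have h0 : 0 < h := by linarith
  have hh2 : 1 ≤ h ^ 2 := one_le_pow₀ hh
  have := H'.r_nonneg
  have := H'.t_nonneg
  calc (h₁ * G + h * Gr) * (h₁ * K + h * Kr) + Gt * Kt
      ≤ ((M * h) * G + h * (M * G)) * ((M * h) * K + h * (M * K)) + (M * G) * (M * K) := by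
        gcongr
        · exact H.r_le
        · exact H'.r_le
        · exact H.t_le
        · exact H'.t_le
    _ = 4 * M ^ 2 * (h * G) * (h * K) + M ^ 2 * G * K * 1 := by ring
    _ ≤ 4 * M ^ 2 * (h * G) * (h * K) + M ^ 2 * G * K * h ^ 2 := by gcongr
    _ = _ := by ring

end Inequalities

section Coefficients

open Filter Topology

variable {R h lam : ℝ → ℝ} {a C : ℝ} {S S₁ S₂ : ℝ → ℝ}

/-- The coefficient `b e^{R(r)}`. -/
noncomputable def radialCoeff (R lam : ℝ → ℝ) (a r : ℝ) : ℝ := bConst lam a * Real.exp (R r)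

/-- The function `F̃(r, t) = b e^{R(r)} f(t - R(r)) + S(t)`. -/
noncomputable def ftilde (R lam : ℝ → ℝ) (a : ℝ) (S : ℝ → ℝ) (r t : ℝ) : ℝ :=
  radialCoeff R lam a r * mollify lam fbar (t - R r) + S t

/-- The derivative of `f = lam * f̄`. -/
noncomputable def mollDeriv (lam : ℝ → ℝ) (s : ℝ) : ℝ := Real.exp s * mollExp lam s

theorem mollDeriv_nonneg (H : IsMollifier lam) (s : ℝ) : 0 ≤ mollDeriv lam s :=
  mul_nonneg (Real.exp_pos s).le (H.mollExp_nonneg s)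

theorem mollDeriv_le (H : IsMollifier lam) (s : ℝ) : mollDeriv lam s ≤ mollify lam fbar s := by
  rw [H.mollify_fbar, mollDeriv]
  linarith [H.mollCdf_le_one s]

theorem radialCoeff_pos (H : IsProfile R h lam) (ha : 5 < a) (r : ℝ) : 0 < radialCoeff R lam a r :=
  mul_pos (bConst_pos H.isMollifier ha) (Real.exp_pos _)

theorem hasDerivAt_radialCoeff (H : IsProfile R h lam) (r : ℝ) :
    HasDerivAt (radialCoeff R lam a) (radialCoeff R lam a r * deriv R r) r := by
  have := (H.hasDerivAt_R r).exp.const_mul (bConst lam a)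
  exact this.congr_deriv (by rw [radialCoeff]; ring)

theorem contDiff_radialCoeff (H : IsProfile R h lam) : ContDiff ℝ ∞ (radialCoeff R lam a) :=
  contDiff_const.mul H.R_smooth.exp

theorem hasPartials_radialCoeff (H : IsProfile R h lam) :
    HasPartials (fun r _ => radialCoeff R lam a r)
      (fun r _ => radialCoeff R lam a r * deriv R r) (fun _ _ => 0)
      (fun r _ => radialCoeff R lam a r * (deriv (deriv R) r + deriv R r ^ 2))
      (fun _ _ => 0) (fun _ _ => 0) where
  smooth := (contDiff_radialCoeff H).comp contDiff_fst
  dr r _ := hasDerivAt_radialCoeff H r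
  dt _ t := hasDerivAt_const t _
  drr r _ := ((hasDerivAt_radialCoeff H r).mul (H.hasDerivAt_deriv_R r)).congr_deriv (by ring)
  drt _ t := hasDerivAt_const t _
  dtt _ t := hasDerivAt_const t _

theorem hasPartials_ftilde (H : IsProfile R h lam) (HS : IsTail lam a C S S₁ S₂) :
    HasPartials (ftilde R lam a S)
      (fun r t => radialCoeff R lam a r * deriv R r *
        (mollify lam fbar (t - R r) - mollDeriv lam (t - R r)))
      (fun r t => radialCoeff R lam a r * mollDeriv lam (t - R r) + S₁ t)
      (fun r t => radialCoeff R lam a r * ((deriv (deriv R) r + deriv R r ^ 2) *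
        (mollify lam fbar (t - R r) - mollDeriv lam (t - R r)) +
          deriv R r ^ 2 * lam (t - R r)))
      (fun r t => -(radialCoeff R lam a r * deriv R r * lam (t - R r)))
      (fun r t => radialCoeff R lam a r * (mollDeriv lam (t - R r) + lam (t - R r)) + S₂ t) := by
  have HL := H.isMollifier
  have f1 : ∀ s, HasDerivAt (mollify lam fbar) (mollDeriv lam s) s := HL.hasDerivAt_mollify_fbar
  have f2 : ∀ s, HasDerivAt (mollDeriv lam) (mollDeriv lam s + lam s) s :=
    HL.hasDerivAt_mollify_fbar'
  have rr : ∀ {φ : ℝ → ℝ} {φ' : ℝ} (r t : ℝ), HasDerivAt φ φ' (t - R r) →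
      HasDerivAt (fun r => φ (t - R r)) (φ' * -deriv R r) r := fun {φ φ'} r t hφ =>
    hφ.comp r ((H.hasDerivAt_R r).const_sub t)
  have tt : ∀ {φ : ℝ → ℝ} {φ' : ℝ} (r t : ℝ), HasDerivAt φ φ' (t - R r) →
      HasDerivAt (fun t => φ (t - R r)) φ' t := fun {φ φ'} r t hφ => hφ.comp_sub_const t (R r)
  have dA := fun r => hasDerivAt_radialCoeff (a := a) H r
  refine ⟨?_, fun r t => ?_, fun r t => ?_, fun r t => ?_, fun r t => ?_, fun r t => ?_⟩
  · have h1 : ContDiff ℝ ∞ fun q : ℝ × ℝ => q.2 - R q.1 :=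
      contDiff_snd.sub (H.R_smooth.comp contDiff_fst)
    exact (((contDiff_radialCoeff H).comp contDiff_fst).mul
      (HL.contDiff_mollify_fbar.comp h1)).add (HS.smooth.comp contDiff_snd)
  · exact (((dA r).mul (rr r t (f1 _))).add_const (S t)).congr_deriv (by ring)
  · exact ((tt r t (f1 _)).const_mul _).add (HS.hasDerivAt t)
  · exact (((dA r).mul (H.hasDerivAt_deriv_R r)).mul
      ((rr r t (f1 _)).sub (rr r t (f2 _)))).congr_deriv (by simp only [Pi.mul_apply, Pi.sub_apply]; ring)
  · exact (((tt r t (f1 _)).sub (tt r t (f2 _))).const_mul _).congr_deriv (by ring)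
  · exact ((tt r t (f2 _)).const_mul _).add (HS.hasDerivAt' t)

theorem ftilde_of_ge (H : IsProfile R h lam) {r t : ℝ} (ht : 4 ≤ t) :
    ftilde R lam a S r t = bcConst lam a * Real.exp t + S t := by
  have hR := H.R_le r
  rw [ftilde, radialCoeff, H.isMollifier.mollify_fbar_of_ge (by linarith), bcConst,
    show Real.exp t = Real.exp (R r) * Real.exp (t - R r) by rw [← Real.exp_add]; ring_nf]
  ring

theorem isFtilde_ftilde (H : IsProfile R h lam) (ha : 5 < a) (HS : IsTail lam a C S S₁ S₂) :
    IsFtilde R lam a (ftilde R lam a S) := by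
  have HP := hasPartials_ftilde H HS
  have HL := H.isMollifier
  have d1 : ∀ r, deriv (ftilde R lam a S r) =
      fun t => radialCoeff R lam a r * mollDeriv lam (t - R r) + S₁ t := fun r =>
    funext fun t => (HP.dt r t).deriv
  refine ⟨HP.smooth, fun r t ht => ?_, fun r t ht => ?_, fun r t => ?_, fun r t => ?_,
    fun r r' t ht => ?_, fun r r' t hr hr' => ?_⟩
  · rw [ftilde, HS.left t ht, add_zero, radialCoeff]
  · rw [ftilde_of_ge H (by linarith), HS.right t ht]
  · rw [d1]
    exact add_nonneg (mul_nonneg (radialCoeff_pos H ha r).le (mollDeriv_nonneg HL _))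
      (HS.deriv_nonneg t)
  · rw [d1, (HP.dtt r t).deriv]
    exact add_nonneg (mul_nonneg (radialCoeff_pos H ha r).le (add_nonneg (mollDeriv_nonneg HL _)
      (HL.nonneg _))) (HS.deriv2_nonneg t)
  · rw [ftilde_of_ge H ht, ftilde_of_ge H ht]
  · simp only [ftilde, radialCoeff, H.R_right r hr, H.R_right r' hr']

theorem radialCoeff_le_ftilde (HS : IsTail lam a C S S₁ S₂) (r t : ℝ) :
    radialCoeff R lam a r * mollify lam fbar (t - R r) ≤ ftilde R lam a S r t :=
  le_add_of_nonneg_right (HS.nonneg t)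

theorem ftilde_pos (H : IsProfile R h lam) (ha : 5 < a) (HS : IsTail lam a C S S₁ S₂) (r t : ℝ) :
    0 < ftilde R lam a S r t :=
  (mul_pos (radialCoeff_pos H ha r) (one_pos.trans_le
    (H.isMollifier.one_le_mollify_fbar _))).trans_le (radialCoeff_le_ftilde (R := R) HS r t)

theorem growthBound_radialCoeff (H : IsProfile R h lam) (ha : 5 < a) {M : ℝ} (hM : 1 ≤ M) (r : ℝ) :
    GrowthBound M (radialCoeff R lam a r) (radialCoeff R lam a r * deriv R r) 0
      (radialCoeff R lam a r * (deriv (deriv R) r + deriv R r ^ 2)) 0 0 := by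
  have hA := radialCoeff_pos H ha r
  have h1 := H.deriv_R_nonneg r
  have h2 := H.deriv_R_le_one r
  have h3 := (H.R_deriv2 r).2
  have h4 : deriv R r ^ 2 ≤ 1 := pow_le_one₀ h1 h2
  have hMA : 0 ≤ M * radialCoeff R lam a r := by positivity
  refine ⟨hA, by positivity, le_rfl, ?_, hMA, ?_, by simpa using hMA, hMA⟩
  · rw [mul_comm]; gcongr; linarith
  · rw [mul_comm]; gcongr; linarith

theorem growthBound_ftilde (H : IsProfile R h lam) (ha : 5 < a) (HS : IsTail lam a C S S₁ S₂) {Λ M : ℝ}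
    (hΛ : ∀ x, lam x ≤ Λ) (hC : 0 ≤ C) (hM : 1 + Λ + C ≤ M) (r t : ℝ) :
    GrowthBound M (ftilde R lam a S r t)
      (radialCoeff R lam a r * deriv R r *
        (mollify lam fbar (t - R r) - mollDeriv lam (t - R r)))
      (radialCoeff R lam a r * mollDeriv lam (t - R r) + S₁ t)
      (radialCoeff R lam a r * ((deriv (deriv R) r + deriv R r ^ 2) *
        (mollify lam fbar (t - R r) - mollDeriv lam (t - R r)) +
          deriv R r ^ 2 * lam (t - R r)))
      (-(radialCoeff R lam a r * deriv R r * lam (t - R r)))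
      (radialCoeff R lam a r * (mollDeriv lam (t - R r) + lam (t - R r)) + S₂ t) := by
  have HL := H.isMollifier
  have hA := radialCoeff_pos H ha r
  have h1 := H.deriv_R_nonneg r
  have h2 := H.deriv_R_le_one r
  have h3 := (H.R_deriv2 r).2
  have h4 : deriv R r ^ 2 ≤ 1 := pow_le_one₀ h1 h2
  have hF := ftilde_pos H ha HS r t
  have hAF := radialCoeff_le_ftilde (R := R) HS r t
  have hf := HL.one_le_mollify_fbar (t - R r)
  have hd := mollDeriv_le HL (t - R r)
  have hd0 := mollDeriv_nonneg HL (t - R r)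
  have hl0 := HL.nonneg (t - R r)
  have hl := hΛ (t - R r)
  have hΛ0 : 0 ≤ Λ := hl0.trans hl
  have b1 : S₁ t ≤ C * ftilde R lam a S r t := by
    rcases le_total t 5 with ht | ht
    · rw [HS.deriv_left t ht]; positivity
    · rw [ftilde_of_ge H (by linarith)]; exact HS.deriv_le t ht
  have b2 : S₂ t ≤ C * ftilde R lam a S r t := by
    rcases le_total t 5 with ht | ht
    · rw [HS.deriv2_left t ht]; positivity
    · rw [ftilde_of_ge H (by linarith)]; exact HS.deriv2_le t ht
  set A := radialCoeff R lam a r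
  set F := ftilde R lam a S r t
  set f := mollify lam fbar (t - R r)
  set d := mollDeriv lam (t - R r)
  set l := lam (t - R r)
  have hAf : A ≤ F := (le_mul_of_one_le_right hA.le hf).trans hAF
  have e1 : A * (f - d) ≤ F := (mul_le_mul_of_nonneg_left (by linarith) hA.le).trans hAF
  have e1' : 0 ≤ A * (f - d) := mul_nonneg hA.le (by linarith)
  have e2 : A * d ≤ F := (mul_le_mul_of_nonneg_left hd hA.le).trans hAF
  have e3 : A * l ≤ Λ * F := by rw [mul_comm Λ]; gcongr
  have e3' : 0 ≤ A * l := by positivity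
  have hCF : 0 ≤ C * F := by positivity
  have hΛF : 0 ≤ Λ * F := by positivity
  have hMF : (1 + Λ + C) * F ≤ M * F := by gcongr
  refine ⟨hF, ?_, by have := HS.deriv_nonneg t; positivity, ?_, ?_, ?_, ?_, ?_⟩
  · have := mul_nonneg h1 e1'
    linarith
  · have : deriv R r * (A * (f - d)) ≤ 1 * (A * (f - d)) := by gcongr
    linarith
  · linarith
  · have i1 : (deriv (deriv R) r + deriv R r ^ 2) * (A * (f - d)) ≤ 1 * (A * (f - d)) := by
      gcongr; linarith
    have i2 : deriv R r ^ 2 * (A * l) ≤ 1 * (A * l) := by gcongr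
    linarith
  · rw [abs_neg, abs_of_nonneg (by positivity)]
    have : deriv R r * (A * l) ≤ 1 * (A * l) := by gcongr
    linarith
  · linarith

theorem hasPartials_T {T T₁ T₂ : ℝ → ℝ} (HT : IsTWith a C T T₁ T₂) :
    HasPartials (fun _ t => T t) (fun _ _ => 0) (fun _ t => T₁ t) (fun _ _ => 0) (fun _ _ => 0)
      (fun _ t => T₂ t) where
  smooth := HT.smooth.comp contDiff_snd
  dr r _ := hasDerivAt_const r _
  dt _ t := HT.hasDerivAt t
  drr r _ := hasDerivAt_const r _
  drt _ t := hasDerivAt_const t _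
  dtt _ t := HT.hasDerivAt' t

theorem growthBound_T {T T₁ T₂ : ℝ → ℝ} (HT : IsTWith a C T T₁ T₂) {M : ℝ} (hC : 0 ≤ C)
    (hM : C ≤ M) (t : ℝ) : GrowthBound M (T t) 0 (T₁ t) 0 0 (T₂ t) := by
  have hT : 0 < T t := one_pos.trans_le (HT.one_le t)
  have hMT : C * T t ≤ M * T t := by gcongr
  have hMT' : 0 ≤ M * T t := by have := hC.trans hM; positivity
  exact ⟨hT, le_rfl, HT.deriv_nonneg t, hMT', (HT.deriv_le t).trans hMT, hMT', by simpa using hMT',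
    (HT.deriv2_le t).trans hMT⟩

end Coefficients

section WarpingInequalities

open Filter Topology

variable {R h lam : ℝ → ℝ} {a C CT : ℝ} {S S₁ S₂ T T₁ T₂ : ℝ → ℝ}

theorem areaForm_surfaceForm (h : ℝ → ℝ) (z u v : ℝ × ℝ) :
    areaForm (surfaceForm h) z u v = h z.1 ^ 2 * (u.1 * v.2 - v.1 * u.2) ^ 2 := by
  simp only [areaForm, warpedForm_apply, lineForm_apply]
  ring

theorem surfaceForm_self (h : ℝ → ℝ) (z u : ℝ × ℝ) :
    surfaceForm h z u u = u.1 ^ 2 + h z.1 ^ 2 * u.2 ^ 2 := by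
  simp only [warpedForm_apply, lineForm_apply]
  ring

theorem HasPartials.hess_lower {ψ ψr ψt ψrr ψrt ψtt : ℝ → ℝ → ℝ} (H : IsProfile R h lam)
    (K : HasPartials ψ ψr ψt ψrr ψrt ψtt) {M r t : ℝ} (hM : 0 ≤ M) (h₁M : deriv h r ≤ M * h r)
    (h₂M : deriv (deriv h) r ≤ M * h r)
    (hG : GrowthBound M (ψ r t) (ψr r t) (ψt r t) (ψrr r t) (ψrt r t) (ψtt r t)) (X : ℝ × ℝ) :
    0 ≤ -1 * (metricHess (surfaceForm h) (fun q => h q.1 * ψ q.1 q.2) (r, t) X X -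
      (1 + 4 * M + 5 * M ^ 2) * (h r * ψ r t) * surfaceForm h (r, t) X X) := by
  rw [K.metricHess_surfaceForm H.h_smooth H.h_pos H.hasDerivAt_h H.hasDerivAt_deriv_h,
    surfaceForm_self]
  have := hG.hess_le hM (H.h_ge r) (H.h_deriv r).le h₁M h₂M X.1 X.2
  linarith

theorem HasPartials.grad_lower {ψ ψr ψt ψrr ψrt ψtt χ χr χt χrr χrt χtt : ℝ → ℝ → ℝ}
    (H : IsProfile R h lam) (K : HasPartials ψ ψr ψt ψrr ψrt ψtt)
    (K' : HasPartials χ χr χt χrr χrt χtt) {M r t : ℝ} (hM : 0 ≤ M) (h₁M : deriv h r ≤ M * h r)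
    (hG : GrowthBound M (ψ r t) (ψr r t) (ψt r t) (ψrr r t) (ψrt r t) (ψtt r t))
    (hG' : GrowthBound M (χ r t) (χr r t) (χt r t) (χrr r t) (χrt r t) (χtt r t)) :
    gradInner (surfaceForm h) (fun q => h q.1 * ψ q.1 q.2) (fun q => h q.1 * χ q.1 q.2) (r, t) ≤
      5 * M ^ 2 * (h r * ψ r t) * (h r * χ r t) := by
  rw [K.gradInner_surfaceForm K' H.h_smooth H.h_pos H.hasDerivAt_h H.hasDerivAt_deriv_h]
  exact hG.grad_le hG' hM (H.h_ge r) (H.h_deriv r).le h₁M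

theorem exists_warpingSide_lower (H : IsProfile R h lam) (ha : 5 < a)
    (HS : IsTail lam a C S S₁ S₂) (hC : 0 ≤ C) (HT : IsTWith a CT T T₁ T₂) (hCT : 0 ≤ CT) :
    ∃ k, 0 < k ∧ ∀ r t, WarpingSide (-1) k (surfaceForm h) (fun q => h q.1 * radialCoeff R lam a q.1)
      (fun q => h q.1 * ftilde R lam a S q.1 q.2) (fun q => h q.1 * T q.2) (r, t) := by
  obtain ⟨Ch, hCh⟩ := H.exists_h_bound
  obtain ⟨Λ, hΛ⟩ := H.isMollifier.exists_le
  have hΛ0 : 0 ≤ Λ := (H.lam_nonneg 0).trans (hΛ 0)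
  have hCh0 : 0 ≤ Ch := by
    by_contra hneg
    nlinarith [(hCh 0).1, H.h_deriv 0, H.h_pos 0]
  set M := 1 + Λ + C + CT + Ch with hM
  have hM0 : 0 ≤ M := by positivity
  refine ⟨1 + 4 * M + 5 * M ^ 2, by positivity, fun r t => ?_⟩
  have hh := H.h_pos r
  have hChM : Ch * h r ≤ M * h r := by gcongr; linarith
  have h₁ := (hCh r).1.trans hChM
  have h₂ := (hCh r).2.trans hChM
  have KP := hasPartials_radialCoeff (a := a) H
  have KQ := hasPartials_ftilde H HS
  have KT := hasPartials_T HT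
  have GP := growthBound_radialCoeff H ha (show 1 ≤ M by linarith) r
  have GQ := growthBound_ftilde H ha HS hΛ hC (show 1 + Λ + C ≤ M by linarith) r t
  have GT := growthBound_T HT hCT (show CT ≤ M by linarith) t
  have hP := radialCoeff_pos H ha r
  have hQ := ftilde_pos H ha HS r t
  have hT := HT.one_le t
  have relax : ∀ {x p q : ℝ}, 0 ≤ p → 0 ≤ q → x ≤ 5 * M ^ 2 * p * q →
      0 ≤ -1 * (x - (1 + 4 * M + 5 * M ^ 2) * p * q) := by
    intro x p q hp hq hx
    have : 0 ≤ (1 + 4 * M) * p * q := by positivity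
    linarith
  refine ⟨fun u v => ?_, fun X => KP.hess_lower (t := t) H hM0 h₁ h₂ GP X,
    fun X => KQ.hess_lower H hM0 h₁ h₂ GQ X,
    fun X => KT.hess_lower H hM0 h₁ h₂ GT X,
    relax (by positivity) (by positivity) (KQ.grad_lower H KP hM0 h₁ GQ GP),
    relax (by positivity) (by positivity) (KT.grad_lower H KP (t := t) hM0 h₁ GT GP),
    relax (by positivity) (by positivity) (KT.grad_lower H KQ hM0 h₁ GT GQ), ?_⟩
  · rw [curvForm_surfaceForm H.h_smooth H.h_pos H.hasDerivAt_h H.hasDerivAt_deriv_h,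
      areaForm_surfaceForm]
    have h3 : h r * deriv (deriv h) r ≤ (1 + 4 * M + 5 * M ^ 2) * h r ^ 2 := by
      have : deriv (deriv h) r ≤ (1 + 4 * M + 5 * M ^ 2) * h r :=
        h₂.trans (mul_le_mul_of_nonneg_right (by nlinarith) hh.le)
      nlinarith
    have := mul_le_mul_of_nonneg_right h3 (sq_nonneg (u.1 * v.2 - v.1 * u.2))
    simp only
    linarith
  · have h1 := KT.grad_lower H KT (r := r) (t := t) hM0 h₁ GT GT
    have h2 : 1 ≤ h r * T t := one_le_mul_of_one_le_of_one_le (H.h_ge r) hT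
    have h3 : 1 ≤ (h r * T t) ^ 2 := one_le_pow₀ h2
    have h4 : 1 * (h r * T t) ^ 2 ≤ (1 + 4 * M) * (h r * T t) ^ 2 := by gcongr; linarith
    simp only
    linarith

theorem HasPartials.hess_upper {ψ ψr ψt ψrr ψrt ψtt : ℝ → ℝ → ℝ} (H : IsProfile R h lam)
    (K : HasPartials ψ ψr ψt ψrr ψrt ψtt) {r t : ℝ} (hψ : 0 < ψ r t)
    (hα : 0 < deriv (deriv h) r * ψ r t + 2 * deriv h r * ψr r t + h r * ψrr r t)
    (hd : (h r * ψrt r t) ^ 2 <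
      (deriv (deriv h) r * ψ r t + 2 * deriv h r * ψr r t + h r * ψrr r t) *
      (h r * ψtt r t + h r * deriv h r * (deriv h r * ψ r t + h r * ψr r t))) :
    ∀ᶠ c : ℝ in 𝓝[>] 0, ∀ X : ℝ × ℝ,
    0 ≤ 1 * (metricHess (surfaceForm h) (fun q => h q.1 * ψ q.1 q.2) (r, t) X X -
      c * (h r * ψ r t) * surfaceForm h (r, t) X X) := by
  have hh := H.h_pos r
  have hw : 0 < h r * ψ r t := by positivity
  filter_upwards [exists_pos_mul_le_quadratic hα hd hw
    (show 0 < h r * ψ r t * h r ^ 2 by positivity)] with c hc X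
  rw [K.metricHess_surfaceForm H.h_smooth H.h_pos H.hasDerivAt_h H.hasDerivAt_deriv_h,
    surfaceForm_self]
  have := hc X.1 X.2
  simp only
  linarith

theorem HasPartials.grad_upper {ψ ψr ψt ψrr ψrt ψtt χ χr χt χrr χrt χtt : ℝ → ℝ → ℝ}
    (H : IsProfile R h lam) (K : HasPartials ψ ψr ψt ψrr ψrt ψtt)
    (K' : HasPartials χ χr χt χrr χrt χtt) {r t : ℝ} (hψ : 0 < ψ r t) (hχ : 0 < χ r t)
    (hψr : 0 ≤ ψr r t) (hχr : 0 ≤ χr r t) (hψt : 0 ≤ ψt r t) (hχt : 0 ≤ χt r t) :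
    ∀ᶠ c : ℝ in 𝓝[>] 0,
    0 ≤ 1 * (gradInner (surfaceForm h) (fun q => h q.1 * ψ q.1 q.2) (fun q => h q.1 * χ q.1 q.2)
      (r, t) - c * (h r * ψ r t) * (h r * χ r t)) := by
  have hh := H.h_pos r
  have hh' := H.h_deriv r
  rw [K.gradInner_surfaceForm K' H.h_smooth H.h_pos H.hasDerivAt_h H.hasDerivAt_deriv_h]
  have hp : 0 < (deriv h r * ψ r t + h r * ψr r t) * (deriv h r * χ r t + h r * χr r t) +
    ψt r t * χt r t := by positivity
  filter_upwards [eventually_mul_le_of_pos hp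
    (show 0 < (h r * ψ r t) * (h r * χ r t) by positivity)] with c hc
  linarith

theorem exists_warpingSide_upper (H : IsProfile R h lam) (ha : 5 < a)
    (HS : IsTail lam a C S S₁ S₂) (HT : IsTWith a CT T T₁ T₂) (r t : ℝ) :
    ∃ c, 0 < c ∧ WarpingSide 1 c (surfaceForm h) (fun q => h q.1 * radialCoeff R lam a q.1)
      (fun q => h q.1 * ftilde R lam a S q.1 q.2) (fun q => h q.1 * T q.2) (r, t) := by
  have HL := H.isMollifier
  have hh := H.h_pos r
  have hh' := H.h_deriv r
  have hh'' := H.h_deriv2 r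
  have KP := hasPartials_radialCoeff (a := a) H
  have KQ := hasPartials_ftilde H HS
  have KT := hasPartials_T HT
  have hP := radialCoeff_pos H ha r
  have hQ := ftilde_pos H ha HS r t
  have hT : 0 < T t := one_pos.trans_le (HT.one_le t)
  have h1 := H.deriv_R_nonneg r
  have h3 := (H.R_deriv2 r).2
  have hkey := H.deriv2_h_add_nonneg r
  have hAF := radialCoeff_le_ftilde (R := R) HS r t
  have hd := mollDeriv_le HL (t - R r)
  have hd0 := mollDeriv_nonneg HL (t - R r)
  have hl0 := HL.nonneg (t - R r)
  have hT1 := HT.deriv_nonneg t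
  have hT2 := HT.deriv2_nonneg t
  have hS1 := HS.deriv_nonneg t
  have hS2 := HS.deriv2_nonneg t
  have hfd : 0 ≤ mollify lam fbar (t - R r) - mollDeriv lam (t - R r) := by linarith
  have hQr : 0 ≤ radialCoeff R lam a r * deriv R r *
    (mollify lam fbar (t - R r) - mollDeriv lam (t - R r)) := by positivity
  have hQt : 0 ≤ radialCoeff R lam a r * mollDeriv lam (t - R r) + S₁ t := by positivity
  -- the Hessian of the coefficient of `dρ²`
  have aP : 0 < deriv (deriv h) r * radialCoeff R lam a r +
      2 * deriv h r * (radialCoeff R lam a r * deriv R r) +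
      h r * (radialCoeff R lam a r * (deriv (deriv R) r + deriv R r ^ 2)) := by
    have e1 : 0 ≤ radialCoeff R lam a r * (deriv (deriv h) r + 2 * h r * deriv (deriv R) r) :=
      mul_nonneg hP.le hkey
    have e2 : 0 < deriv (deriv h) r * radialCoeff R lam a r := by positivity
    have e3 : 0 ≤ 2 * deriv h r * (radialCoeff R lam a r * deriv R r) := by positivity
    have e4 : 0 ≤ h r * (radialCoeff R lam a r * deriv R r ^ 2) := by positivity
    linarith
  have dP : (h r * 0) ^ 2 < (deriv (deriv h) r * radialCoeff R lam a r +
      2 * deriv h r * (radialCoeff R lam a r * deriv R r) +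
      h r * (radialCoeff R lam a r * (deriv (deriv R) r + deriv R r ^ 2))) *
      (h r * 0 + h r * deriv h r * (deriv h r * radialCoeff R lam a r +
        h r * (radialCoeff R lam a r * deriv R r))) := by
    rw [mul_zero, zero_pow two_ne_zero, zero_add]
    exact mul_pos aP (by positivity)
  have aT : 0 < deriv (deriv h) r * T t + 2 * deriv h r * 0 + h r * 0 := by
    rw [mul_zero, mul_zero, add_zero, add_zero]; positivity
  have dT : (h r * 0) ^ 2 < (deriv (deriv h) r * T t + 2 * deriv h r * 0 + h r * 0) *
      (h r * T₂ t + h r * deriv h r * (deriv h r * T t + h r * 0)) := by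
    have e0 : (h r * 0) ^ 2 = 0 := by simp
    rw [e0]
    refine mul_pos aT ?_
    rw [mul_zero, add_zero]
    positivity
  -- the Hessian of the coefficient of `dτ²`
  have aQ' : h r * (radialCoeff R lam a r * deriv R r ^ 2 * lam (t - R r)) <
      deriv (deriv h) r * ftilde R lam a S r t +
      2 * deriv h r * (radialCoeff R lam a r * deriv R r *
        (mollify lam fbar (t - R r) - mollDeriv lam (t - R r))) +
      h r * (radialCoeff R lam a r * ((deriv (deriv R) r + deriv R r ^ 2) *
        (mollify lam fbar (t - R r) - mollDeriv lam (t - R r)) +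
          deriv R r ^ 2 * lam (t - R r))) := by
    have e0 : radialCoeff R lam a r * (mollify lam fbar (t - R r) - mollDeriv lam (t - R r)) ≤
        ftilde R lam a S r t :=
      (mul_le_mul_of_nonneg_left (by linarith) hP.le).trans hAF
    have e1 : 0 ≤ (radialCoeff R lam a r * (mollify lam fbar (t - R r) -
        mollDeriv lam (t - R r))) * (deriv (deriv h) r + 2 * h r * deriv (deriv R) r) :=
      mul_nonneg (mul_nonneg hP.le hfd) hkey
    have e2 := mul_le_mul_of_nonneg_left e0 hh''.le
    have e3 : 0 < deriv (deriv h) r * ftilde R lam a S r t := by positivity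
    have e4 : 0 ≤ 2 * deriv h r * (radialCoeff R lam a r * deriv R r *
        (mollify lam fbar (t - R r) - mollDeriv lam (t - R r))) := by positivity
    have e5 : 0 ≤ h r * (radialCoeff R lam a r * (deriv R r ^ 2 *
        (mollify lam fbar (t - R r) - mollDeriv lam (t - R r)))) := by positivity
    linarith
  have gQ' : h r * (radialCoeff R lam a r * lam (t - R r)) <
      h r * (radialCoeff R lam a r * (mollDeriv lam (t - R r) + lam (t - R r)) + S₂ t) +
      h r * deriv h r * (deriv h r * ftilde R lam a S r t + h r * (radialCoeff R lam a r *
        deriv R r * (mollify lam fbar (t - R r) - mollDeriv lam (t - R r)))) := by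
    have e1 : 0 < h r * deriv h r * (deriv h r * ftilde R lam a S r t +
      h r * (radialCoeff R lam a r * deriv R r * (mollify lam fbar (t - R r) -
        mollDeriv lam (t - R r)))) := by positivity
    have e2 : 0 ≤ h r * (radialCoeff R lam a r * mollDeriv lam (t - R r) + S₂ t) := by positivity
    linarith
  have l1 : 0 ≤ h r * (radialCoeff R lam a r * deriv R r ^ 2 * lam (t - R r)) := by positivity
  have l2 : 0 ≤ h r * (radialCoeff R lam a r * lam (t - R r)) := by positivity
  have dQ := mul_lt_mul'' aQ' gQ' l1 l2
  have dQ' : (h r * -(radialCoeff R lam a r * deriv R r * lam (t - R r))) ^ 2 =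
      h r * (radialCoeff R lam a r * deriv R r ^ 2 * lam (t - R r)) *
      (h r * (radialCoeff R lam a r * lam (t - R r))) := by ring
  have ev := ((((((((eventually_mul_le_of_pos hh'' hh).and
    (KP.hess_upper (t := t) H hP aP dP)).and
    (KQ.hess_upper H hQ (l1.trans_lt aQ') (dQ'.trans_lt dQ))).and
    (KT.hess_upper H hT aT dT)).and
    (KQ.grad_upper H KP hQ hP hQr (by positivity) hQt le_rfl)).and
    (KT.grad_upper H KP (t := t) (r := r) hT hP le_rfl (by positivity) hT1 le_rfl)).and
    (KT.grad_upper H KQ hT hQ le_rfl hQr hT1 hQt)).and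
    (KT.grad_upper H KT (t := t) (r := r) hT hT le_rfl le_rfl hT1 hT1)).and self_mem_nhdsWithin
  obtain ⟨c, ⟨⟨⟨⟨⟨⟨⟨c1, c2⟩, c3⟩, c4⟩, c5⟩, c6⟩, c7⟩, c8⟩, hc⟩ := ev.exists
  refine ⟨c, hc, fun u v => ?_, c2, c3, c4, c5, c6, c7, ?_⟩
  · rw [curvForm_surfaceForm H.h_smooth H.h_pos H.hasDerivAt_h H.hasDerivAt_deriv_h,
      areaForm_surfaceForm]
    have := mul_le_mul_of_nonneg_right c1 (mul_nonneg hh.le (sq_nonneg (u.1 * v.2 - v.1 * u.2)))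
    simp only
    linarith
  · simp only at c8 ⊢
    linarith

theorem warpingSide_slice (H : IsProfile R h lam) (ha : 5 < a) (HS : IsTail lam a C S S₁ S₂)
    (HT : IsTWith a CT T T₁ T₂) (A r t : ℝ) :
    WarpingSide 1 0 lineForm (fun _ => A) (fun t => ftilde R lam a S r t) T t := by
  have HL := H.isMollifier
  have KQ := hasPartials_ftilde H HS
  have hP := radialCoeff_pos H ha r
  have hd0 := mollDeriv_nonneg HL (t - R r)
  have hl0 := HL.nonneg (t - R r)
  have hT1 := HT.deriv_nonneg t
  have hT2 := HT.deriv2_nonneg t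
  have hS1 := HS.deriv_nonneg t
  have hS2 := HS.deriv2_nonneg t
  refine ⟨curvatureSide_lineForm 1 0 t, fun X => ?_, fun X => ?_, fun X => ?_, ?_, ?_, ?_, ?_⟩
  · rw [metricHess_lineForm (fun x => hasDerivAt_const x A) fun x => hasDerivAt_const x 0]
    simp
  · rw [metricHess_lineForm (KQ.dt r) (KQ.dtt r)]
    have := mul_self_nonneg X
    simp only [zero_mul, sub_zero, one_mul]
    positivity
  · rw [metricHess_lineForm HT.hasDerivAt HT.hasDerivAt']
    have := mul_self_nonneg X
    simp only [zero_mul, sub_zero, one_mul]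
    positivity
  · rw [gradInner_lineForm (KQ.dt r) fun x => hasDerivAt_const x A]
    simp
  · rw [gradInner_lineForm HT.hasDerivAt fun x => hasDerivAt_const x A]
    simp
  · rw [gradInner_lineForm HT.hasDerivAt (KQ.dt r)]
    simp only [zero_mul, sub_zero, one_mul]
    positivity
  · rw [gradInner_lineForm HT.hasDerivAt HT.hasDerivAt]
    simp only [zero_mul, sub_zero, one_mul]
    positivity

end WarpingInequalities

section TotalForm

theorem CurvatureSide.localSectionalCurvature_le {E : Type*} [NormedAddCommGroup E]
    [NormedSpace ℝ E] {G : E → E →L[ℝ] E →L[ℝ] ℝ} (H : IsRiemannianForm G) {c : ℝ} {y : E}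
    (h : CurvatureSide 1 c G y) {u v : E} (huv : LinearIndependent ℝ ![u, v]) :
    localSectionalCurvature G y u v ≤ -c := by
  have hpos := H.areaForm_pos y huv
  rw [show localSectionalCurvature G y u v = curvForm G y u v / areaForm G y u v from rfl,
    div_le_iff₀ hpos]
  linarith [h u v]

theorem CurvatureSide.le_localSectionalCurvature {E : Type*} [NormedAddCommGroup E]
    [NormedSpace ℝ E] {G : E → E →L[ℝ] E →L[ℝ] ℝ} (H : IsRiemannianForm G) {c : ℝ} {y : E}
    (h : CurvatureSide (-1) c G y) {u v : E} (huv : LinearIndependent ℝ ![u, v]) :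
    -c ≤ localSectionalCurvature G y u v := by
  have hpos := H.areaForm_pos y huv
  rw [show localSectionalCurvature G y u v = curvForm G y u v / areaForm G y u v from rfl,
    le_div_iff₀ hpos]
  linarith [h u v]

theorem CurvatureSide.pullForm {E E' : Type*} [NormedAddCommGroup E] [NormedSpace ℝ E]
    [FiniteDimensional ℝ E] [NormedAddCommGroup E'] [NormedSpace ℝ E'] [FiniteDimensional ℝ E']
    {G : E' → E' →L[ℝ] E' →L[ℝ] ℝ} (H : IsRiemannianForm G) (L : E ≃L[ℝ] E') {s c : ℝ} {y : E}
    (h : CurvatureSide s c G (L y)) : CurvatureSide s c (pullForm L G) y := fun u v => by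
  rw [curvForm_pullForm H]
  exact h (L u) (L v)

/-- Reassociation of `B × ℝ × ℝ × V`. -/
noncomputable def assocEquiv (B V : Type*) [NormedAddCommGroup B] [NormedSpace ℝ B]
    [NormedAddCommGroup V] [NormedSpace ℝ V] : (B × ℝ × ℝ × V) ≃L[ℝ] ((B × ℝ) × ℝ) × V :=
  (ContinuousLinearEquiv.prodAssoc ℝ B ℝ (ℝ × V)).symm.trans
    (ContinuousLinearEquiv.prodAssoc ℝ (B × ℝ) ℝ V).symm

theorem assocEquiv_apply {B V : Type*} [NormedAddCommGroup B] [NormedSpace ℝ B]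
    [NormedAddCommGroup V] [NormedSpace ℝ V] (z : B × ℝ × ℝ × V) :
    assocEquiv B V z = (((z.1, z.2.1), z.2.2.1), z.2.2.2) := rfl

/-- Reassociation of `ℝ × ℝ × ℝ × ℝ × V`. -/
noncomputable def totalEquiv (V : Type*) [NormedAddCommGroup V] [NormedSpace ℝ V] :
    (ℝ × ℝ × ℝ × ℝ × V) ≃L[ℝ] (((ℝ × ℝ) × ℝ) × ℝ) × V :=
  (ContinuousLinearEquiv.prodAssoc ℝ ℝ ℝ (ℝ × ℝ × V)).symm.trans (assocEquiv (ℝ × ℝ) V)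

theorem totalEquiv_apply {V : Type*} [NormedAddCommGroup V] [NormedSpace ℝ V]
    (z : ℝ × ℝ × ℝ × ℝ × V) :
    totalEquiv V z = ((((z.1, z.2.1), z.2.2.1), z.2.2.2.1), z.2.2.2.2) := rfl

variable (R h lam : ℝ → ℝ) (a : ℝ) (S T : ℝ → ℝ) (m : ℕ)

/-- The metric `dr² + h²(dt² + A² dρ² + F² dτ² + T² g_N)` in coordinates. -/
noncomputable def totalForm : ℝ × ℝ × ℝ × ℝ × Euc m →
    (ℝ × ℝ × ℝ × ℝ × Euc m) →L[ℝ] (ℝ × ℝ × ℝ × ℝ × Euc m) →L[ℝ] ℝ :=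
  pullForm (totalEquiv (Euc m)) (tripleForm (surfaceForm h)
    (fun q => h q.1 * radialCoeff R lam a q.1) (fun q => h q.1 * ftilde R lam a S q.1 q.2)
    (fun q => h q.1 * T q.2) (hyperbolicForm m))

/-- The metric `dt² + A² dρ² + F² dτ² + T² g_N` for a fixed value of `r` in coordinates. -/
noncomputable def sliceForm (r : ℝ) : ℝ × ℝ × ℝ × Euc m →
    (ℝ × ℝ × ℝ × Euc m) →L[ℝ] (ℝ × ℝ × ℝ × Euc m) →L[ℝ] ℝ :=
  pullForm (assocEquiv ℝ (Euc m)) (tripleForm lineForm (fun _ => radialCoeff R lam a r)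
    (fun t => ftilde R lam a S r t) T (hyperbolicForm m))

variable {R h lam a S T m}

theorem totalForm_apply (z u v : ℝ × ℝ × ℝ × ℝ × Euc m) :
    totalForm R h lam a S T m z u v = u.1 * v.1 + h z.1 ^ 2 *
      (u.2.1 * v.2.1 + radialCoeff R lam a z.1 ^ 2 * (u.2.2.1 * v.2.2.1) +
        ftilde R lam a S z.1 z.2.1 ^ 2 * (u.2.2.2.1 * v.2.2.2.1) +
        T z.2.1 ^ 2 * hypMetric z.2.2.2.2 u.2.2.2.2 v.2.2.2.2) := by
  simp only [totalForm, pullForm_apply, tripleForm, warpedForm_apply, totalEquiv_apply,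
    lineForm_apply, hyperbolicForm_apply]
  ring

theorem sliceForm_apply (r : ℝ) (z u v : ℝ × ℝ × ℝ × Euc m) :
    sliceForm R lam a S T m r z u v =
      u.1 * v.1 + radialCoeff R lam a r ^ 2 * (u.2.1 * v.2.1) +
        ftilde R lam a S r z.1 ^ 2 * (u.2.2.1 * v.2.2.1) +
        T z.1 ^ 2 * hypMetric z.2.2.2 u.2.2.2 v.2.2.2 := by
  simp only [sliceForm, pullForm_apply, tripleForm, warpedForm_apply, assocEquiv_apply,
    lineForm_apply, hyperbolicForm_apply]

variable {C CT : ℝ} {S₁ S₂ T₁ T₂ : ℝ → ℝ}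

theorem isRiemannianForm_totalTriple (H : IsProfile R h lam) (ha : 5 < a)
    (HS : IsTail lam a C S S₁ S₂) (HT : IsTWith a CT T T₁ T₂) (m : ℕ) :
    IsRiemannianForm (tripleForm (surfaceForm h)
    (fun q => h q.1 * radialCoeff R lam a q.1) (fun q => h q.1 * ftilde R lam a S q.1 q.2)
    (fun q => h q.1 * T q.2) (hyperbolicForm m)) :=
  (isRiemannianForm_lineForm.warpedForm isRiemannianForm_lineForm H.h_smooth H.h_pos).tripleForm
    (isRiemannianForm_hyperbolicForm m)
    ((hasPartials_radialCoeff H).h_mul H.h_smooth H.hasDerivAt_h H.hasDerivAt_deriv_h).smooth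
    (fun _ => mul_pos (H.h_pos _) (radialCoeff_pos H ha _))
    ((hasPartials_ftilde H HS).h_mul H.h_smooth H.hasDerivAt_h H.hasDerivAt_deriv_h).smooth
    (fun _ => mul_pos (H.h_pos _) (ftilde_pos H ha HS _ _))
    ((hasPartials_T HT).h_mul H.h_smooth H.hasDerivAt_h H.hasDerivAt_deriv_h).smooth
    (fun _ => mul_pos (H.h_pos _) (one_pos.trans_le (HT.one_le _)))

theorem isRiemannianForm_sliceTriple (H : IsProfile R h lam) (ha : 5 < a)
    (HS : IsTail lam a C S S₁ S₂) (HT : IsTWith a CT T T₁ T₂) (m : ℕ) (r : ℝ) :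
    IsRiemannianForm (tripleForm lineForm (fun _ => radialCoeff R lam a r)
      (fun t => ftilde R lam a S r t) T (hyperbolicForm m)) :=
  isRiemannianForm_lineForm.tripleForm (isRiemannianForm_hyperbolicForm m) contDiff_const
    (fun _ => radialCoeff_pos H ha _)
    ((hasPartials_ftilde H HS).smooth.comp (contDiff_const.prodMk contDiff_id))
    (fun _ => ftilde_pos H ha HS _ _) HT.smooth fun _ => one_pos.trans_le (HT.one_le _)

theorem isRiemannianForm_totalForm (H : IsProfile R h lam) (ha : 5 < a)
    (HS : IsTail lam a C S S₁ S₂) (HT : IsTWith a CT T T₁ T₂) (m : ℕ) :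
    IsRiemannianForm (totalForm R h lam a S T m) :=
  (isRiemannianForm_totalTriple H ha HS HT m).pullForm _

theorem isRiemannianForm_sliceForm (H : IsProfile R h lam) (ha : 5 < a)
    (HS : IsTail lam a C S S₁ S₂) (HT : IsTWith a CT T T₁ T₂) (m : ℕ) (r : ℝ) :
    IsRiemannianForm (sliceForm R lam a S T m r) :=
  (isRiemannianForm_sliceTriple H ha HS HT m r).pullForm _

theorem WarpingSide.curvatureSide_totalForm (H : IsProfile R h lam) (ha : 5 < a)
    (HS : IsTail lam a C S S₁ S₂) (HT : IsTWith a CT T T₁ T₂) {s k : ℝ}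
    (z : ℝ × ℝ × ℝ × ℝ × Euc m)
    (hW : WarpingSide s k (surfaceForm h) (fun q => h q.1 * radialCoeff R lam a q.1)
      (fun q => h q.1 * ftilde R lam a S q.1 q.2) (fun q => h q.1 * T q.2) (z.1, z.2.1)) :
    CurvatureSide s k (totalForm R h lam a S T m) z :=
  (WarpingSide.curvatureSide
    (isRiemannianForm_lineForm.warpedForm isRiemannianForm_lineForm H.h_smooth H.h_pos)
    (isRiemannianForm_hyperbolicForm m) (curvForm_hyperbolicForm m)
    ((hasPartials_radialCoeff H).h_mul H.h_smooth H.hasDerivAt_h H.hasDerivAt_deriv_h).smooth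
    (fun _ => mul_pos (H.h_pos _) (radialCoeff_pos H ha _))
    ((hasPartials_ftilde H HS).h_mul H.h_smooth H.hasDerivAt_h H.hasDerivAt_deriv_h).smooth
    (fun _ => mul_pos (H.h_pos _) (ftilde_pos H ha HS _ _))
    ((hasPartials_T HT).h_mul H.h_smooth H.hasDerivAt_h H.hasDerivAt_deriv_h).smooth
    (fun _ => mul_pos (H.h_pos _) (one_pos.trans_le (HT.one_le _)))
    (totalEquiv (Euc m) z) hW).pullForm (isRiemannianForm_totalTriple H ha HS HT m) _

theorem exists_curvature_bounds_totalForm (H : IsProfile R h lam) (ha : 5 < a)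
    (HS : IsTail lam a C S S₁ S₂) (hC : 0 ≤ C) (HT : IsTWith a CT T T₁ T₂) (hCT : 0 ≤ CT) :
    ∃ k : ℝ, 0 < k ∧ ∀ (m : ℕ) (z u v : ℝ × ℝ × ℝ × ℝ × Euc m), LinearIndependent ℝ ![u, v] →
      -k ≤ localSectionalCurvature (totalForm R h lam a S T m) z u v ∧
      localSectionalCurvature (totalForm R h lam a S T m) z u v < 0 := by
  obtain ⟨k, hk, hlow⟩ := exists_warpingSide_lower H ha HS hC HT hCT
  refine ⟨k, hk, fun m z u v huv => ?_⟩
  have HR := isRiemannianForm_totalForm H ha HS HT m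
  obtain ⟨c, hc, hup⟩ := exists_warpingSide_upper H ha HS HT z.1 z.2.1
  refine ⟨((hlow z.1 z.2.1).curvatureSide_totalForm H ha HS HT z).le_localSectionalCurvature HR huv,
    ((hup.curvatureSide_totalForm H ha HS HT z).localSectionalCurvature_le HR huv).trans_lt
      (by linarith)⟩

theorem localSectionalCurvature_sliceForm_nonpos (H : IsProfile R h lam) (ha : 5 < a)
    (HS : IsTail lam a C S S₁ S₂) (HT : IsTWith a CT T T₁ T₂) (r : ℝ)
    {z u v : ℝ × ℝ × ℝ × Euc m} (huv : LinearIndependent ℝ ![u, v]) :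
    localSectionalCurvature (sliceForm R lam a S T m r) z u v ≤ 0 := by
  have HR := isRiemannianForm_sliceForm H ha HS HT m r
  have hW := warpingSide_slice H ha HS HT (radialCoeff R lam a r) r z.1
  have := (WarpingSide.curvatureSide isRiemannianForm_lineForm
    (isRiemannianForm_hyperbolicForm m) (curvForm_hyperbolicForm m) contDiff_const
    (fun _ => radialCoeff_pos H ha _)
    ((hasPartials_ftilde H HS).smooth.comp (contDiff_const.prodMk contDiff_id))
    (fun _ => ftilde_pos H ha HS _ _) HT.smooth (fun _ => one_pos.trans_le (HT.one_le _))
    (assocEquiv ℝ (Euc m) z) hW).pullForm (isRiemannianForm_sliceTriple H ha HS HT m r)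
  simpa using this.localSectionalCurvature_le HR huv

end TotalForm

section OfForm

open Filter Topology

variable {E : Type*} [NormedAddCommGroup E] [NormedSpace ℝ E]
  {H : Type*} [TopologicalSpace H] (I : ModelWithCorners ℝ E H)
  (M : Type*) [TopologicalSpace M] [ChartedSpace H M]

/-- The coordinate changes between the preferred charts of `M` are isometries for `G`. -/
def IsInvariantForm (G : E → E →L[ℝ] E →L[ℝ] ℝ) : Prop :=
  ∀ (p q : M) (y : E), y ∈ (extChartAt I p).target → (extChartAt I p).symm y ∈ (extChartAt I q).source →
    ∀ u v : E, G (extChartAt I q ((extChartAt I p).symm y))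
      (fderiv ℝ (extChartAt I q ∘ (extChartAt I p).symm) y u)
      (fderiv ℝ (extChartAt I q ∘ (extChartAt I p).symm) y v) = G y u v

variable {I M} {G : E → E →L[ℝ] E →L[ℝ] ℝ}

theorem IsRiemannianForm.exists_lower_bound [FiniteDimensional ℝ E] (HG : IsRiemannianForm G)
    (y : E) : ∃ c, 0 < c ∧ ∀ v, c * ‖v‖ ^ 2 ≤ G y v v := by
  have hc : Continuous fun v => G y v v := by fun_prop
  have key : ∃ c, 0 < c ∧ ∀ v ∈ Metric.sphere (0 : E) 1, c ≤ G y v v := by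
    rcases (Metric.sphere (0 : E) 1).eq_empty_or_nonempty with he | hne
    · exact ⟨1, one_pos, fun v hv => by simp [he] at hv⟩
    · obtain ⟨v₀, hv₀, hmin⟩ := (isCompact_sphere (0 : E) 1).exists_isMinOn hne hc.continuousOn
      exact ⟨G y v₀ v₀, HG.pos y v₀ (ne_zero_of_mem_unit_sphere ⟨v₀, hv₀⟩), fun v hv => hmin hv⟩
  obtain ⟨c, hc0, hcle⟩ := key
  refine ⟨c, hc0, fun v => ?_⟩
  by_cases hv : v = 0
  · simp [hv]
  · have hn : ‖v‖ ≠ 0 := norm_ne_zero_iff.2 hv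
    have h1 := hcle (‖v‖⁻¹ • v) (by simp [norm_smul, hn])
    simp only [map_smul, smul_apply, smul_eq_mul] at h1
    have : G y v v = ‖v‖ ^ 2 * (‖v‖⁻¹ * (‖v‖⁻¹ * G y v v)) := by field_simp
    rw [this, mul_comm]
    gcongr

theorem IsRiemannianForm.isVonNBounded [FiniteDimensional ℝ E] (HG : IsRiemannianForm G) (y : E) :
    Bornology.IsVonNBounded ℝ {v : E | G y v v < 1} := by
  obtain ⟨c, hc, h⟩ := HG.exists_lower_bound y
  rw [NormedSpace.isVonNBounded_iff']
  refine ⟨1 + 1 / c, fun v hv => ?_⟩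
  have h1 : c * ‖v‖ ^ 2 < 1 := (h v).trans_lt hv
  have h2 : ‖v‖ ^ 2 ≤ 1 / c := by rw [le_div_iff₀ hc]; linarith
  nlinarith [norm_nonneg v, sq_nonneg (‖v‖ - 1), one_div_pos.2 hc]

variable [I.Boundaryless] [IsManifold I ∞ M]

theorem mfderiv_extChartAt_symm_eq (p : M) {y : E} (hy : y ∈ (extChartAt I p).target) :
    (mfderiv 𝓘(ℝ, E) I (extChartAt I p).symm y : E → E) =
      fderiv ℝ (extChartAt I ((extChartAt I p).symm y) ∘ (extChartAt I p).symm) y := by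
  have hd : MDifferentiableAt 𝓘(ℝ, E) I (extChartAt I p).symm y :=
    ((contMDiffOn_extChartAt_symm (n := ∞) p).contMDiffAt
      ((isOpen_extChartAt_target p).mem_nhds hy)).mdifferentiableAt (by simp)
  have h1 := hd.mfderiv
  have h2 : fderivWithin ℝ (writtenInExtChartAt 𝓘(ℝ, E) I y (extChartAt I p).symm)
      (range 𝓘(ℝ, E)) (extChartAt 𝓘(ℝ, E) y y) =
      fderiv ℝ (extChartAt I ((extChartAt I p).symm y) ∘ (extChartAt I p).symm) y := by
    simp only [writtenInExtChartAt, extChartAt_model_space_eq_id, PartialEquiv.refl_coe,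
      PartialEquiv.refl_symm, Function.comp_id, id_eq, modelWithCornersSelf_coe, range_id,
      fderivWithin_univ]
  exact congrArg DFunLike.coe (h1.trans h2)

/-- The metric on `M` whose expression in every preferred chart is `G`. -/
noncomputable def RMetric.ofForm [FiniteDimensional ℝ E] (HG : IsRiemannianForm G)
    (hG : IsInvariantForm I M G) : RMetric I M where
  inner p := G (extChartAt I p p)
  symm p v w := HG.symm _ v w
  pos p v hv := HG.pos _ v hv
  isVonNBounded p := HG.isVonNBounded _
  contMDiff := by
    intro p
    rw [contMDiffAt_hom_bundle]
    refine ⟨contMDiffAt_id, ?_⟩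
    have h1 : ContMDiffAt I 𝓘(ℝ, E →L[ℝ] E →L[ℝ] ℝ) ∞ (fun q => G (extChartAt I p q)) p :=
      HG.smooth.contMDiff.contMDiffAt.comp p contMDiffAt_extChartAt
    refine h1.congr_of_eventuallyEq ?_
    filter_upwards [extChartAt_source_mem_nhds (I := I) p] with q hq
    have hq' : q ∈ (chartAt H p).source := by rwa [extChartAt_source] at hq
    ext v w
    have e0 := inCoordinates_apply_eq₂ (F₁ := E) (F₂ := E) (F₃ := ℝ) (𝕜 := ℝ)
      (E₁ := fun x : M => TangentSpace I x) (E₂ := fun x : M => TangentSpace I x)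
      (E₃ := fun _ : M => ℝ) (x₀ := p) (x := q) (ϕ := (G (extChartAt I q q) : E →L[ℝ] E →L[ℝ] ℝ))
      (v := v) (w := w) (by simpa using hq') (by simpa using hq') (by simp)
    refine e0.trans ?_
    have hy := (extChartAt I p).map_source hq
    have hinv := (extChartAt I p).left_inv hq
    have e := hG p q (extChartAt I p q) hy (by rw [hinv]; exact mem_extChartAt_source q) v w
    have hs : ∀ v : E, ((trivializationAt E (TangentSpace I : M → Type _) p).symm q v : E) =
        fderiv ℝ (extChartAt I q ∘ (extChartAt I p).symm) (extChartAt I p q) v := by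
      intro v
      have h2 := TangentBundle.symmL_trivializationAt_eq_core (I := I) hq'
      have h3 : ((tangentBundleCore I M).coordChange (achart H p) (achart H q) q : E →L[ℝ] E) =
        fderiv ℝ (extChartAt I q ∘ (extChartAt I p).symm) (extChartAt I p q) := by
        rw [← fderivWithin_univ, ← I.range_eq_univ]
        rfl
      rw [← Trivialization.symmL_apply (R := ℝ) _ (show q ∈ (trivializationAt E (TangentSpace I : M → Type _) p).baseSet by simpa using hq')]
      exact congrArg (fun L : E →L[ℝ] E => L v) (h2.trans h3)
    rw [hinv] at e
    rw [← e, ← hs, ← hs]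
    simp
    rfl

end OfForm

section OfForm

open Filter Topology

variable {E : Type*} [NormedAddCommGroup E] [NormedSpace ℝ E] [FiniteDimensional ℝ E]
  {H : Type*} [TopologicalSpace H] {I : ModelWithCorners ℝ E H}
  {M : Type*} [TopologicalSpace M] [ChartedSpace H M] {G : E → E →L[ℝ] E →L[ℝ] ℝ}
  [I.Boundaryless] [IsManifold I ∞ M]

theorem RMetric.ofForm_inner (HG : IsRiemannianForm G) (hG : IsInvariantForm I M G) (p : M)
    (u v : E) : (RMetric.ofForm HG hG).inner p u v = G (extChartAt I p p) u v := rfl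

theorem localMetric_ofForm (HG : IsRiemannianForm G) (hG : IsInvariantForm I M G) (p : M) {y : E}
    (hy : y ∈ (extChartAt I p).target) : localMetric (RMetric.ofForm HG hG) p y = G y := by
  ext u v
  have h := hG p ((extChartAt I p).symm y) y hy (mem_extChartAt_source _) u v
  rw [← mfderiv_extChartAt_symm_eq p hy] at h
  exact h

theorem exists_eq_of_mem_sectionalCurvatures_ofForm (HG : IsRiemannianForm G)
    (hG : IsInvariantForm I M G) {K : ℝ} (hK : K ∈ sectionalCurvatures (RMetric.ofForm HG hG)) :
    ∃ y u v : E, LinearIndependent ℝ ![u, v] ∧ K = localSectionalCurvature G y u v := by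
  obtain ⟨p, u, v, huv, rfl⟩ := hK
  refine ⟨extChartAt I p p, u, v, huv, ?_⟩
  refine localSectionalCurvature_congr ?_ _ _
  filter_upwards [(isOpen_extChartAt_target p).mem_nhds (mem_extChartAt_target (I := I) p)] with y hy
  exact localMetric_ofForm HG hG p hy

theorem preservesMetric_ofForm (HG : IsRiemannianForm G) (hG : IsInvariantForm I M G) {φ : M → M}
    (hφ : ContMDiff I I ∞ φ)
    (h : ∀ (p : M) (u v : E), G (extChartAt I (φ p) (φ p))
      (fderiv ℝ (extChartAt I (φ p) ∘ φ ∘ (extChartAt I p).symm) (extChartAt I p p) u)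
      (fderiv ℝ (extChartAt I (φ p) ∘ φ ∘ (extChartAt I p).symm) (extChartAt I p p) v) =
        G (extChartAt I p p) u v) : PreservesMetric (RMetric.ofForm HG hG) φ := by
  refine ⟨hφ, fun p u v => ?_⟩
  have h1 := ((hφ p).mdifferentiableAt (by simp)).mfderiv
  have h2 : (mfderiv I I φ p : E → E) =
      fderiv ℝ (extChartAt I (φ p) ∘ φ ∘ (extChartAt I p).symm) (extChartAt I p p) := by
    rw [← fderivWithin_univ, ← I.range_eq_univ]
    exact congrArg DFunLike.coe h1
  have h3 := h p u v
  rw [← h2] at h3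
  exact h3

end OfForm

section CircleCharts

open Filter Topology

variable {c : ℝ} [Fact (0 < c)]

theorem extChartAt_circle_symm_apply (x : AddCircle c) (w : ℝ) :
    (extChartAt 𝓘(ℝ, ℝ) x).symm w = (w : AddCircle c) := rfl

theorem extChartAt_circle_coe {x : AddCircle c} {w : ℝ}
    (hw : w ∈ (extChartAt 𝓘(ℝ, ℝ) x).target) : extChartAt 𝓘(ℝ, ℝ) x (w : AddCircle c) = w :=
  (extChartAt 𝓘(ℝ, ℝ) x).right_inv hw

theorem exists_eventuallyEq_circle_transition {x y α : AddCircle c} {z : ℝ}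
    (h : (extChartAt 𝓘(ℝ, ℝ) x).symm z + α ∈ (extChartAt 𝓘(ℝ, ℝ) y).source) :
    ∃ k : ℝ, (fun w => extChartAt 𝓘(ℝ, ℝ) y ((extChartAt 𝓘(ℝ, ℝ) x).symm w + α)) =ᶠ[𝓝 z]
      fun w => w + k := by
  rw [extChartAt_circle_symm_apply] at h
  set y' := extChartAt 𝓘(ℝ, ℝ) y ((z : AddCircle c) + α) with hy'
  have hy := (extChartAt 𝓘(ℝ, ℝ) y).map_source h
  have hxy : (y' : AddCircle c) = (z : AddCircle c) + α := (extChartAt 𝓘(ℝ, ℝ) y).left_inv h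
  refine ⟨y' - z, ?_⟩
  have hnear : ∀ᶠ w in 𝓝 z, w + (y' - z) ∈ (extChartAt 𝓘(ℝ, ℝ) y).target := by
    have hc : ContinuousAt (fun w : ℝ => w + (y' - z)) z := by fun_prop
    apply hc.eventually_mem
    rw [add_sub_cancel]
    exact (isOpen_extChartAt_target y).mem_nhds hy
  filter_upwards [hnear] with w hw
  have e : ((w : AddCircle c) + α) = ((w + (y' - z) : ℝ) : AddCircle c) := by
    rw [AddCircle.coe_add, AddCircle.coe_sub, hxy]
    abel
  rw [extChartAt_circle_symm_apply, e, extChartAt_circle_coe hw]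

theorem hasFDerivAt_circle_transition {x y α : AddCircle c} {z : ℝ}
    (h : (extChartAt 𝓘(ℝ, ℝ) x).symm z + α ∈ (extChartAt 𝓘(ℝ, ℝ) y).source) :
    HasFDerivAt (fun w => extChartAt 𝓘(ℝ, ℝ) y ((extChartAt 𝓘(ℝ, ℝ) x).symm w + α))
      (ContinuousLinearMap.id ℝ ℝ) z := by
  obtain ⟨k, hk⟩ := exists_eventuallyEq_circle_transition h
  exact ((hasFDerivAt_id z).add_const k).congr_of_eventuallyEq hk

theorem contMDiff_circle_add (α : AddCircle c) :
    ContMDiff 𝓘(ℝ, ℝ) 𝓘(ℝ, ℝ) ∞ fun x : AddCircle c => x + α := by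
  intro x
  rw [contMDiffAt_iff]
  refine ⟨by fun_prop, ?_⟩
  obtain ⟨k, hk⟩ := exists_eventuallyEq_circle_transition (x := x) (y := x + α) (α := α)
    (z := extChartAt 𝓘(ℝ, ℝ) x x) (by
      rw [(extChartAt 𝓘(ℝ, ℝ) x).left_inv (mem_extChartAt_source x)]
      exact mem_extChartAt_source _)
  have h1 : ContDiffAt ℝ ∞ (fun w : ℝ => w + k) (extChartAt 𝓘(ℝ, ℝ) x x) := by fun_prop
  exact (h1.congr_of_eventuallyEq hk).contDiffWithinAt

end CircleCharts

section ProductCharts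

variable {m : ℕ} {N : Type*} [TopologicalSpace N] [ChartedSpace (Euc m) N]
  [HyperbolicManifold m N] {c₁ c₂ : ℝ} [Fact (0 < c₁)] [Fact (0 < c₂)]

theorem differentiableAt_hyperbolic_transition {p q : N} {z : Euc m}
    (hz : z ∈ (extChartAt (𝓡 m) p).target)
    (hq : (extChartAt (𝓡 m) p).symm z ∈ (extChartAt (𝓡 m) q).source) :
    DifferentiableAt ℝ (extChartAt (𝓡 m) q ∘ (extChartAt (𝓡 m) p).symm) z := by
  have h := HyperbolicManifold.contDiffOn_transition _ (chart_mem_atlas (Euc m) p) _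
    (chart_mem_atlas (Euc m) q)
  have hs : z ∈ ((chartAt (Euc m) p).symm ≫ₕ chartAt (Euc m) q).source := by
    simpa using And.intro hz hq
  have h1 := (h.contDiffAt
    (((chartAt (Euc m) p).symm ≫ₕ chartAt (Euc m) q).open_source.mem_nhds hs)).differentiableAt
    (by simp)
  exact h1

theorem hypMetric_transition {p q : N} {z : Euc m} (hz : z ∈ (extChartAt (𝓡 m) p).target)
    (hq : (extChartAt (𝓡 m) p).symm z ∈ (extChartAt (𝓡 m) q).source) (u v : Euc m) :
    hypMetric (extChartAt (𝓡 m) q ((extChartAt (𝓡 m) p).symm z))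
      (fderiv ℝ (extChartAt (𝓡 m) q ∘ (extChartAt (𝓡 m) p).symm) z u)
      (fderiv ℝ (extChartAt (𝓡 m) q ∘ (extChartAt (𝓡 m) p).symm) z v) = hypMetric z u v :=
  HyperbolicManifold.isometry_transition _ (chart_mem_atlas (Euc m) p) _
    (chart_mem_atlas (Euc m) q) z (by simpa using And.intro hz hq) u v

/-- Rotation of the two circles in `ℝ × S¹(c₁) × S¹(c₂) × N`. -/
def fiberRotate (α : AddCircle c₁) (β : AddCircle c₂) (p : ProdFiber c₁ c₂ N) :
    ProdFiber c₁ c₂ N :=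
  (p.1, p.2.1 + α, p.2.2.1 + β, p.2.2.2)

/-- The derivative of a rotation in coordinates, given the derivative `L` along `N`. -/
noncomputable def fiberRotateDeriv (L : Euc m →L[ℝ] Euc m) :
    (ℝ × ℝ × ℝ × Euc m) →L[ℝ] ℝ × ℝ × ℝ × Euc m :=
  (ContinuousLinearMap.id ℝ ℝ).prodMap
    ((ContinuousLinearMap.id ℝ ℝ).prodMap ((ContinuousLinearMap.id ℝ ℝ).prodMap L))

theorem hasFDerivAt_fiberRotate {p q : ProdFiber c₁ c₂ N} {α : AddCircle c₁} {β : AddCircle c₂}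
    {z : ℝ × ℝ × ℝ × Euc m} (hz : z ∈ (extChartAt (fiberModel m) p).target)
    (hq : fiberRotate α β ((extChartAt (fiberModel m) p).symm z) ∈
      (extChartAt (fiberModel m) q).source) :
    z.2.2.2 ∈ (extChartAt (𝓡 m) p.2.2.2).target ∧
    (extChartAt (𝓡 m) p.2.2.2).symm z.2.2.2 ∈ (extChartAt (𝓡 m) q.2.2.2).source ∧
    HasFDerivAt (extChartAt (fiberModel m) q ∘ fiberRotate α β ∘ (extChartAt (fiberModel m) p).symm)
      (fiberRotateDeriv (fderiv ℝ
        (extChartAt (𝓡 m) q.2.2.2 ∘ (extChartAt (𝓡 m) p.2.2.2).symm) z.2.2.2)) z := by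
  simp only [extChartAt_prod, PartialEquiv.prod_target, PartialEquiv.prod_source, mem_prod,
    fiberRotate, PartialEquiv.prod_symm] at hz hq
  obtain ⟨-, -, -, hz4⟩ := hz
  obtain ⟨-, hq2, hq3, hq4⟩ := hq
  refine ⟨hz4, hq4, ?_⟩
  have h := (hasFDerivAt_id z.1).prodMap z
    ((hasFDerivAt_circle_transition hq2).prodMap z.2
      ((hasFDerivAt_circle_transition hq3).prodMap z.2.2
        (differentiableAt_hyperbolic_transition hz4 hq4).hasFDerivAt))
  refine h.congr_of_eventuallyEq (Filter.Eventually.of_forall fun w => ?_)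
  simp only [extChartAt_prod, PartialEquiv.prod_symm]
  rfl

theorem hasFDerivAt_rotate {p q : ProdTotal c₁ c₂ N} {α : AddCircle c₁} {β : AddCircle c₂}
    {z : ℝ × ℝ × ℝ × ℝ × Euc m} (hz : z ∈ (extChartAt (totalModel m) p).target)
    (hq : rotate α β ((extChartAt (totalModel m) p).symm z) ∈
      (extChartAt (totalModel m) q).source) :
    z.2.2.2.2 ∈ (extChartAt (𝓡 m) p.2.2.2.2).target ∧
    (extChartAt (𝓡 m) p.2.2.2.2).symm z.2.2.2.2 ∈ (extChartAt (𝓡 m) q.2.2.2.2).source ∧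
    HasFDerivAt (extChartAt (totalModel m) q ∘ rotate α β ∘ (extChartAt (totalModel m) p).symm)
      ((ContinuousLinearMap.id ℝ ℝ).prodMap (fiberRotateDeriv (fderiv ℝ
        (extChartAt (𝓡 m) q.2.2.2.2 ∘ (extChartAt (𝓡 m) p.2.2.2.2).symm) z.2.2.2.2))) z := by
  rw [extChartAt_prod p] at hz
  have hz2 : z.2 ∈ (extChartAt (fiberModel m) p.2).target := by
    simp only [PartialEquiv.prod_target, mem_prod] at hz
    exact hz.2
  rw [extChartAt_prod q, PartialEquiv.prod_source, mem_prod] at hq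
  have hq2 : fiberRotate α β ((extChartAt (fiberModel m) p.2).symm z.2) ∈
      (extChartAt (fiberModel m) q.2).source := by
    have h := hq.2
    rw [extChartAt_prod p] at h
    exact h
  obtain ⟨h1, h2, h3⟩ := hasFDerivAt_fiberRotate hz2 hq2
  refine ⟨h1, h2, ((hasFDerivAt_id z.1).prodMap z h3).congr_of_eventuallyEq
    (Filter.Eventually.of_forall fun w => ?_)⟩
  rw [extChartAt_prod, extChartAt_prod]
  rfl

end ProductCharts

section ProductMetrics

variable {m : ℕ} {N : Type*} [TopologicalSpace N] [ChartedSpace (Euc m) N]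
  [HyperbolicManifold m N] {c₁ c₂ : ℝ} [Fact (0 < c₁)] [Fact (0 < c₂)]
  {R h lam : ℝ → ℝ} {a : ℝ} {S T : ℝ → ℝ}

theorem totalForm_rotate {p q : ProdTotal c₁ c₂ N} {α : AddCircle c₁} {β : AddCircle c₂}
    {z : ℝ × ℝ × ℝ × ℝ × Euc m} (hz : z ∈ (extChartAt (totalModel m) p).target)
    (hq : rotate α β ((extChartAt (totalModel m) p).symm z) ∈
      (extChartAt (totalModel m) q).source) (u v : ℝ × ℝ × ℝ × ℝ × Euc m) :
    totalForm R h lam a S T m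
      (extChartAt (totalModel m) q (rotate α β ((extChartAt (totalModel m) p).symm z)))
      (fderiv ℝ (extChartAt (totalModel m) q ∘ rotate α β ∘ (extChartAt (totalModel m) p).symm) z u)
      (fderiv ℝ (extChartAt (totalModel m) q ∘ rotate α β ∘ (extChartAt (totalModel m) p).symm) z v)
      = totalForm R h lam a S T m z u v := by
  obtain ⟨h1, h2, h3⟩ := hasFDerivAt_rotate hz hq
  rw [h3.fderiv, totalForm_apply, totalForm_apply,
    ← hypMetric_transition h1 h2 u.2.2.2.2 v.2.2.2.2]
  simp only [extChartAt_prod]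
  rfl

theorem sliceForm_fiberRotate {p q : ProdFiber c₁ c₂ N} {α : AddCircle c₁} {β : AddCircle c₂}
    {z : ℝ × ℝ × ℝ × Euc m} (hz : z ∈ (extChartAt (fiberModel m) p).target)
    (hq : fiberRotate α β ((extChartAt (fiberModel m) p).symm z) ∈
      (extChartAt (fiberModel m) q).source) (r : ℝ) (u v : ℝ × ℝ × ℝ × Euc m) :
    sliceForm R lam a S T m r
      (extChartAt (fiberModel m) q (fiberRotate α β ((extChartAt (fiberModel m) p).symm z)))
      (fderiv ℝ
        (extChartAt (fiberModel m) q ∘ fiberRotate α β ∘ (extChartAt (fiberModel m) p).symm) z u)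
      (fderiv ℝ
        (extChartAt (fiberModel m) q ∘ fiberRotate α β ∘ (extChartAt (fiberModel m) p).symm) z v)
      = sliceForm R lam a S T m r z u v := by
  obtain ⟨h1, h2, h3⟩ := hasFDerivAt_fiberRotate hz hq
  rw [h3.fderiv, sliceForm_apply, sliceForm_apply,
    ← hypMetric_transition h1 h2 u.2.2.2 v.2.2.2]
  simp only [extChartAt_prod]
  rfl

theorem rotate_zero : (rotate 0 0 : ProdTotal c₁ c₂ N → ProdTotal c₁ c₂ N) = id := by
  funext p
  simp [rotate]

theorem fiberRotate_zero : (fiberRotate 0 0 : ProdFiber c₁ c₂ N → ProdFiber c₁ c₂ N) = id := by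
  funext p
  simp [fiberRotate]

theorem isInvariantForm_totalForm :
    IsInvariantForm (totalModel m) (ProdTotal c₁ c₂ N) (totalForm R h lam a S T m) := by
  intro p q z hz hq u v
  have h := totalForm_rotate (R := R) (h := h) (lam := lam) (a := a) (S := S) (T := T)
    (α := 0) (β := 0) hz (q := q) (by rwa [rotate_zero]) u v
  rwa [rotate_zero] at h

theorem isInvariantForm_sliceForm (r : ℝ) :
    IsInvariantForm (fiberModel m) (ProdFiber c₁ c₂ N) (sliceForm R lam a S T m r) := by
  intro p q z hz hq u v
  have h := sliceForm_fiberRotate (R := R) (lam := lam) (a := a) (S := S) (T := T)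
    (α := 0) (β := 0) hz (q := q) (by rwa [fiberRotate_zero]) r u v
  rwa [fiberRotate_zero] at h

theorem contMDiff_rotate (α : AddCircle c₁) (β : AddCircle c₂) :
    ContMDiff (totalModel m) (totalModel m) ∞
      (rotate α β : ProdTotal c₁ c₂ N → ProdTotal c₁ c₂ N) :=
  contMDiff_id.prodMap (contMDiff_id.prodMap ((contMDiff_circle_add α).prodMap
    ((contMDiff_circle_add β).prodMap contMDiff_id)))

theorem preservesMetric_rotate (HG : IsRiemannianForm (totalForm R h lam a S T m))
    (α : AddCircle c₁) (β : AddCircle c₂) :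
    PreservesMetric (RMetric.ofForm (M := ProdTotal c₁ c₂ N) HG isInvariantForm_totalForm)
      (rotate α β) := by
  refine preservesMetric_ofForm HG _ (contMDiff_rotate α β) fun p u v => ?_
  have hinv := (extChartAt (totalModel m) p).left_inv (mem_extChartAt_source p)
  have h := totalForm_rotate (R := R) (h := h) (lam := lam) (a := a) (S := S) (T := T)
    (α := α) (β := β) (mem_extChartAt_target p) (q := rotate α β p)
    (by rw [hinv]; exact mem_extChartAt_source _) u v
  rwa [hinv] at h

theorem ofForm_totalForm_inner (HG : IsRiemannianForm (totalForm R h lam a S T m))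
    (r t : ℝ) (ρ : AddCircle c₁) (τ : AddCircle c₂) (x : N) (u v : ℝ × ℝ × ℝ × ℝ × Euc m) :
    (RMetric.ofForm (M := ProdTotal c₁ c₂ N) HG isInvariantForm_totalForm).inner (r, t, ρ, τ, x) u v
      = u.1 * v.1 + h r ^ 2 *
        fiberForm (radialCoeff R lam a r) (ftilde R lam a S r t) (T t) x u.2 v.2 := by
  rw [RMetric.ofForm_inner, totalForm_apply]
  simp only [extChartAt_prod]
  rfl

theorem ofForm_sliceForm_inner {r : ℝ} (HG : IsRiemannianForm (sliceForm R lam a S T m r))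
    (t : ℝ) (ρ : AddCircle c₁) (τ : AddCircle c₂) (x : N) (u v : ℝ × ℝ × ℝ × Euc m) :
    (RMetric.ofForm (M := ProdFiber c₁ c₂ N) HG (isInvariantForm_sliceForm r)).inner (t, ρ, τ, x) u v
      = fiberForm (radialCoeff R lam a r) (ftilde R lam a S r t) (T t) x u v := by
  rw [RMetric.ofForm_inner, sliceForm_apply]
  simp only [extChartAt_prod]
  rfl

end ProductMetrics

section FormVolume

open Module

variable {E : Type*} [NormedAddCommGroup E] [NormedSpace ℝ E] [FiniteDimensional ℝ E]

/-- The determinant of the Gram matrix of a bilinear form. -/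
noncomputable def gramDet (B : E →L[ℝ] E →L[ℝ] ℝ) : ℝ :=
  Matrix.det (Matrix.of fun i j => B (finBasis ℝ E i) (finBasis ℝ E j))

theorem gramDet_eq_of_forall {B B' : E →L[ℝ] E →L[ℝ] ℝ} (L : E →L[ℝ] E)
    (h : ∀ u v, B' (L u) (L v) = B u v) :
    gramDet B = (LinearMap.det (L : E →ₗ[ℝ] E)) ^ 2 * gramDet B' := by
  let b := finBasis ℝ E
  have key : (Matrix.of fun i j => B (b i) (b j)) =
      (LinearMap.toMatrix b b (L : E →ₗ[ℝ] E)).transpose * (Matrix.of fun i j => B' (b i) (b j)) *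
        LinearMap.toMatrix b b (L : E →ₗ[ℝ] E) := by
    ext i j
    have hL : ∀ i, L (b i) = ∑ k, LinearMap.toMatrix b b (L : E →ₗ[ℝ] E) k i • b k := fun i => by
      conv_lhs => rw [← b.sum_repr (L (b i))]
      simp [LinearMap.toMatrix_apply]
    rw [Matrix.of_apply, ← h, hL i, hL j]
    simp only [map_sum, map_smul, sum_apply, smul_apply, smul_eq_mul, Matrix.mul_apply,
      Matrix.transpose_apply, Matrix.of_apply, Finset.mul_sum, Finset.sum_mul]
    refine Finset.sum_congr rfl fun k _ => Finset.sum_congr rfl fun l _ => ?_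
    ring
  rw [gramDet, gramDet, key, Matrix.det_mul, Matrix.det_mul, Matrix.det_transpose,
    LinearMap.det_toMatrix]
  ring

theorem sqrt_gramDet_eq_of_forall {B B' : E →L[ℝ] E →L[ℝ] ℝ} (L : E →L[ℝ] E)
    (h : ∀ u v, B' (L u) (L v) = B u v) :
    √(gramDet B) = |LinearMap.det (L : E →ₗ[ℝ] E)| * √(gramDet B') := by
  rw [gramDet_eq_of_forall L h, Real.sqrt_mul (sq_nonneg _), Real.sqrt_sq_eq_abs]

theorem Continuous.gramDet {X : Type*} [TopologicalSpace X] {B : X → E →L[ℝ] E →L[ℝ] ℝ}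
    (hB : Continuous B) : Continuous fun x => gramDet (B x) := by
  refine Continuous.matrix_det ?_
  refine continuous_matrix fun i j => ?_
  simp only [Matrix.of_apply]
  fun_prop

variable [MeasurableSpace E] [BorelSpace E]
  {H : Type*} [TopologicalSpace H] {I : ModelWithCorners ℝ E H}
  {M : Type*} [TopologicalSpace M] [ChartedSpace H M] {G : E → E →L[ℝ] E →L[ℝ] ℝ}
  [I.Boundaryless] [IsManifold I ∞ M]

theorem measurableSet_extChartAt_symm_preimage (p : M) {A : Set M} (hA : MeasurableSet[borel M] A) :
    MeasurableSet ((extChartAt I p).target ∩ (extChartAt I p).symm ⁻¹' A) := by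
  let _ : MeasurableSpace M := borel M
  have : BorelSpace M := ⟨rfl⟩
  have hm : MeasurableSet (extChartAt I p).target := (isOpen_extChartAt_target p).measurableSet
  have h := hm.subtype_image ((continuousOn_extChartAt_symm (I := I) p).domRestrict.measurable hA)
  convert h using 1
  ext y
  simp [and_comm]

theorem chartVolume_ofForm_apply (HG : IsRiemannianForm G) (hG : IsInvariantForm I M G) (p : M)
    {A : Set M} (hA : MeasurableSet[borel M] A) :
    chartVolume (RMetric.ofForm HG hG) p A =
      ∫⁻ y in (extChartAt I p).target ∩ (extChartAt I p).symm ⁻¹' A,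
        ENNReal.ofReal √(gramDet (G y)) ∂(finBasis ℝ E).addHaar := by
  let _ : MeasurableSpace M := borel M
  have : BorelSpace M := ⟨rfl⟩
  have hm : MeasurableSet (extChartAt I p).target := (isOpen_extChartAt_target p).measurableSet
  have hc := (continuousOn_extChartAt_symm (I := I) p).aemeasurable (μ := (finBasis ℝ E).addHaar) hm
  rw [chartVolume, Measure.map_apply_of_aemeasurable
    (hc.mono_ac (withDensity_absolutelyContinuous _ _)) hA, withDensity_apply',
    Measure.restrict_restrict' hm, inter_comm]
  refine setLIntegral_congr_fun (measurableSet_extChartAt_symm_preimage p hA) fun y hy => ?_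
  simp only [localMetric_ofForm HG hG p hy.1]
  rfl

theorem chartVolume_ofForm_le (HG : IsRiemannianForm G) (hG : IsInvariantForm I M G) (p q : M)
    {A : Set M} (hA : MeasurableSet[borel M] A) (hAq : A ⊆ (extChartAt I q).source) :
    chartVolume (RMetric.ofForm HG hG) p A ≤ chartVolume (RMetric.ofForm HG hG) q A := by
  rw [chartVolume_ofForm_apply HG hG p hA, chartVolume_ofForm_apply HG hG q hA]
  set s := (extChartAt I p).target ∩ (extChartAt I p).symm ⁻¹' A
  have hs : MeasurableSet s := measurableSet_extChartAt_symm_preimage p hA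
  set ψ := extChartAt I q ∘ (extChartAt I p).symm
  have hd : ∀ y ∈ s, HasFDerivWithinAt ψ (fderiv ℝ ψ y) s y := by
    intro y hy
    have h1 := contDiffWithinAt_ext_coord_change (I := I) (n := ∞) q p
      (y := y) ⟨hy.1, hAq hy.2⟩
    rw [I.range_eq_univ, contDiffWithinAt_univ] at h1
    exact (h1.differentiableAt (by simp)).hasFDerivAt.hasFDerivWithinAt
  have hinj : InjOn ψ s := by
    intro y hy y' hy' h
    have h1 := (extChartAt I q).injOn (hAq hy.2) (hAq hy'.2) h
    exact (extChartAt I p).symm.injOn hy.1 hy'.1 h1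
  calc ∫⁻ y in s, ENNReal.ofReal √(gramDet (G y)) ∂(finBasis ℝ E).addHaar
      = ∫⁻ y in s, ENNReal.ofReal |(fderiv ℝ ψ y).det| *
          ENNReal.ofReal √(gramDet (G (ψ y))) ∂(finBasis ℝ E).addHaar := by
        refine setLIntegral_congr_fun hs fun y hy => ?_
        have e := sqrt_gramDet_eq_of_forall (B := G y) (B' := G (ψ y)) (fderiv ℝ ψ y)
          fun u v => hG p q y hy.1 (hAq hy.2) u v
        simp only [e]
        exact ENNReal.ofReal_mul (abs_nonneg _)
    _ = ∫⁻ y in ψ '' s, ENNReal.ofReal √(gramDet (G y)) ∂(finBasis ℝ E).addHaar :=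
        (lintegral_image_eq_lintegral_abs_det_fderiv_mul (finBasis ℝ E).addHaar hs hd hinj
          fun y => ENNReal.ofReal √(gramDet (G y))).symm
    _ ≤ _ := by
        refine lintegral_mono_set ?_
        rintro _ ⟨y, hy, rfl⟩
        refine ⟨(extChartAt I q).map_source (hAq hy.2), ?_⟩
        have := (extChartAt I q).left_inv (hAq hy.2)
        simp only [mem_preimage, ψ, Function.comp_apply, this]
        exact hy.2

theorem riemannianVolume_ofForm_le (HG : IsRiemannianForm G) (hG : IsInvariantForm I M G)
    {ι : Type*} (t : Finset ι) (q : ι → M) (K : ι → Set M) (hK : ∀ i, IsClosed (K i))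
    (hKs : ∀ i, K i ⊆ (extChartAt I (q i)).source) (hcover : univ ⊆ ⋃ i ∈ t, K i) {A : Set M}
    (hA : MeasurableSet[borel M] A) :
    riemannianVolume (RMetric.ofForm HG hG) A ≤
      ∑ i ∈ t, chartVolume (RMetric.ofForm HG hG) (q i) (A ∩ K i) := by
  let _ : MeasurableSpace M := borel M
  have : BorelSpace M := ⟨rfl⟩
  have hle : riemannianVolume (RMetric.ofForm HG hG) ≤
      ∑ i ∈ t, (chartVolume (RMetric.ofForm HG hG) (q i)).restrict (K i) := by
    refine iSup_le fun p => Measure.le_iff.2 fun B hB => ?_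
    calc chartVolume (RMetric.ofForm HG hG) p B
        ≤ chartVolume (RMetric.ofForm HG hG) p (⋃ i ∈ t, B ∩ K i) := by
          refine measure_mono fun x hx => ?_
          have := hcover (mem_univ x)
          simp only [mem_iUnion, exists_prop] at this ⊢
          obtain ⟨i, hi, hxi⟩ := this
          exact ⟨i, hi, hx, hxi⟩
      _ ≤ ∑ i ∈ t, chartVolume (RMetric.ofForm HG hG) p (B ∩ K i) := measure_biUnion_finset_le _ _
      _ ≤ ∑ i ∈ t, chartVolume (RMetric.ofForm HG hG) (q i) (B ∩ K i) :=
          Finset.sum_le_sum fun i _ => chartVolume_ofForm_le HG hG p (q i)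
            (hB.inter (hK i).measurableSet) (inter_subset_right.trans (hKs i))
      _ = _ := by
          rw [Measure.finsetSum_apply]
          exact Finset.sum_congr rfl fun i _ => (Measure.restrict_apply hB).symm
  refine (hle A).trans ?_
  rw [Measure.finsetSum_apply]
  exact Finset.sum_le_sum fun i _ => (Measure.restrict_apply hA).le

end FormVolume

section TotalVolume

open Module

variable {m : ℕ}

/-- The metric `dr² + dt² + dρ² + dτ² + g_N` in coordinates. -/
noncomputable def unitForm (m : ℕ) : ℝ × ℝ × ℝ × ℝ × Euc m →
    (ℝ × ℝ × ℝ × ℝ × Euc m) →L[ℝ] (ℝ × ℝ × ℝ × ℝ × Euc m) →L[ℝ] ℝ :=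
  pullForm (totalEquiv (Euc m)) (tripleForm (surfaceForm fun _ => 1)
    (fun _ => 1) (fun _ => 1) (fun _ => 1) (hyperbolicForm m))

theorem unitForm_apply (z u v : ℝ × ℝ × ℝ × ℝ × Euc m) :
    unitForm m z u v = u.1 * v.1 + u.2.1 * v.2.1 + u.2.2.1 * v.2.2.1 + u.2.2.2.1 * v.2.2.2.1 +
      hypMetric z.2.2.2.2 u.2.2.2.2 v.2.2.2.2 := by
  simp only [unitForm, pullForm_apply, tripleForm, warpedForm_apply, totalEquiv_apply,
    lineForm_apply, hyperbolicForm_apply]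
  ring

theorem continuous_unitForm (m : ℕ) : Continuous (unitForm m) :=
  ((isRiemannianForm_lineForm.warpedForm isRiemannianForm_lineForm contDiff_const
    fun _ => one_pos).tripleForm (isRiemannianForm_hyperbolicForm m) contDiff_const
      (fun _ => one_pos) contDiff_const (fun _ => one_pos) contDiff_const
        fun _ => one_pos).pullForm _ |>.smooth.continuous

/-- The diagonal map with entries `1, h, k, l, s`. -/
noncomputable def scaleMap (m : ℕ) (h k l s : ℝ) :
    (ℝ × ℝ × ℝ × ℝ × Euc m) →L[ℝ] ℝ × ℝ × ℝ × ℝ × Euc m :=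
  (ContinuousLinearMap.id ℝ ℝ).prodMap ((h • ContinuousLinearMap.id ℝ ℝ).prodMap
    ((k • ContinuousLinearMap.id ℝ ℝ).prodMap ((l • ContinuousLinearMap.id ℝ ℝ).prodMap
      (s • ContinuousLinearMap.id ℝ (Euc m)))))

theorem scaleMap_apply (h k l s : ℝ) (u : ℝ × ℝ × ℝ × ℝ × Euc m) :
    scaleMap m h k l s u =
      (u.1, h • u.2.1, k • u.2.2.1, l • u.2.2.2.1, s • u.2.2.2.2) := rfl

theorem det_scaleMap (h k l s : ℝ) :
    LinearMap.det (scaleMap m h k l s : (ℝ × ℝ × ℝ × ℝ × Euc m) →ₗ[ℝ] ℝ × ℝ × ℝ × ℝ × Euc m) =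
      h * (k * (l * s ^ m)) := by
  simp [scaleMap, LinearMap.det_prodMap]

theorem hypMetric_smul (x u v : Euc m) (s : ℝ) :
    hypMetric x (s • u) (s • v) = s ^ 2 * hypMetric x u v := by
  simp only [← hyperbolicForm_apply, map_smul, smul_apply, smul_eq_mul]
  ring

variable {R h lam : ℝ → ℝ} {a C CT : ℝ} {S S₁ S₂ T T₁ T₂ : ℝ → ℝ}

theorem sqrt_gramDet_totalForm (H : IsProfile R h lam) (ha : 5 < a)
    (HS : IsTail lam a C S S₁ S₂) (HT : IsTWith a CT T T₁ T₂) (z : ℝ × ℝ × ℝ × ℝ × Euc m) :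
    √(gramDet (totalForm R h lam a S T m z)) =
      h z.1 * ((h z.1 * radialCoeff R lam a z.1) * ((h z.1 * ftilde R lam a S z.1 z.2.1) *
        (h z.1 * T z.2.1) ^ m)) * √(gramDet (unitForm m (0, 0, z.2.2))) := by
  have h1 := H.h_pos z.1
  have h2 := radialCoeff_pos H ha z.1
  have h3 := ftilde_pos H ha HS z.1 z.2.1
  have h4 : 0 < T z.2.1 := one_pos.trans_le (HT.one_le _)
  rw [sqrt_gramDet_eq_of_forall (B' := unitForm m (0, 0, z.2.2)) (scaleMap m (h z.1)
    (h z.1 * radialCoeff R lam a z.1) (h z.1 * ftilde R lam a S z.1 z.2.1) (h z.1 * T z.2.1)),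
    det_scaleMap, abs_of_pos (by positivity)]
  intro u v
  rw [totalForm_apply, unitForm_apply]
  simp only [scaleMap_apply, hypMetric_smul, smul_eq_mul]
  ring

theorem mollify_fbar_le (H : IsMollifier lam) {s : ℝ} (hs : -1 ≤ s) :
    mollify lam fbar s ≤ (Real.exp 1 + mollify lam Real.exp 0) * Real.exp s := by
  rw [H.mollify_fbar]
  have h1 := H.mollCdf_nonneg s
  have h2 := mul_le_mul_of_nonneg_left (H.mollExp_le s) (Real.exp_pos s).le
  have h3 : 1 ≤ Real.exp 1 * Real.exp s := by
    rw [← Real.exp_add]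
    exact Real.one_le_exp (by linarith)
  linarith

theorem exists_volume_density_le (H : IsProfile R h lam) (ha : 5 < a)
    (HS : IsTail lam a C S S₁ S₂) (HT : IsTWith a CT T T₁ T₂) (m : ℕ) :
    ∃ k : ℝ, 0 ≤ k ∧ ∀ z : ℝ × ℝ × ℝ × ℝ × Euc m, z.1 ≤ -1 → z.1 - 1 ≤ z.2.1 → z.2.1 ≤ 2 →
      √(gramDet (totalForm R h lam a S T m z)) ≤
        k * (Real.exp z.1 * Real.exp z.2.1) * √(gramDet (unitForm m (0, 0, z.2.2))) := by
  have hb := bConst_pos H.isMollifier ha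
  have hc := H.isMollifier.mollify_exp_pos
  refine ⟨2 * ((2 * bConst lam a) * ((2 * (bConst lam a *
    (Real.exp 1 + mollify lam Real.exp 0))) * 2 ^ m)), by positivity, fun z h1 h2 h3 => ?_⟩
  rw [sqrt_gramDet_totalForm H ha HS HT]
  refine mul_le_mul_of_nonneg_right ?_ (Real.sqrt_nonneg _)
  have hR : R z.1 = z.1 := H.R_left _ (by linarith)
  have hh : h z.1 ≤ 2 := by
    rw [H.h_left _ h1]
    linarith [Real.exp_le_one_iff.2 (show z.1 ≤ 0 by linarith)]
  have hh0 := H.h_pos z.1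
  have hA : radialCoeff R lam a z.1 = bConst lam a * Real.exp z.1 := by rw [radialCoeff, hR]
  have hF : ftilde R lam a S z.1 z.2.1 ≤
      bConst lam a * (Real.exp 1 + mollify lam Real.exp 0) * Real.exp z.2.1 := by
    rw [ftilde, HS.left _ (by linarith), add_zero, hA, hR]
    have e : Real.exp z.2.1 = Real.exp z.1 * Real.exp (z.2.1 - z.1) := by
      rw [← Real.exp_add]; ring_nf
    have := mul_le_mul_of_nonneg_left (mollify_fbar_le H.isMollifier
      (show -1 ≤ z.2.1 - z.1 by linarith)) (mul_pos hb (Real.exp_pos z.1)).le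
    rw [e]
    linarith
  have hF0 := (ftilde_pos H ha HS z.1 z.2.1).le
  rw [hA, HT.left _ (by linarith), mul_one]
  calc _ ≤ 2 * ((2 * (bConst lam a * Real.exp z.1)) * ((2 * (bConst lam a *
        (Real.exp 1 + mollify lam Real.exp 0) * Real.exp z.2.1)) * 2 ^ m)) := by
        gcongr
    _ = _ := by ring

theorem setLIntegral_exp_mul_exp_lt_top {Y : Type*} [NormedAddCommGroup Y] [NormedSpace ℝ Y]
    [FiniteDimensional ℝ Y] [MeasurableSpace Y] [BorelSpace Y] (μ : Measure (ℝ × ℝ × Y))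
    [μ.IsAddHaarMeasure] {K : Set Y} (hK : IsCompact K) (k r t : ℝ) :
    ∫⁻ z in Iic r ×ˢ Iic t ×ˢ K, ENNReal.ofReal (k * (Real.exp z.1 * Real.exp z.2.1)) ∂μ < ⊤ := by
  let ν : Measure Y := (finBasis ℝ Y).addHaar
  rw [Measure.isAddLeftInvariant_eq_smul μ
    ((volume : Measure ℝ).prod ((volume : Measure ℝ).prod ν)), Measure.restrict_smul,
    lintegral_smul_measure, ENNReal.smul_def, smul_eq_mul]
  refine ENNReal.mul_lt_top ENNReal.coe_lt_top ?_
  rw [← Measure.prod_restrict, ← Measure.prod_restrict]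
  have : IsFiniteMeasure (ν.restrict K) := ⟨by simpa using hK.measure_lt_top⟩
  have h1 : Integrable (fun t : ℝ => Real.exp t) (volume.restrict (Iic t)) := integrableOn_exp_Iic t
  have h2 : Integrable (fun t : ℝ => Real.exp t) (volume.restrict (Iic r)) := integrableOn_exp_Iic r
  have h3 := h1.mul_prod (integrable_const (μ := ν.restrict K) (1 : ℝ))
  have h4 := ((h2.mul_prod h3).const_mul k).lintegral_lt_top
  simpa only [mul_one] using h4

section

variable {N : Type*} [TopologicalSpace N] [ChartedSpace (Euc m) N] [HyperbolicManifold m N]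
  {c₁ c₂ : ℝ} [Fact (0 < c₁)] [Fact (0 < c₂)]

theorem measurableSet_cusp : MeasurableSet[borel (ProdTotal c₁ c₂ N)]
    {p : ProdTotal c₁ c₂ N | p.1 ≤ -1 ∧ p.1 - 1 ≤ p.2.1 ∧ p.2.1 ≤ 2} := by
  let _ : MeasurableSpace (ProdTotal c₁ c₂ N) := borel _
  have : BorelSpace (ProdTotal c₁ c₂ N) := ⟨rfl⟩
  have h1 : Continuous fun p : ProdTotal c₁ c₂ N => p.1 := continuous_fst
  have h2 : Continuous fun p : ProdTotal c₁ c₂ N => p.2.1 := continuous_fst.comp continuous_snd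
  exact ((isClosed_le h1 continuous_const).inter ((isClosed_le (h1.sub continuous_const) h2).inter
    (isClosed_le h2 continuous_const))).measurableSet

theorem chartVolume_totalForm_lt_top (H : IsProfile R h lam) (ha : 5 < a)
    (HS : IsTail lam a C S S₁ S₂) (HT : IsTWith a CT T T₁ T₂)
    (HG : IsRiemannianForm (totalForm R h lam a S T m)) (p : ProdTotal c₁ c₂ N)
    {K : Set (AddCircle c₁ × AddCircle c₂ × N)} (hK : IsCompact K) (hKc : IsClosed K)
    (hKs : K ⊆ (extChartAt (𝓘(ℝ, ℝ).prod (𝓘(ℝ, ℝ).prod (𝓡 m))) p.2.2).source) :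
    chartVolume (RMetric.ofForm (M := ProdTotal c₁ c₂ N) HG isInvariantForm_totalForm) p
      ({p | p.1 ≤ -1 ∧ p.1 - 1 ≤ p.2.1 ∧ p.2.1 ≤ 2} ∩ {p | p.2.2 ∈ K}) < ⊤ := by
  have hA : MeasurableSet[borel (ProdTotal c₁ c₂ N)]
      ({p | p.1 ≤ -1 ∧ p.1 - 1 ≤ p.2.1 ∧ p.2.1 ≤ 2} ∩ {p | p.2.2 ∈ K}) := by
    let _ : MeasurableSpace (ProdTotal c₁ c₂ N) := borel _
    have : BorelSpace (ProdTotal c₁ c₂ N) := ⟨rfl⟩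
    exact measurableSet_cusp.inter
      (hKc.preimage (show Continuous fun p : ProdTotal c₁ c₂ N => p.2.2 by fun_prop)).measurableSet
  rw [chartVolume_ofForm_apply HG _ p hA]
  obtain ⟨k, hk, hd⟩ := exists_volume_density_le H ha HS HT m
  have hK' : IsCompact (extChartAt (𝓘(ℝ, ℝ).prod (𝓘(ℝ, ℝ).prod (𝓡 m))) p.2.2 '' K) :=
    hK.image_of_continuousOn ((continuousOn_extChartAt _).mono hKs)
  obtain ⟨D, hD⟩ := (hK'.image (f := fun w : ℝ × ℝ × Euc m => √(gramDet (unitForm m (0, 0, w))))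
    (((continuous_unitForm m).comp (by fun_prop)).gramDet.sqrt)).bddAbove
  refine lt_of_le_of_lt ?_ (setLIntegral_exp_mul_exp_lt_top
    (finBasis ℝ (ℝ × ℝ × ℝ × ℝ × Euc m)).addHaar hK' (k * D) (-1) 2)
  have hmem : ∀ z ∈ (extChartAt (totalModel m) p).target ∩ (extChartAt (totalModel m) p).symm ⁻¹'
      ({p | p.1 ≤ -1 ∧ p.1 - 1 ≤ p.2.1 ∧ p.2.1 ≤ 2} ∩ {p | p.2.2 ∈ K}),
      (z.1 ≤ -1 ∧ z.1 - 1 ≤ z.2.1 ∧ z.2.1 ≤ 2) ∧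
        z.2.2 ∈ extChartAt (𝓘(ℝ, ℝ).prod (𝓘(ℝ, ℝ).prod (𝓡 m))) p.2.2 '' K := by
    rintro z ⟨hz, hz1, hz2⟩
    rw [extChartAt_prod, PartialEquiv.prod_target, mem_prod, extChartAt_prod (x := p.2),
      PartialEquiv.prod_target, mem_prod] at hz
    have e : ((extChartAt (totalModel m) p).symm z) =
        (z.1, z.2.1, (extChartAt (𝓘(ℝ, ℝ).prod (𝓘(ℝ, ℝ).prod (𝓡 m))) p.2.2).symm z.2.2) := by
      rw [extChartAt_prod, extChartAt_prod (x := p.2)]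
      rfl
    rw [mem_ofPred_eq, e] at hz1 hz2
    exact ⟨hz1, _, hz2, (extChartAt _ p.2.2).right_inv hz.2.2⟩
  refine (setLIntegral_mono' (measurableSet_extChartAt_symm_preimage p hA)
    fun z hz => ?_).trans (lintegral_mono_set fun z hz => ?_)
  · obtain ⟨⟨h1, h2, h3⟩, h4⟩ := hmem z hz
    refine ENNReal.ofReal_le_ofReal ((hd z h1 h2 h3).trans ?_)
    have h5 := hD (mem_image_of_mem _ h4)
    have h6 := mul_le_mul_of_nonneg_left h5
      (mul_nonneg hk (mul_pos (Real.exp_pos z.1) (Real.exp_pos z.2.1)).le)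
    exact h6.trans_eq (by ring)
  · obtain ⟨⟨h1, h2, h3⟩, h4⟩ := hmem z hz
    exact ⟨h1, h3, h4⟩

theorem riemannianVolume_totalForm_lt_top [T2Space N] [CompactSpace N] (H : IsProfile R h lam)
    (ha : 5 < a) (HS : IsTail lam a C S S₁ S₂) (HT : IsTWith a CT T T₁ T₂)
    (HG : IsRiemannianForm (totalForm R h lam a S T m)) :
    riemannianVolume (RMetric.ofForm (M := ProdTotal c₁ c₂ N) HG isInvariantForm_totalForm)
      {p : ProdTotal c₁ c₂ N | p.1 ≤ -1 ∧ p.1 - 1 ≤ p.2.1 ∧ p.2.1 ≤ 2} < ⊤ := by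
  choose K hK hxK hKs using fun y : AddCircle c₁ × AddCircle c₂ × N => exists_compact_subset
    (isOpen_extChartAt_source (I := 𝓘(ℝ, ℝ).prod (𝓘(ℝ, ℝ).prod (𝓡 m))) y)
    (mem_extChartAt_source y)
  obtain ⟨t, -, ht⟩ := isCompact_univ.elim_nhds_subcover K
    fun y _ => mem_interior_iff_mem_nhds.1 (hxK y)
  refine lt_of_le_of_lt (riemannianVolume_ofForm_le HG isInvariantForm_totalForm t
    (fun y => (0, 0, y)) (fun y => {p | p.2.2 ∈ K y}) (fun y => ?_) (fun y => ?_) ?_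
    measurableSet_cusp) ?_
  · exact (hK y).isClosed.preimage (show Continuous fun p : ProdTotal c₁ c₂ N => p.2.2 by fun_prop)
  · intro p hp
    rw [extChartAt_prod, PartialEquiv.prod_source, mem_prod, extChartAt_prod,
      PartialEquiv.prod_source, mem_prod]
    simp only [extChartAt_model_space_eq_id]
    exact ⟨mem_univ _, mem_univ _, hKs y hp⟩
  · intro p _
    simpa using ht (mem_univ p.2.2)
  · exact ENNReal.sum_lt_top.2 fun y _ => chartVolume_totalForm_lt_top H ha HS HT HG (0, 0, y) (hK y)
      (hK y).isClosed (hKs y)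

end

end TotalVolume

theorem mainTheorem9 :
    (∃ R h lam : ℝ → ℝ, IsProfile R h lam) ∧
    ∀ R h lam : ℝ → ℝ, IsProfile R h lam → ∀ a : ℝ, 5 < a →
    ∃ (F : ℝ → ℝ → ℝ) (T : ℝ → ℝ) (C : ℝ), IsFtilde R lam a F ∧ IsT a T ∧ C < 0 ∧
    ∀ (m : ℕ) (N : Type*) [TopologicalSpace N] [T2Space N] [CompactSpace N]
      [ChartedSpace (Euc m) N] [HyperbolicManifold m N]
      (c₁ c₂ : ℝ) [Fact (0 < c₁)] [Fact (0 < c₂)],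
    ∃ (g : RMetric (totalModel m) (ProdTotal c₁ c₂ N)) (ghat : RMetric (fiberModel m) (ProdFiber c₁ c₂ N)),
      -- invariance under rotations of each circle
      (∀ (α : AddCircle c₁) (β : AddCircle c₂), PreservesMetric g (rotate α β)) ∧
      -- curvature bounds
      (∀ K ∈ sectionalCurvatures g, C ≤ K ∧ K < 0) ∧
      -- finite volume of the cusp region
      riemannianVolume g
        {p : ProdTotal c₁ c₂ N | p.1 ≤ -1 ∧ p.1 - 1 ≤ p.2.1 ∧ p.2.1 ≤ 2} < ⊤ ∧
      -- the metric for `r ≤ 0`, `t ≤ r - 1`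
      (∀ (r t : ℝ) (ρ : AddCircle c₁) (τ : AddCircle c₂) (x : N), r ≤ 0 → t ≤ r - 1 →
        ∀ u v : ℝ × ℝ × ℝ × ℝ × Euc m,
          g.inner (r, t, ρ, τ, x) u v = u.1 * v.1 + h r ^ 2 *
            fiberForm (bConst lam a * Real.exp r) (bConst lam a * Real.exp r) 1 x u.2 v.2) ∧
      -- the metric for `0 ≤ r`, `t ≤ -1`
      (∀ (r t : ℝ) (ρ : AddCircle c₁) (τ : AddCircle c₂) (x : N), 0 ≤ r → t ≤ -1 →
        ∀ u v : ℝ × ℝ × ℝ × ℝ × Euc m,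
          g.inner (r, t, ρ, τ, x) u v = u.1 * v.1 + h r ^ 2 *
            fiberForm (bConst lam a * Real.exp (R r)) (bConst lam a * Real.exp (R r)) 1
              x u.2 v.2) ∧
      -- the metric for `a ≤ t`
      (∀ (r t : ℝ) (ρ : AddCircle c₁) (τ : AddCircle c₂) (x : N), a ≤ t →
        ∀ u v : ℝ × ℝ × ℝ × ℝ × Euc m,
          g.inner (r, t, ρ, τ, x) u v = u.1 * v.1 + h r ^ 2 *
            fiberForm (bConst lam a * Real.exp (R r)) (Real.sinh (t - 5)) (Real.cosh (t - 5))
              x u.2 v.2) ∧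
      -- warped product for `5 ≤ r`
      (∀ (r t : ℝ) (ρ : AddCircle c₁) (τ : AddCircle c₂) (x : N), 5 ≤ r →
        (∀ u v : ℝ × ℝ × ℝ × ℝ × Euc m,
          g.inner (r, t, ρ, τ, x) u v = u.1 * v.1 + 4 * Real.exp (2 * r) *
            ghat.inner (t, ρ, τ, x) u.2 v.2) ∧
        (∀ u v : ℝ × ℝ × ℝ × Euc m,
          ghat.inner (t, ρ, τ, x) u v =
            fiberForm (bConst lam a * Real.exp 3) (F r t) (T t) x u v)) ∧
      -- curvature of the fiber metric
      (∀ K ∈ sectionalCurvatures ghat, K ≤ 0) := by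
  refine ⟨exists_isProfile, fun R h lam H a ha => ?_⟩
  obtain ⟨C, S, S₁, S₂, hC, HS⟩ := exists_isTail H.isMollifier ha
  obtain ⟨CT, T, T₁, T₂, hCT, HT⟩ := exists_isTWith ha
  obtain ⟨k, hk, hcurv⟩ := exists_curvature_bounds_totalForm H ha HS hC HT hCT
  have HF := isFtilde_ftilde H ha HS
  refine ⟨ftilde R lam a S, T, -k, HF, HT.isT, neg_lt_zero.2 hk, ?_⟩
  intro m N _ _ _ _ _ c₁ c₂ _ _
  have HG := isRiemannianForm_totalForm H ha HS HT m
  have HG' := isRiemannianForm_sliceForm H ha HS HT m 5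
  have hflat : ∀ {r t : ℝ}, t ≤ 4 → t - R r ≤ -1 → ftilde R lam a S r t = radialCoeff R lam a r := by
    intro r t h1 h2
    rw [HF.left r t (by linarith), H.isMollifier.mollify_fbar_of_le h2, mul_one, radialCoeff]
  refine ⟨RMetric.ofForm HG isInvariantForm_totalForm,
    RMetric.ofForm HG' (isInvariantForm_sliceForm 5), preservesMetric_rotate HG, ?_,
    riemannianVolume_totalForm_lt_top H ha HS HT HG, ?_, ?_, ?_, ?_, ?_⟩
  · intro K hK
    obtain ⟨y, u, v, huv, rfl⟩ := exists_eq_of_mem_sectionalCurvatures_ofForm HG _ hK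
    exact hcurv m y u v huv
  · intro r t ρ τ x hr ht u v
    have hR := H.R_left r (by linarith)
    rw [ofForm_totalForm_inner, hflat (by linarith) (by linarith), HT.left t (by linarith),
      radialCoeff, hR]
  · intro r t ρ τ x hr ht u v
    have hR := H.R_nonneg hr
    rw [ofForm_totalForm_inner, hflat (by linarith) (by linarith), HT.left t (by linarith),
      radialCoeff]
  · intro r t ρ τ x ht u v
    rw [ofForm_totalForm_inner, HF.right r t ht, HT.right t ht, radialCoeff]
  · intro r t ρ τ x hr
    have e3 : radialCoeff R lam a r = bConst lam a * Real.exp 3 := by rw [radialCoeff, H.R_right r hr]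
    have e3' : radialCoeff R lam a 5 = bConst lam a * Real.exp 3 := by
      rw [radialCoeff, H.R_right 5 le_rfl]
    have eF := HF.indep_r 5 r t le_rfl hr
    constructor
    · intro u v
      rw [ofForm_totalForm_inner, ofForm_sliceForm_inner, e3, e3', eF, H.h_right r (by linarith),
        mul_pow, ← Real.exp_nat_mul]
      norm_num
    · intro u v
      rw [ofForm_sliceForm_inner, e3', eF]
  · intro K hK
    obtain ⟨y, u, v, huv, rfl⟩ := exists_eq_of_mem_sectionalCurvatures_ofForm HG' _ hK
    exact localSectionalCurvature_sliceForm_nonpos H ha HS HT 5 huv
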